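/- All manifolds and maps are smooth ($C^\infty$); manifolds are Hausdorff and without boundary unless stated otherwise. A presymplectic form on a manifold of odd dimension $2n+1$ is a closed 2-form of rank $2n$ at every point. Cohomology is de Rham cohomology with real coefficients. Let $B$ and $F$ be closed manifolds, let $\omega_0$ be a symplectic form on $F$, and let $N_0\subset F$ be a compact smooth codimension-zero submanifold (with boundary). Let $\mathrm{Symp}(F,N_0,\omega_0)$ be the group of diffeomorphisms of $F$ that preserve $\omega_0$ and fix every point of $N_0$. Let $p:M\to B$ be a smooth fibre bundle with fibre $F$ and structure group $\mathrm{Symp}(F,N_0,\omega_0)$; that is, $M$ has an atlas of smooth local trivializations $p^{-1}(U)\cong U\times F$ whose transition maps restrict, over each point $b$ of the overlap, to an element of $\mathrm{Symp}(F,N_0,\omega_0)$. For $b\in B$ let $i_b:F_b=p^{-1}(b)\hookrightarrow M$ be the inclusion of the fibre and let $\omega_b$ be the symplectic form on $F_b$ that corresponds to $\omega_0$ in the local trivializations. Let $N\subset M$ be the submanifold of all points whose fibre coordinate in a local trivialization lies in $N_0$; canonically $N=N_0\times B$. Let $\omega_N$ be the closed 2-form on $N$ obtained by pulling back $\omega_0$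 under the projection $N\to N_0\subset F$. Let $\omega_B$ be a presymplectic form on $B$ and let $u\in H^2(M;\mathbb R)$ be a class such that 1. $i_b^*u=[\omega_b]$ in $H^2(F_b;\mathbb R)$ for every $b\in B$, and 2. $u|_N=[\omega_N]$ in $H^2(N;\mathbb R)$. Then there exist a constant $K>0$ and a presymplectic form $\tau$ on $M$ such that $[\tau]=u+K\,p^*[\omega_B]$ in $H^2(M;\mathbb R)$ and $\tau=\omega_N+K\,p^*\omega_B$ at every point of $N$. -/

import Mathlib

open scoped Manifold ContDiff Topology
open Bundle

noncomputable section

/-! ### Differential forms on boundaryless manifolds -/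

section Forms

variable {E : Type*} [NormedAddCommGroup E] [NormedSpace ℝ E]
  {M : Type*} [TopologicalSpace M] [ChartedSpace E M]
  {E' : Type*} [NormedAddCommGroup E'] [NormedSpace ℝ E']
  {M' : Type*} [TopologicalSpace M'] [ChartedSpace E' M']
  {k : ℕ}

/-- A (not necessarily smooth) differential `k`-form on a manifold `M` modelled on `E`: an
alternating `k`-linear form on every tangent space. -/
def DForm (E : Type*) [NormedAddCommGroup E] [NormedSpace ℝ E]
    (M : Type*) [TopologicalSpace M] [ChartedSpace E M] (k : ℕ) : Type _ :=
  ∀ x : M, (TangentSpace 𝓘(ℝ, E) x) [⋀^Fin k]→L[ℝ] ℝ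

namespace DForm

instance : AddCommGroup (DForm E M k) :=
  inferInstanceAs (AddCommGroup (∀ x : M, (TangentSpace 𝓘(ℝ, E) x) [⋀^Fin k]→L[ℝ] ℝ))

instance : Module ℝ (DForm E M k) :=
  inferInstanceAs (Module ℝ (∀ x : M, (TangentSpace 𝓘(ℝ, E) x) [⋀^Fin k]→L[ℝ] ℝ))

theorem zero_apply (x : M) : (0 : DForm E M k) x = 0 := rfl

theorem add_apply (α β : DForm E M k) (x : M) : (α + β) x = α x + β x := rfl

theorem smul_apply (c : ℝ) (α : DForm E M k) (x : M) : (c • α) x = c • α x := rfl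

/-- The pull-back `f^* α` of a form along a map `f`. -/
def pullback (E : Type*) [NormedAddCommGroup E] [NormedSpace ℝ E]
    {M : Type*} [TopologicalSpace M] [ChartedSpace E M]
    (f : M → M') (α : DForm E' M' k) : DForm E M k :=
  fun x => (α (f x)).compContinuousLinearMap (mfderiv 𝓘(ℝ, E) 𝓘(ℝ, E') f x)

/-- The local expression of a form in the preferred chart at `x₀`: the pull-back along the inverse
of this chart (meaningful on the target of the chart). -/
def inChart (α : DForm E M k) (x₀ : M) : E → E [⋀^Fin k]→L[ℝ] ℝ :=
  fun y => (α ((chartAt E x₀).symm y)).compContinuousLinearMap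
    (mfderiv 𝓘(ℝ, E) 𝓘(ℝ, E) (chartAt E x₀).symm y)

/-- A form is smooth at `x` if its local expression in the chart at `x` is. -/
def SmoothAt (α : DForm E M k) (x : M) : Prop :=
  ContDiffAt ℝ ∞ (α.inChart x) (chartAt E x x)

/-- A smooth form. -/
def Smooth (α : DForm E M k) : Prop := ∀ x, α.SmoothAt x

/-- The exterior derivative, computed at each point `x` in the chart at `x`. -/
def extD (α : DForm E M k) : DForm E M (k + 1) :=
  fun x => (extDeriv (α.inChart x) (chartAt E x x)).compContinuousLinearMap
    (mfderiv 𝓘(ℝ, E) 𝓘(ℝ, E) (chartAt E x) x)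

theorem inChart_add (α β : DForm E M k) (x₀ : M) :
    inChart (α + β) x₀ = α.inChart x₀ + β.inChart x₀ := rfl

theorem inChart_smul (c : ℝ) (α : DForm E M k) (x₀ : M) :
    inChart (c • α) x₀ = c • α.inChart x₀ := rfl

theorem inChart_zero (x₀ : M) : inChart (0 : DForm E M k) x₀ = 0 := rfl

theorem SmoothAt.zero (x : M) : DForm.SmoothAt (0 : DForm E M k) x := by
  rw [SmoothAt, inChart_zero]; exact contDiffAt_const

theorem SmoothAt.add {α β : DForm E M k} {x : M} (hα : α.SmoothAt x) (hβ : β.SmoothAt x) :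
    DForm.SmoothAt (α + β) x := ContDiffAt.add hα hβ

theorem SmoothAt.smul (c : ℝ) {α : DForm E M k} {x : M} (hα : α.SmoothAt x) :
    DForm.SmoothAt (c • α) x := ContDiffAt.const_smul c hα

theorem SmoothAt.differentiableAt {α : DForm E M k} {x : M} (hα : α.SmoothAt x) :
    DifferentiableAt ℝ (α.inChart x) (chartAt E x x) :=
  ContDiffAt.differentiableAt hα (by simp)

theorem extD_zero : extD (0 : DForm E M k) = 0 := by
  funext x
  have h : extDeriv (0 : E → E [⋀^Fin k]→L[ℝ] ℝ) (chartAt E x x) = 0 := by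
    have := extDeriv_smul (x := chartAt E x x) (0 : ℝ) (0 : E → E [⋀^Fin k]→L[ℝ] ℝ)
    simpa using this
  simp only [extD, inChart_zero, h]
  rfl

theorem extD_add_apply {α β : DForm E M k} {x : M} (hα : α.SmoothAt x) (hβ : β.SmoothAt x) :
    extD (α + β) x = α.extD x + β.extD x := by
  simp only [extD, inChart_add, extDeriv_add hα.differentiableAt hβ.differentiableAt]
  rfl

theorem extD_smul_apply (c : ℝ) (α : DForm E M k) (x : M) :
    extD (c • α) x = c • α.extD x := by
  simp only [extD, inChart_smul, extDeriv_smul]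
  rfl

/-! ### Naturality of the exterior derivative -/

theorem contDiffAt_compContinuousLinearMap [FiniteDimensional ℝ E] [FiniteDimensional ℝ E']
    {a : E → E' [⋀^Fin k]→L[ℝ] ℝ} {g : E → E →L[ℝ] E'} {y : E}
    (ha : ContDiffAt ℝ ∞ a y) (hg : ContDiffAt ℝ ∞ g y) :
    ContDiffAt ℝ ∞ (fun z => (a z).compContinuousLinearMap (g z)) y := by
  have hfin : FiniteDimensional ℝ (ContinuousMultilinearMap ℝ (fun _ : Fin k => E) ℝ) :=
    Module.Finite.of_injective
      (ContinuousMultilinearMap.toMultilinearMapLinear (R' := ℝ) (A := ℝ)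
        (M₁ := fun _ : Fin k => E) (M₂ := ℝ))
      ContinuousMultilinearMap.toMultilinearMap_injective
  let J : (E [⋀^Fin k]→L[ℝ] ℝ) →ₗ[ℝ] ContinuousMultilinearMap ℝ (fun _ : Fin k => E) ℝ :=
    (ContinuousAlternatingMap.toContinuousMultilinearMapLI (𝕜 := ℝ) (E := E) (F := ℝ)
      (ι := Fin k)).toLinearMap
  have hJ : Function.Injective J := ContinuousAlternatingMap.toContinuousMultilinearMap_injective
  obtain ⟨L, hL⟩ := J.exists_leftInverse_of_injective (LinearMap.ker_eq_bot.2 hJ)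
  have hLc : ContDiff ℝ ∞ L := (LinearMap.toContinuousLinearMap L).contDiff
  have h1 : ContDiffAt ℝ ∞ (fun z => (a z).toContinuousMultilinearMap) y :=
    ((ContinuousAlternatingMap.toContinuousMultilinearMapLI (𝕜 := ℝ) (E := E') (F := ℝ)
      (ι := Fin k)).toContinuousLinearMap.contDiff.contDiffAt (x := a y)).comp y ha
  have h2 : ContDiffAt ℝ ∞ (fun z => ((fun _ : Fin k => g z), (a z).toContinuousMultilinearMap)) y :=
    (contDiffAt_pi.2 fun _ => hg).prodMk h1
  have h3 : ContDiffAt ℝ ∞ (fun z => ContinuousMultilinearMap.compContinuousLinearMap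
      (a z).toContinuousMultilinearMap (fun _ : Fin k => g z)) y :=
    (ContinuousMultilinearMap.analyticAt_uncurry_compContinuousLinearMap
      (𝕜 := ℝ) (Fm := fun _ : Fin k => E) (Em := fun _ : Fin k => E') (G := ℝ)
      (q := ((fun _ => g y), (a y).toContinuousMultilinearMap))).contDiffAt.fun_comp y h2
  have h4 := hLc.contDiffAt.comp y h3
  refine h4.congr_of_eventuallyEq (Filter.Eventually.of_forall fun z => ?_)
  have := LinearMap.congr_fun hL ((a z).compContinuousLinearMap (g z))
  exact this.symm

/-- The map `f` read in the preferred charts at `x` and `f x`. -/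
def mapInCharts (E E' : Type*) [NormedAddCommGroup E] [NormedSpace ℝ E]
    [NormedAddCommGroup E'] [NormedSpace ℝ E']
    {M : Type*} [TopologicalSpace M] [ChartedSpace E M]
    {M' : Type*} [TopologicalSpace M'] [ChartedSpace E' M'] (f : M → M') (x : M) : E → E' :=
  chartAt E' (f x) ∘ f ∘ (chartAt E x).symm

theorem contDiffAt_mapInCharts {f : M → M'} {x : M}
    (hf : ContMDiffAt 𝓘(ℝ, E) 𝓘(ℝ, E') ∞ f x) :
    ContDiffAt ℝ ∞ (mapInCharts E E' f x) (chartAt E x x) := by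
  have := (contMDiffAt_iff.1 hf).2
  simpa [mapInCharts, contDiffWithinAt_univ] using this

theorem congr_point (α : DForm E M k) {w w' : M} (h : w = w') :
    (show E [⋀^Fin k]→L[ℝ] ℝ from α w) = (show E [⋀^Fin k]→L[ℝ] ℝ from α w') := by
  subst h; rfl

variable [IsManifold 𝓘(ℝ, E) ∞ M] [IsManifold 𝓘(ℝ, E') ∞ M']

theorem inChart_pullback {f : M → M'} {x : M}
    (hf : ContMDiffAt 𝓘(ℝ, E) 𝓘(ℝ, E') ∞ f x) (α : DForm E' M' k) :
    inChart (pullback E f α) x =ᶠ[𝓝 (chartAt E x x)]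
      fun y => (α.inChart (f x) (mapInCharts E E' f x y)).compContinuousLinearMap
        (fderiv ℝ (mapInCharts E E' f x) y) := by
  have hm : ∀ᶠ z in 𝓝 x, ContMDiffAt 𝓘(ℝ, E) 𝓘(ℝ, E') 1 f z := by
    have h1 : ContMDiffAt 𝓘(ℝ, E) 𝓘(ℝ, E') 1 f x := ContMDiffAt.of_le hf (by simp)
    exact (contMDiffAt_iff_contMDiffAt_nhds (by simp)).1 h1
  have hs : ∀ᶠ z in 𝓝 x, f z ∈ (chartAt E' (f x)).source :=
    hf.continuousAt.eventually ((chartAt E' (f x)).open_source.mem_nhds (mem_chart_source E' (f x)))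
  have hsymm : Filter.Tendsto (chartAt E x).symm (𝓝 (chartAt E x x)) (𝓝 x) := by
    have := (chartAt E x).continuousAt_symm (mem_chart_target E x)
    simpa [ContinuousAt] using this
  have ht : ∀ᶠ y in 𝓝 (chartAt E x x), y ∈ (chartAt E x).target :=
    (chartAt E x).open_target.mem_nhds (mem_chart_target E x)
  have hg1 : ∀ᶠ y in 𝓝 (chartAt E x x), DifferentiableAt ℝ (mapInCharts E E' f x) y :=
    (((contDiffAt_mapInCharts hf).of_le (m := 1) (by exact_mod_cast le_top)).eventually
      (by simp)).mono fun y hy => hy.differentiableAt (by simp)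
  filter_upwards [hsymm.eventually hm, hsymm.eventually hs, ht, hg1,
    (hsymm.eventually hs).eventually_nhds] with y h1 h2 h3 h4 h5
  have hpt : (chartAt E' (f x)).symm (mapInCharts E E' f x y) = f ((chartAt E x).symm y) :=
    (chartAt E' (f x)).left_inv h2
  have hEq : (chartAt E' (f x)).symm ∘ mapInCharts E E' f x =ᶠ[𝓝 y] f ∘ (chartAt E x).symm :=
    h5.mono fun z hz => (chartAt E' (f x)).left_inv hz
  have hφ : MDifferentiableAt 𝓘(ℝ, E) 𝓘(ℝ, E) (chartAt E x).symm y :=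
    haveI := IsManifold.of_le (I := 𝓘(ℝ, E)) (M := M) (m := 1) (n := ∞) (by simp)
    mdifferentiableAt_atlas_symm (chart_mem_atlas E x) h3
  have hψ : MDifferentiableAt 𝓘(ℝ, E') 𝓘(ℝ, E') (chartAt E' (f x)).symm
      (mapInCharts E E' f x y) :=
    haveI := IsManifold.of_le (I := 𝓘(ℝ, E')) (M := M') (m := 1) (n := ∞) (by simp)
    mdifferentiableAt_atlas_symm (chart_mem_atlas E' (f x)) ((chartAt E' (f x)).map_source h2)
  have hc1 := mfderiv_comp y (h1.mdifferentiableAt (by simp)) hφ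
  have hc2 := mfderiv_comp y hψ h4.mdifferentiableAt
  rw [hEq.mfderiv_eq, hc1] at hc2
  rw [mfderiv_eq_fderiv] at hc2
  have key : ∀ w : E, (mfderiv 𝓘(ℝ, E) 𝓘(ℝ, E') f ((chartAt E x).symm y)
      (mfderiv 𝓘(ℝ, E) 𝓘(ℝ, E) (chartAt E x).symm y w) : E') =
      (mfderiv 𝓘(ℝ, E') 𝓘(ℝ, E') (chartAt E' (f x)).symm (mapInCharts E E' f x y)
        (fderiv ℝ (mapInCharts E E' f x) y w) : E') := fun w => congrArg (fun T : E →L[ℝ] E' => T w) hc2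
  ext v
  refine (congrArg (fun u : Fin k → E' =>
    (show E' [⋀^Fin k]→L[ℝ] ℝ from α (f ((chartAt E x).symm y))) u)
      (funext fun i => key (v i))).trans ?_
  exact congrArg (fun β : E' [⋀^Fin k]→L[ℝ] ℝ => β fun i =>
    (mfderiv 𝓘(ℝ, E') 𝓘(ℝ, E') (chartAt E' (f x)).symm (mapInCharts E E' f x y)
        (fderiv ℝ (mapInCharts E E' f x) y (v i)) : E'))
    (congr_point α hpt.symm)

theorem SmoothAt.pullback [FiniteDimensional ℝ E] [FiniteDimensional ℝ E'] {f : M → M'} {x : M}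
    {α : DForm E' M' k} (hα : α.SmoothAt (f x)) (hf : ContMDiffAt 𝓘(ℝ, E) 𝓘(ℝ, E') ∞ f x) :
    DForm.SmoothAt (DForm.pullback E f α) x := by
  have hg := contDiffAt_mapInCharts hf
  have hx : mapInCharts E E' f x (chartAt E x x) = chartAt E' (f x) (f x) := by
    simp [mapInCharts]
  refine ContDiffAt.congr_of_eventuallyEq ?_ (inChart_pullback hf α)
  refine contDiffAt_compContinuousLinearMap (ContDiffAt.fun_comp _ ?_ hg)
    (hg.fderiv_right (m := ∞) (by simp))
  rw [hx]; exact hα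

theorem extD_pullback {f : M → M'} {x : M} {α : DForm E' M' k} (hα : α.SmoothAt (f x))
    (hf : ContMDiffAt 𝓘(ℝ, E) 𝓘(ℝ, E') ∞ f x) :
    extD (pullback E f α) x = pullback E f α.extD x := by
  have hg := contDiffAt_mapInCharts hf
  have hx : mapInCharts E E' f x (chartAt E x x) = chartAt E' (f x) (f x) := by
    simp [mapInCharts]
  have hφ : MDifferentiableAt 𝓘(ℝ, E) 𝓘(ℝ, E) (chartAt E x) x :=
    haveI := IsManifold.of_le (I := 𝓘(ℝ, E)) (M := M) (m := 1) (n := ∞) (by simp)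
    mdifferentiableAt_atlas (chart_mem_atlas E x) (mem_chart_source E x)
  have hψ : MDifferentiableAt 𝓘(ℝ, E') 𝓘(ℝ, E') (chartAt E' (f x)) (f x) :=
    haveI := IsManifold.of_le (I := 𝓘(ℝ, E')) (M := M') (m := 1) (n := ∞) (by simp)
    mdifferentiableAt_atlas (chart_mem_atlas E' (f x)) (mem_chart_source E' (f x))
  have hEq : mapInCharts E E' f x ∘ chartAt E x =ᶠ[𝓝 x] chartAt E' (f x) ∘ f := by
    filter_upwards [(chartAt E x).open_source.mem_nhds (mem_chart_source E x)] with z hz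
    simp [mapInCharts, (chartAt E x).left_inv hz]
  have hc1 := mfderiv_comp x (hg.differentiableAt (by simp)).mdifferentiableAt hφ
  have hc2 := mfderiv_comp x hψ (hf.mdifferentiableAt (by simp))
  rw [hEq.mfderiv_eq, hc2] at hc1
  rw [mfderiv_eq_fderiv] at hc1
  have hd : DifferentiableAt ℝ (α.inChart (f x)) (mapInCharts E E' f x (chartAt E x x)) := by
    rw [hx]; exact hα.differentiableAt
  have h1 : extDeriv (inChart (pullback E f α) x) (chartAt E x x) =
      (extDeriv (α.inChart (f x)) (chartAt E' (f x) (f x))).compContinuousLinearMap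
        (fderiv ℝ (mapInCharts E E' f x) (chartAt E x x)) := by
    rw [(inChart_pullback hf α).extDeriv_eq, extDeriv_pullback hd hg (by simp; exact WithTop.coe_le_coe.2 le_top), hx]
  have key : ∀ w : E, (mfderiv 𝓘(ℝ, E') 𝓘(ℝ, E') (chartAt E' (f x)) (f x)
      (mfderiv 𝓘(ℝ, E) 𝓘(ℝ, E') f x w) : E') =
      (fderiv ℝ (mapInCharts E E' f x) (chartAt E x x)
        (mfderiv 𝓘(ℝ, E) 𝓘(ℝ, E) (chartAt E x) x w) : E') :=
    fun w => congrArg (fun T : E →L[ℝ] E' => T w) hc1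
  simp only [extD, h1]
  ext v
  exact congrArg (fun u : Fin (k + 1) → E' =>
    extDeriv (α.inChart (f x)) (chartAt E' (f x) (f x)) u) (funext fun i => (key (v i)).symm)

end DForm

end Forms

/-! ### Closed and exact forms, de Rham cohomology in degree two -/

section Cohomology

variable {E : Type*} [NormedAddCommGroup E] [NormedSpace ℝ E]
  {M : Type*} [TopologicalSpace M] [ChartedSpace E M]
  {E' : Type*} [NormedAddCommGroup E'] [NormedSpace ℝ E']
  {M' : Type*} [TopologicalSpace M'] [ChartedSpace E' M']
  {k : ℕ}

/-- The pull-back of forms as a linear map. -/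
def DForm.pullbackₗ (E : Type*) [NormedAddCommGroup E] [NormedSpace ℝ E]
    {M : Type*} [TopologicalSpace M] [ChartedSpace E M]
    (f : M → M') : DForm E' M' k →ₗ[ℝ] DForm E M k where
  toFun α := DForm.pullback E f α
  map_add' _ _ := rfl
  map_smul' _ _ := rfl

/-- The space of closed smooth `k`-forms on `M`. -/
def closedForms (E : Type*) [NormedAddCommGroup E] [NormedSpace ℝ E]
    (M : Type*) [TopologicalSpace M] [ChartedSpace E M] (k : ℕ) : Submodule ℝ (DForm E M k) where
  carrier := {α | DForm.Smooth α ∧ DForm.extD α = 0}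
  zero_mem' := ⟨fun x => .zero x, DForm.extD_zero⟩
  add_mem' := by
    rintro α β ⟨h1, h2⟩ ⟨h3, h4⟩
    refine ⟨fun x => (h1 x).add (h3 x), funext fun x => ?_⟩
    rw [DForm.extD_add_apply (h1 x) (h3 x), h2, h4, DForm.zero_apply, add_zero]
  smul_mem' := by
    rintro c α ⟨h1, h2⟩
    refine ⟨fun x => (h1 x).smul c, funext fun x => ?_⟩
    rw [DForm.extD_smul_apply, h2, DForm.zero_apply, smul_zero]

/-- The space of exact `(k + 1)`-forms on `M`: the differentials of smooth `k`-forms. -/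
def exactForms (E : Type*) [NormedAddCommGroup E] [NormedSpace ℝ E]
    (M : Type*) [TopologicalSpace M] [ChartedSpace E M] (k : ℕ) :
    Submodule ℝ (DForm E M (k + 1)) where
  carrier := {α | ∃ β : DForm E M k, DForm.Smooth β ∧ DForm.extD β = α}
  zero_mem' := ⟨0, fun x => .zero x, DForm.extD_zero⟩
  add_mem' := by
    rintro _ _ ⟨α, h1, rfl⟩ ⟨β, h3, rfl⟩
    exact ⟨α + β, fun x => (h1 x).add (h3 x),
      funext fun x => DForm.extD_add_apply (h1 x) (h3 x)⟩
  smul_mem' := by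
    rintro c _ ⟨α, h1, rfl⟩
    exact ⟨c • α, fun x => (h1 x).smul c, funext fun x => DForm.extD_smul_apply c α x⟩

/-- The second de Rham cohomology `H²(M; ℝ)`: closed smooth 2-forms modulo exact ones. -/
abbrev H2 (E : Type*) [NormedAddCommGroup E] [NormedSpace ℝ E]
    (M : Type*) [TopologicalSpace M] [ChartedSpace E M] : Type _ :=
  closedForms E M 2 ⧸ (exactForms E M 1).comap (closedForms E M 2).subtype

/-- The cohomology class of a closed smooth 2-form. -/
def H2.mk (α : DForm E M 2) (hα : α ∈ closedForms E M 2) : H2 E M :=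
  Submodule.Quotient.mk ⟨α, hα⟩

section Pullback

variable [FiniteDimensional ℝ E] [FiniteDimensional ℝ E']
  [IsManifold 𝓘(ℝ, E) ∞ M] [IsManifold 𝓘(ℝ, E') ∞ M']

theorem pullback_mem_closedForms {f : M → M'} (hf : ContMDiff 𝓘(ℝ, E) 𝓘(ℝ, E') ∞ f)
    {α : DForm E' M' k} (hα : α ∈ closedForms E' M' k) :
    DForm.pullback E f α ∈ closedForms E M k := by
  refine ⟨fun x => (hα.1 (f x)).pullback (hf x), funext fun x => ?_⟩
  rw [DForm.extD_pullback (hα.1 (f x)) (hf x), hα.2]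
  exact ContinuousAlternatingMap.ext fun _ => rfl

theorem pullback_mem_exactForms {f : M → M'} (hf : ContMDiff 𝓘(ℝ, E) 𝓘(ℝ, E') ∞ f)
    {α : DForm E' M' (k + 1)} (hα : α ∈ exactForms E' M' k) :
    DForm.pullback E f α ∈ exactForms E M k := by
  obtain ⟨β, hβ, rfl⟩ := hα
  exact ⟨DForm.pullback E f β, fun x => (hβ (f x)).pullback (hf x),
    funext fun x => DForm.extD_pullback (hβ (f x)) (hf x)⟩

/-- The map `f^* : H²(M') → H²(M)` induced by a smooth map `f : M → M'`. -/
def H2.pullback (f : M → M') (hf : ContMDiff 𝓘(ℝ, E) 𝓘(ℝ, E') ∞ f) :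
    H2 E' M' →ₗ[ℝ] H2 E M :=
  Submodule.mapQ _ _
    ((DForm.pullbackₗ E f).restrict (p := closedForms E' M' 2) (q := closedForms E M 2)
      fun _ hα => pullback_mem_closedForms hf hα)
    fun _ hα => pullback_mem_exactForms hf hα

end Pullback

/-! ### Forms and cohomology on a codimension zero submanifold

Forms on a subset `N` of `M` (in practice a codimension zero submanifold with boundary, so that
`T_xN = T_xM` for `x ∈ N`) are represented by forms on `M`, whose values outside `N` are irrelevant.
As usual, smoothness on `N` means that the form extends smoothly to a neighbourhood in `M` of each
point of `N`; the exterior derivative at points of `N` is that of such an extension. -/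

/-- The closed smooth `k`-forms on `N ⊆ M`. -/
def closedFormsOn (E : Type*) [NormedAddCommGroup E] [NormedSpace ℝ E]
    {M : Type*} [TopologicalSpace M] [ChartedSpace E M] (N : Set M) (k : ℕ) :
    Submodule ℝ (DForm E M k) where
  carrier := {α | ∀ x ∈ N, ∃ α' : DForm E M k, ∀ᶠ y in 𝓝 x,
    DForm.SmoothAt α' y ∧ (y ∈ N → α' y = α y ∧ DForm.extD α' y = 0)}
  zero_mem' := fun x _ => ⟨0, Filter.Eventually.of_forall fun y =>
    ⟨.zero y, fun _ => ⟨rfl, congrFun DForm.extD_zero y⟩⟩⟩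
  add_mem' := by
    intro α β hα hβ x hx
    obtain ⟨α', hα'⟩ := hα x hx
    obtain ⟨β', hβ'⟩ := hβ x hx
    refine ⟨α' + β', ?_⟩
    filter_upwards [hα', hβ'] with y h1 h2
    refine ⟨h1.1.add h2.1, fun hy => ⟨?_, ?_⟩⟩
    · rw [DForm.add_apply, DForm.add_apply, (h1.2 hy).1, (h2.2 hy).1]
    · rw [DForm.extD_add_apply h1.1 h2.1, (h1.2 hy).2, (h2.2 hy).2, add_zero]
  smul_mem' := by
    intro c α hα x hx
    obtain ⟨α', hα'⟩ := hα x hx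
    refine ⟨c • α', ?_⟩
    filter_upwards [hα'] with y h1
    refine ⟨h1.1.smul c, fun hy => ⟨?_, ?_⟩⟩
    · rw [DForm.smul_apply, DForm.smul_apply, (h1.2 hy).1]
    · rw [DForm.extD_smul_apply, (h1.2 hy).2, smul_zero]

/-- The exact `(k + 1)`-forms on `N ⊆ M`: those equal on `N` to `dβ` for a smooth `k`-form `β` on
`N`. -/
def exactFormsOn (E : Type*) [NormedAddCommGroup E] [NormedSpace ℝ E]
    {M : Type*} [TopologicalSpace M] [ChartedSpace E M] (N : Set M) (k : ℕ) :
    Submodule ℝ (DForm E M (k + 1)) where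
  carrier := {α | ∃ β : DForm E M k, ∀ x ∈ N, ∃ β' : DForm E M k, ∀ᶠ y in 𝓝 x,
    DForm.SmoothAt β' y ∧ (y ∈ N → β' y = β y ∧ DForm.extD β' y = α y)}
  zero_mem' := ⟨0, fun x _ => ⟨0, Filter.Eventually.of_forall fun y =>
    ⟨.zero y, fun _ => ⟨rfl, congrFun DForm.extD_zero y⟩⟩⟩⟩
  add_mem' := by
    rintro α₁ α₂ ⟨β₁, h₁⟩ ⟨β₂, h₂⟩
    refine ⟨β₁ + β₂, fun x hx => ?_⟩
    obtain ⟨β₁', h₁'⟩ := h₁ x hx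
    obtain ⟨β₂', h₂'⟩ := h₂ x hx
    refine ⟨β₁' + β₂', ?_⟩
    filter_upwards [h₁', h₂'] with y h1 h2
    refine ⟨h1.1.add h2.1, fun hy => ⟨?_, ?_⟩⟩
    · rw [DForm.add_apply, DForm.add_apply, (h1.2 hy).1, (h2.2 hy).1]
    · rw [DForm.extD_add_apply h1.1 h2.1, (h1.2 hy).2, (h2.2 hy).2, DForm.add_apply]
  smul_mem' := by
    rintro c α ⟨β, h⟩
    refine ⟨c • β, fun x hx => ?_⟩
    obtain ⟨β', h'⟩ := h x hx
    refine ⟨c • β', ?_⟩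
    filter_upwards [h'] with y h1
    refine ⟨h1.1.smul c, fun hy => ⟨?_, ?_⟩⟩
    · rw [DForm.smul_apply, DForm.smul_apply, (h1.2 hy).1]
    · rw [DForm.extD_smul_apply, (h1.2 hy).2, DForm.smul_apply]

/-- The second de Rham cohomology `H²(N; ℝ)` of a codimension zero submanifold `N ⊆ M`. -/
abbrev H2On (E : Type*) [NormedAddCommGroup E] [NormedSpace ℝ E]
    {M : Type*} [TopologicalSpace M] [ChartedSpace E M] (N : Set M) : Type _ :=
  closedFormsOn E N 2 ⧸ (exactFormsOn E N 1).comap (closedFormsOn E N 2).subtype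

/-- The cohomology class of a closed smooth 2-form on `N`. -/
def H2On.mk {N : Set M} (α : DForm E M 2) (hα : α ∈ closedFormsOn E N 2) : H2On E N :=
  Submodule.Quotient.mk ⟨α, hα⟩

theorem closedForms_le_closedFormsOn (N : Set M) : closedForms E M k ≤ closedFormsOn E N k :=
  fun α hα _ _ => ⟨α, Filter.Eventually.of_forall fun y =>
    ⟨hα.1 y, fun _ => ⟨rfl, congrFun hα.2 y⟩⟩⟩

theorem exactForms_le_exactFormsOn (N : Set M) : exactForms E M k ≤ exactFormsOn E N k := by
  rintro _ ⟨β, hβ, rfl⟩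
  exact ⟨β, fun _ _ => ⟨β, Filter.Eventually.of_forall fun y => ⟨hβ y, fun _ => ⟨rfl, rfl⟩⟩⟩⟩

/-- The restriction map `H²(M) → H²(N)`, `u ↦ u|N`. -/
def H2.restrict (N : Set M) : H2 E M →ₗ[ℝ] H2On E N :=
  Submodule.mapQ _ _ (Submodule.inclusion (closedForms_le_closedFormsOn N))
    fun _ hα => exactForms_le_exactFormsOn N hα

end Cohomology

/-! ### Symplectic and presymplectic forms -/

section Symplectic

variable {E : Type*} [NormedAddCommGroup E] [NormedSpace ℝ E]
  {M : Type*} [TopologicalSpace M] [ChartedSpace E M]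

/-- The contraction `v ↦ ι_v α = α(v, ·)` of a 2-form with tangent vectors at `x`. -/
def DForm.contraction (α : DForm E M 2) (x : M) : E →L[ℝ] E [⋀^Fin 1]→L[ℝ] ℝ :=
  ContinuousAlternatingMap.curryLeft (show E [⋀^Fin 2]→L[ℝ] ℝ from α x)

/-- The rank of a 2-form at the point `x`. -/
def DForm.rank (α : DForm E M 2) (x : M) : ℕ :=
  Module.finrank ℝ (LinearMap.range (α.contraction x : E →ₗ[ℝ] E [⋀^Fin 1]→L[ℝ] ℝ))

/-- A symplectic form: a closed smooth non-degenerate 2-form. -/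
structure IsSymplectic (α : DForm E M 2) : Prop where
  closed : α ∈ closedForms E M 2
  nondegenerate : ∀ x : M, ∀ v, α.contraction x v = 0 → v = 0

/-- A presymplectic form: a closed smooth 2-form of maximal rank on an odd-dimensional manifold,
i.e. of rank `2n` on a manifold of dimension `2n + 1`. -/
structure IsPresymplectic (α : DForm E M 2) : Prop where
  closed : α ∈ closedForms E M 2
  maximal_rank : ∀ x : M, ∃ n : ℕ,
    Module.finrank ℝ (TangentSpace 𝓘(ℝ, E) x) = 2 * n + 1 ∧ α.rank x = 2 * n

/-- The smooth codimension zero submanifolds (with boundary) of a manifold `F`: near each of its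
points, `N` is either all of `F`, or a half space `{0 ≤ ℓ}` in some smooth chart of `F`. -/
def IsCodimZeroSubmanifold (E : Type*) [NormedAddCommGroup E] [NormedSpace ℝ E]
    {F : Type*} [TopologicalSpace F] [ChartedSpace E F] (N : Set F) : Prop :=
  ∀ x ∈ N, x ∈ interior N ∨ ∃ e ∈ IsManifold.maximalAtlas 𝓘(ℝ, E) ∞ F, x ∈ e.source ∧
    ∃ ℓ : E →L[ℝ] ℝ, ℓ ≠ 0 ∧ ∀ y ∈ e.source, (y ∈ N ↔ 0 ≤ ℓ (e y))

theorem IsCodimZeroSubmanifold.uniqueMDiffWithinAt [IsManifold 𝓘(ℝ, E) ∞ M] {N : Set M}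
    (hN : IsCodimZeroSubmanifold E N) {x : M} (hx : x ∈ N) :
    UniqueMDiffWithinAt 𝓘(ℝ, E) N x := by
  have := IsManifold.of_le (I := 𝓘(ℝ, E)) (M := M) (m := 1) (n := ∞) (by simp)
  rcases hN x hx with h | ⟨e, he, hxe, ℓ, hℓ, h⟩
  · have := (uniqueMDiffWithinAt_univ 𝓘(ℝ, E) (x := x)).inter (mem_interior_iff_mem_nhds.1 h)
    rwa [Set.univ_inter] at this
  have hd : e.MDifferentiable 𝓘(ℝ, E) 𝓘(ℝ, E) :=
    ⟨(contMDiffOn_of_mem_maximalAtlas he).mdifferentiableOn (by simp),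
      (contMDiffOn_symm_of_mem_maximalAtlas he).mdifferentiableOn (by simp)⟩
  obtain ⟨v, hv⟩ : ∃ v, 0 < ℓ v := by
    obtain ⟨v, hv⟩ : ∃ v, ℓ v ≠ 0 := by
      by_contra! h0
      exact hℓ (ContinuousLinearMap.ext h0)
    rcases lt_or_gt_of_ne hv with h0 | h0
    · exact ⟨-v, by rw [map_neg]; linarith⟩
    · exact ⟨v, h0⟩
  have hint : (interior {w : E | 0 ≤ ℓ w}).Nonempty :=
    ⟨v, mem_interior.2 ⟨{w | 0 < ℓ w}, fun w (hw : 0 < ℓ w) => le_of_lt hw,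
      isOpen_lt continuous_const ℓ.continuous, hv⟩⟩
  have hconv : Convex ℝ {w : E | 0 ≤ ℓ w} := convex_halfSpace_ge ℓ.toLinearMap.isLinear 0
  have h1 : UniqueMDiffWithinAt 𝓘(ℝ, E) {w : E | 0 ≤ ℓ w} (e x) :=
    uniqueMDiffWithinAt_iff_uniqueDiffWithinAt.2
      (uniqueDiffOn_convex hconv hint _ ((h x hxe).1 hx))
  have h2 := h1.preimage_openPartialHomeomorph hd.symm (e.map_source hxe)
  have h3 : e.symm (e x) = x := e.left_inv hxe
  rw [h3] at h2
  exact h2.mono fun z hz => (h z hz.1).2 hz.2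

/-- `Symp(F, N₀, σ₀)`: the diffeomorphisms of `F` which preserve `σ₀` and fix every point of
`N₀`. -/
def Symp (σ₀ : DForm E M 2) (N₀ : Set M) : Set (M ≃ₘ^∞⟮𝓘(ℝ, E), 𝓘(ℝ, E)⟯ M) :=
  {g | DForm.pullback E g σ₀ = σ₀ ∧ ∀ y ∈ N₀, g y = y}

end Symplectic

/-! ### Symplectic fibrations with structure group `Symp(F, N₀, σ₀)` -/

section Fibration

variable {EB : Type*} [NormedAddCommGroup EB] [NormedSpace ℝ EB]
  {B : Type*} [TopologicalSpace B] [ChartedSpace EB B]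
  {EF : Type*} [NormedAddCommGroup EF] [NormedSpace ℝ EF]
  {F : Type*} [TopologicalSpace F] [ChartedSpace EF F]
  {EM : Type*} [NormedAddCommGroup EM] [NormedSpace ℝ EM]
  {M : Type*} [TopologicalSpace M] [ChartedSpace EM M]

/-- A symplectic fibration `p : M → B` with fibre `(F, σ₀)` and structure group
`Symp(F, N₀, σ₀)`: a smooth fibre bundle given by an atlas of smooth local trivializations
`p⁻¹(U) ≃ U × F`, all of whose transition maps `{b} × F → {b} × F` are in `Symp(F, N₀, σ₀)`. -/
structure SymplecticFibration (EB EM : Type*) [NormedAddCommGroup EB] [NormedSpace ℝ EB]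
    [NormedAddCommGroup EM] [NormedSpace ℝ EM]
    {B : Type*} [TopologicalSpace B] [ChartedSpace EB B]
    {M : Type*} [TopologicalSpace M] [ChartedSpace EM M]
    (p : M → B) (σ₀ : DForm EF F 2) (N₀ : Set F) where
  atlas : Set (Trivialization F p)
  exists_mem : ∀ b : B, ∃ e ∈ atlas, b ∈ e.baseSet
  smooth : ∀ e ∈ atlas,
    ContMDiffOn 𝓘(ℝ, EM) (𝓘(ℝ, EB).prod 𝓘(ℝ, EF)) ∞ e e.source
  smooth_symm : ∀ e ∈ atlas,
    ContMDiffOn (𝓘(ℝ, EB).prod 𝓘(ℝ, EF)) 𝓘(ℝ, EM) ∞ e.toOpenPartialHomeomorph.symm e.target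
  transition : ∀ e ∈ atlas, ∀ e' ∈ atlas, ∀ b ∈ e.baseSet ∩ e'.baseSet,
    ∃ g ∈ Symp σ₀ N₀, ∀ y : F, e' (e.toOpenPartialHomeomorph.symm (b, y)) = (b, g y)

namespace SymplecticFibration

variable {p : M → B} {σ₀ : DForm EF F 2} {N₀ : Set F} (P : SymplecticFibration EB EM p σ₀ N₀)

theorem contMDiff_proj (P : SymplecticFibration EB EM p σ₀ N₀) :
    ContMDiff 𝓘(ℝ, EM) 𝓘(ℝ, EB) ∞ p := by
  intro x
  obtain ⟨e, he, hb⟩ := P.exists_mem (p x)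
  have hx : x ∈ e.source := e.mem_source.2 hb
  have h := (P.smooth e he).contMDiffAt (e.open_source.mem_nhds hx)
  refine h.fst.congr_of_eventuallyEq ?_
  filter_upwards [e.open_source.mem_nhds hx] with z hz
  exact (e.coe_fst hz).symm

/-- The inclusion `F ≃ F_b ⊆ M` of the fibre over `b`, identified with `F` by a trivialization. -/
def fibreIncl (e : Trivialization F p) (b : B) : F → M :=
  fun y => e.toOpenPartialHomeomorph.symm (b, y)

theorem contMDiff_fibreIncl {e : Trivialization F p} (he : e ∈ P.atlas) {b : B}
    (hb : b ∈ e.baseSet) : ContMDiff 𝓘(ℝ, EF) 𝓘(ℝ, EM) ∞ (fibreIncl e b) := by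
  have h := P.smooth_symm e he
  have hpr : ContMDiff 𝓘(ℝ, EF) (𝓘(ℝ, EB).prod 𝓘(ℝ, EF)) ∞ (fun y : F => (b, y)) :=
    contMDiff_const.prodMk contMDiff_id
  intro y
  have hy : (b, y) ∈ e.target := e.mem_target.2 hb
  exact (h.contMDiffAt (e.open_target.mem_nhds hy)).comp y (hpr y)

/-- A chosen trivialization around `b`. -/
def trivAt (b : B) : Trivialization F p := (P.exists_mem b).choose

theorem trivAt_mem (b : B) : P.trivAt b ∈ P.atlas := (P.exists_mem b).choose_spec.1

theorem mem_baseSet_trivAt (b : B) : b ∈ (P.trivAt b).baseSet := (P.exists_mem b).choose_spec.2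

/-- The second component of `x` in the trivialization chosen around `p x`. On `N = N₀ × B` this is
the (well defined) projection `N → N₀ ⊆ F`. -/
def toFibre (x : M) : F := (P.trivAt (p x) x).2

/-- The submanifold `N = N₀ × B` of `M`: the points which lie in `N₀` in a trivialization. -/
def N : Set M := {x | P.toFibre x ∈ N₀}

/-- The form `ω_N` on `N`: the pull-back of `σ₀` along the projection `N → F`. -/
def formN : DForm EM M 2 := fun x =>
  (σ₀ (P.toFibre x)).compContinuousLinearMap
    (mfderivWithin 𝓘(ℝ, EM) 𝓘(ℝ, EF) P.toFibre P.N x)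

theorem toFibre_transition {e : Trivialization F p} (he : e ∈ P.atlas) {x : M}
    (hx : x ∈ e.source) : ∃ g ∈ Symp σ₀ N₀, P.toFibre x = g (e x).2 := by
  have hx' : x ∈ (P.trivAt (p x)).source :=
    (P.trivAt (p x)).mem_source.2 (P.mem_baseSet_trivAt (p x))
  obtain ⟨g, hg, h⟩ := P.transition e he (P.trivAt (p x)) (P.trivAt_mem (p x)) (p x)
    ⟨e.mem_source.1 hx, P.mem_baseSet_trivAt (p x)⟩
  refine ⟨g, hg, ?_⟩
  have h1 := h (e x).2
  rw [← e.coe_fst hx, Prod.mk.eta, e.coe_fst hx] at h1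
  have h2 : e.toOpenPartialHomeomorph.symm (e x) = x := e.toOpenPartialHomeomorph.left_inv hx
  rw [h2] at h1
  exact congrArg Prod.snd h1

theorem mem_N_iff {e : Trivialization F p} (he : e ∈ P.atlas) {x : M} (hx : x ∈ e.source) :
    x ∈ P.N ↔ (e x).2 ∈ N₀ := by
  obtain ⟨g, hg, h⟩ := P.toFibre_transition he hx
  have h' : x ∈ P.N ↔ g (e x).2 ∈ N₀ := by rw [← h]; rfl
  rw [h']
  constructor
  · intro h1
    have h2 := hg.2 _ h1
    rwa [← g.injective h2]
  · intro h1
    rwa [hg.2 _ h1]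

theorem toFibre_eq {e : Trivialization F p} (he : e ∈ P.atlas) {x : M} (hx : x ∈ e.source)
    (hN : x ∈ P.N) : P.toFibre x = (e x).2 := by
  obtain ⟨g, hg, h⟩ := P.toFibre_transition he hx
  rw [h, hg.2 _ ((P.mem_N_iff he hx).1 hN)]

theorem uniqueMDiffWithinAt_N [IsManifold 𝓘(ℝ, EF) ∞ F]
    (hN₀ : IsCodimZeroSubmanifold EF N₀) {x : M} (hx : x ∈ P.N) :
    UniqueMDiffWithinAt 𝓘(ℝ, EM) P.N x := by
  set e := P.trivAt (p x)
  have he := P.trivAt_mem (p x)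
  have hxe : x ∈ e.source := e.mem_source.2 (P.mem_baseSet_trivAt (p x))
  have hd : e.toOpenPartialHomeomorph.MDifferentiable 𝓘(ℝ, EM) (𝓘(ℝ, EB).prod 𝓘(ℝ, EF)) :=
    ⟨(P.smooth e he).mdifferentiableOn (by simp), (P.smooth_symm e he).mdifferentiableOn (by simp)⟩
  have h1 : UniqueMDiffWithinAt (𝓘(ℝ, EB).prod 𝓘(ℝ, EF)) (Set.univ ×ˢ N₀) (e x) :=
    UniqueMDiffWithinAt.prod (x := (e x).1) (y := (e x).2) (uniqueMDiffWithinAt_univ _)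
      (hN₀.uniqueMDiffWithinAt ((P.mem_N_iff he hxe).1 hx))
  have h2 := h1.preimage_openPartialHomeomorph hd.symm (e.map_source hxe)
  have h3 : e.toOpenPartialHomeomorph.symm (e x) = x := e.toOpenPartialHomeomorph.left_inv hxe
  rw [h3] at h2
  exact h2.mono fun z hz => (P.mem_N_iff he hz.1).2 hz.2.2

theorem formN_eq_pullback [IsManifold 𝓘(ℝ, EF) ∞ F] (hN₀ : IsCodimZeroSubmanifold EF N₀)
    {e : Trivialization F p} (he : e ∈ P.atlas) {x : M} (hx : x ∈ e.source) (hN : x ∈ P.N) :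
    P.formN x = DForm.pullback EM (fun z => (e z).2) σ₀ x := by
  have hq : MDifferentiableAt 𝓘(ℝ, EM) 𝓘(ℝ, EF) (fun z => (e z).2) x :=
    ((P.smooth e he).contMDiffAt (e.open_source.mem_nhds hx)).snd.mdifferentiableAt (by simp)
  have hEq : P.toFibre =ᶠ[𝓝[P.N] x] fun z => (e z).2 := by
    filter_upwards [self_mem_nhdsWithin, mem_nhdsWithin_of_mem_nhds (e.open_source.mem_nhds hx)]
      with z h1 h2
    exact P.toFibre_eq he h2 h1
  have h1 : mfderivWithin 𝓘(ℝ, EM) 𝓘(ℝ, EF) P.toFibre P.N x =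
      mfderiv 𝓘(ℝ, EM) 𝓘(ℝ, EF) (fun z => (e z).2) x :=
    (hEq.mfderivWithin_eq (P.toFibre_eq he hx hN)).trans
      (mfderivWithin_eq_mfderiv (P.uniqueMDiffWithinAt_N hN₀ hN) hq)
  ext v
  have h2 := congrArg (fun T : EM →L[ℝ] EF => fun i => T (v i)) h1
  refine (congrArg (fun u : Fin 2 → EF =>
    (show EF [⋀^Fin 2]→L[ℝ] ℝ from σ₀ (P.toFibre x)) u) h2).trans ?_
  exact congrArg (fun β : EF [⋀^Fin 2]→L[ℝ] ℝ => β fun i =>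
    (mfderiv 𝓘(ℝ, EM) 𝓘(ℝ, EF) (fun z => (e z).2) x (v i) : EF))
    (DForm.congr_point σ₀ (P.toFibre_eq he hx hN))

/-- `ω_N` is a closed smooth form on `N`. -/
theorem formN_mem [FiniteDimensional ℝ EF] [FiniteDimensional ℝ EM]
    [IsManifold 𝓘(ℝ, EF) ∞ F] [IsManifold 𝓘(ℝ, EM) ∞ M] (hσ₀ : IsSymplectic σ₀) (hN₀ : IsCodimZeroSubmanifold EF N₀) :
    P.formN ∈ closedFormsOn EM P.N 2 := by
  intro x hx
  have he := P.trivAt_mem (p x)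
  have hxe : x ∈ (P.trivAt (p x)).source :=
    (P.trivAt (p x)).mem_source.2 (P.mem_baseSet_trivAt (p x))
  refine ⟨DForm.pullback EM (fun z => (P.trivAt (p x) z).2) σ₀, ?_⟩
  filter_upwards [(P.trivAt (p x)).open_source.mem_nhds hxe] with y hy
  have hq : ContMDiffAt 𝓘(ℝ, EM) 𝓘(ℝ, EF) ∞ (fun z => (P.trivAt (p x) z).2) y :=
    ((P.smooth _ he).contMDiffAt ((P.trivAt (p x)).open_source.mem_nhds hy)).snd
  refine ⟨(hσ₀.closed.1 _).pullback hq, fun hyN => ⟨(P.formN_eq_pullback hN₀ he hy hyN).symm, ?_⟩⟩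
  rw [DForm.extD_pullback (hσ₀.closed.1 _) hq, hσ₀.closed.2]
  exact ContinuousAlternatingMap.ext fun _ => rfl

end SymplecticFibration

end Fibration

end

noncomputable section

/-! ### Smooth dependence of integrals over the unit interval on parameters. -/

section ParametricIntegral

open MeasureTheory Set

variable {E : Type*} [NormedAddCommGroup E] [NormedSpace ℝ E]
  {G : Type*} [NormedAddCommGroup G] [NormedSpace ℝ G]

/-! The proof is Thurston's construction carried out relative to `N`, followed by a rank estimate
for large `K`. Write `q` for the fibre coordinate of a trivialization and `ι_b` for the inclusion of
the fibre over `b`.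

Correction on `N`. A representative `τ₀` of `u` differs from `ω_N` on `N` by an exact form. Local
extensions of its primitive are glued to a smooth 1-form `β` on `M`, and `τ₀ - dβ` equals `ω_N` on
`N` (`exists_sub_extD_eq_formN`). Boundary points of `N` cause no trouble because derivatives are
determined by values on `N` (`DForm.extD_eq_of_eqOn`).

Correction on the fibres. Let `τ` be the corrected form. Over small sets `U_i` of the base there are
1-forms `γ_i` with `dγ_i = τ - q_i^*σ₀`. For a partition of unity `ρ_i` on `B` put `Γ = ∑ (ρ_i ∘ p)
γ_i`. The functions `ρ_i ∘ p` are constant on fibres, so `τ - dΓ` restricts to `σ₀` on each fibre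
(`exists_sub_extD_fibrewise`). On `N` every `dγ_i` vanishes, but `dΓ` also contains `∑ d(ρ_i ∘ p) ∧
γ_i`, which vanishes if all `γ_i` have the same values on `N`.

This agreement is the crux. For each `b` consider the set of 1-forms on `F` that agree on `N₀` with
some primitive of `ι_b^*τ - σ₀`. It does not depend on the trivialization, because transition maps
fix `N₀` pointwise and preserve `σ₀` (`hasFibrePrimitive_transition`). It is locally constant in
`b`: contracting the bundle to one fibre with `q` held constant gives a homotopy primitive which is
zero on `N`, since there `τ = q^*σ₀` annihilates the velocity (`exists_primitive_sub_retract`). A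
choice function applied to these sets therefore prescribes boundary values on `N₀` that are locally
constant in `b`, and the `γ_i` are built with them (`exists_local_primitives`).

Large multiples. With `K = s⁻²`, scaling the base directions by `s` turns `τ + K p^*ω_B` into a form
which tends to `σ₀ ⊕ ω_B` as `s → 0`. The limit has corank one, rank is lower semicontinuous, and
`M` is compact, so one `s > 0` gives corank at most one everywhere; odd dimension excludes corank
zero (`exists_isPresymplectic_add`). The corrections are exact, so the class is as required. -/

theorem eventually_forall_Icc_of_contDiffAt {f : ℝ × E → G} {x₀ : E} (n : ℕ)
    (hf : ∀ t ∈ Icc (0 : ℝ) 1, ContDiffAt ℝ ∞ f (t, x₀)) :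
    ∃ W : Set E, IsOpen W ∧ x₀ ∈ W ∧ ∀ t ∈ Icc (0 : ℝ) 1, ∀ x ∈ W, ContDiffAt ℝ n f (t, x) := by
  -- Smoothness of order `∞` at a point gives a neighbourhood only for each finite order, hence the
  -- parameter `n`. Compactness of the interval makes the neighbourhood uniform in `t`.
  have h : ∀ t ∈ Icc (0 : ℝ) 1, ∀ᶠ z : ℝ × E in 𝓝 (t, x₀), ContDiffAt ℝ n f z := fun t ht =>
    ((hf t ht).of_le (m := n) (by exact_mod_cast le_top)).eventually (by simp)
  have h2 : ∀ᶠ x in 𝓝 x₀, ∀ t ∈ Icc (0 : ℝ) 1, ContDiffAt ℝ n f (t, x) :=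
    isCompact_Icc.eventually_forall_of_forall_eventually fun t ht =>
      (continuous_swap.tendsto (x₀, t)).eventually (h t ht)
  obtain ⟨W, hW, hWo, hx⟩ := eventually_nhds_iff.1 h2
  exact ⟨W, hWo, hx, fun t ht x hx => hW x hx t ht⟩

omit [NormedSpace ℝ E] [NormedSpace ℝ G] in
theorem continuousOn_slice {f : ℝ × E → G} {x : E}
    (hf : ∀ t ∈ Icc (0 : ℝ) 1, ContinuousAt f (t, x)) :
    ContinuousOn (fun t => f (t, x)) (Icc 0 1) := fun t ht =>
  ((hf t ht).comp (f := fun t => (t, x)) (by fun_prop)).continuousWithinAt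

omit [NormedSpace ℝ E] [NormedSpace ℝ G] in
theorem intervalIntegrable_slice {f : ℝ × E → G} {x : E}
    (hf : ∀ t ∈ Icc (0 : ℝ) 1, ContinuousAt f (t, x)) :
    IntervalIntegrable (fun t => f (t, x)) volume 0 1 := by
  apply ContinuousOn.intervalIntegrable
  rw [uIcc_of_le zero_le_one]
  exact continuousOn_slice hf

/-- Differentiation under the integral sign. -/
theorem hasFDerivAt_intervalIntegral_of_contDiffAt {f : ℝ × E → G} {x₀ : E} {W : Set E}
    (hW : IsOpen W) (hx₀ : x₀ ∈ W)
    (hf : ∀ t ∈ Icc (0 : ℝ) 1, ∀ x ∈ W, ContDiffAt ℝ 1 f (t, x)) :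
    HasFDerivAt (fun x => ∫ t in (0 : ℝ)..1, f (t, x))
      (∫ t in (0 : ℝ)..1, (fderiv ℝ f (t, x₀)).comp (ContinuousLinearMap.inr ℝ ℝ E)) x₀ := by
  have hd : ∀ t ∈ Icc (0 : ℝ) 1, ∀ x ∈ W, ContinuousAt
      (fun z => (fderiv ℝ f z).comp (ContinuousLinearMap.inr ℝ ℝ E)) (t, x) := fun t ht x hx =>
    ((hf t ht x hx).fderiv_right (m := 0) (by simp)).continuousAt.clm_comp continuousAt_const
  have hI : Set.uIoc (0 : ℝ) 1 ⊆ Icc 0 1 := by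
    rw [uIoc_of_le zero_le_one]; exact Ioc_subset_Icc_self
  obtain ⟨C, hC⟩ : ∃ C, ∀ t ∈ Icc (0 : ℝ) 1,
      ‖(fderiv ℝ f (t, x₀)).comp (ContinuousLinearMap.inr ℝ ℝ E)‖ ≤ C :=
    isCompact_Icc.exists_bound_of_continuousOn
      (continuousOn_slice (f := fun z => (fderiv ℝ f z).comp (ContinuousLinearMap.inr ℝ ℝ E))
        fun t ht => hd t ht x₀ hx₀)
  -- `C` bounds the derivative along the slice over `x₀` only; by continuity and compactness `C + 1`
  -- is a dominating constant for all nearby slices.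
  have hb : ∀ᶠ x in 𝓝 x₀, ∀ t ∈ Icc (0 : ℝ) 1,
      ‖(fderiv ℝ f (t, x)).comp (ContinuousLinearMap.inr ℝ ℝ E)‖ < C + 1 :=
    isCompact_Icc.eventually_forall_of_forall_eventually fun t ht => by
      have h1 := (hd t ht x₀ hx₀).norm.eventually (gt_mem_nhds (lt_of_le_of_lt (hC t ht)
        (lt_add_one C)))
      exact (continuous_swap.tendsto (x₀, t)).eventually h1
  refine intervalIntegral.hasFDerivAt_integral_of_dominated_of_fderiv_le
    (F := fun x t => f (t, x))
    (F' := fun x t => (fderiv ℝ f (t, x)).comp (ContinuousLinearMap.inr ℝ ℝ E))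
    (bound := fun _ => C + 1)
    (Filter.inter_mem hb (hW.mem_nhds hx₀)) ?_ ?_ ?_ ?_ ?_ ?_
  · filter_upwards [hW.mem_nhds hx₀] with x hx
    exact (intervalIntegrable_slice fun t ht => (hf t ht x hx).continuousAt).def'.aestronglyMeasurable
  · exact intervalIntegrable_slice fun t ht => (hf t ht x₀ hx₀).continuousAt
  · exact (intervalIntegrable_slice (f := fun z => (fderiv ℝ f z).comp
      (ContinuousLinearMap.inr ℝ ℝ E)) fun t ht => hd t ht x₀ hx₀).def'.aestronglyMeasurable
  · exact Filter.Eventually.of_forall fun t ht x hx => (hx.1 t (hI ht)).le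
  · exact intervalIntegrable_const
  · refine Filter.Eventually.of_forall fun t ht x hx => ?_
    have h1 := ((hf t (hI ht) x hx.2).differentiableAt (by simp)).hasFDerivAt
    exact h1.comp x (hasFDerivAt_prodMk_right t x)

/-- Meant for `Λ` equal to alternatization followed by evaluation: it then moves an exterior
derivative under the integral sign. -/
theorem map_fderiv_intervalIntegral {f : ℝ × E → G} {x₀ : E}
    (hf : ∀ t ∈ Icc (0 : ℝ) 1, ContDiffAt ℝ ∞ f (t, x₀)) {G' : Type*} [NormedAddCommGroup G']
    [NormedSpace ℝ G'] [CompleteSpace G] [CompleteSpace G'] (Λ : (E →L[ℝ] G) →L[ℝ] G') :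
    Λ (fderiv ℝ (fun x => ∫ t in (0 : ℝ)..1, f (t, x)) x₀) =
      ∫ t in (0 : ℝ)..1, Λ ((fderiv ℝ f (t, x₀)).comp (ContinuousLinearMap.inr ℝ ℝ E)) := by
  obtain ⟨W, hW, hx, h⟩ := eventually_forall_Icc_of_contDiffAt 1 hf
  rw [(hasFDerivAt_intervalIntegral_of_contDiffAt hW hx h).fderiv,
    ContinuousLinearMap.intervalIntegral_comp_comm]
  exact intervalIntegrable_slice (f := fun z => (fderiv ℝ f z).comp
      (ContinuousLinearMap.inr ℝ ℝ E)) fun t ht =>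
      ((h t ht x₀ hx).fderiv_right (m := 0) (by simp)).continuousAt.clm_comp continuousAt_const

variable [FiniteDimensional ℝ E]

/-- Induction on the order, applied to the directional derivatives of `f`, which is why `f` is
quantified inside. One order of smoothness is given away so that the base case can still
differentiate under the integral. -/
theorem contDiffOn_intervalIntegral {W : Set E} (hW : IsOpen W) (n : ℕ) :
    ∀ f : ℝ × E → G, (∀ t ∈ Icc (0 : ℝ) 1, ∀ x ∈ W, ContDiffAt ℝ (n + 1 : ℕ) f (t, x)) →
      ContDiffOn ℝ n (fun x => ∫ t in (0 : ℝ)..1, f (t, x)) W := by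
  induction n with
  | zero =>
    intro f hf
    refine contDiffOn_zero.2 fun x hx => ?_
    exact (hasFDerivAt_intervalIntegral_of_contDiffAt hW hx (by simpa using hf)).continuousAt
      |>.continuousWithinAt
  | succ n ih =>
    intro f hf
    have h1 : ∀ t ∈ Icc (0 : ℝ) 1, ∀ x ∈ W, ContDiffAt ℝ 1 f (t, x) := fun t ht x hx =>
      (hf t ht x hx).of_le (by simp)
    have hd : ∀ x ∈ W, HasFDerivAt (fun x => ∫ t in (0 : ℝ)..1, f (t, x))
        (∫ t in (0 : ℝ)..1, (fderiv ℝ f (t, x)).comp (ContinuousLinearMap.inr ℝ ℝ E)) x :=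
      fun x hx => hasFDerivAt_intervalIntegral_of_contDiffAt hW hx h1
    push_cast
    refine contDiffOn_succ_of_fderiv_apply
      (fun x hx => (hd x hx).differentiableAt.differentiableWithinAt) (by simp) fun y => ?_
    refine (ih (fun z => fderiv ℝ f z (0, y)) fun t ht x hx => ?_).congr fun x hx => ?_
    · exact ((hf t ht x hx).fderiv_right (m := (n + 1 : ℕ)) (by norm_cast)).clm_apply
        contDiffAt_const
    · rw [fderivWithin_of_isOpen hW hx, (hd x hx).fderiv,
        ContinuousLinearMap.intervalIntegral_apply]
      · rfl
      · exact intervalIntegrable_slice (f := fun z => (fderiv ℝ f z).comp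
          (ContinuousLinearMap.inr ℝ ℝ E)) fun t ht =>
          (((h1 t ht x hx).fderiv_right (m := 0) (by simp)).continuousAt).clm_comp
            continuousAt_const

theorem contDiffAt_intervalIntegral {f : ℝ × E → G} {x₀ : E}
    (hf : ∀ t ∈ Icc (0 : ℝ) 1, ContDiffAt ℝ ∞ f (t, x₀)) :
    ContDiffAt ℝ ∞ (fun x => ∫ t in (0 : ℝ)..1, f (t, x)) x₀ := by
  refine contDiffAt_infty.2 fun n => ?_
  obtain ⟨W, hW, hx, h⟩ := eventually_forall_Icc_of_contDiffAt (n + 1) hf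
  exact (contDiffOn_intervalIntegral hW n f h).contDiffAt (hW.mem_nhds hx)

end ParametricIntegral

/-! ### The homotopy formula on a vector space. -/

section HomotopyFormula

open MeasureTheory Set

variable {E : Type*} [NormedAddCommGroup E] [NormedSpace ℝ E]

/-- The contraction of a 2-form on `ℝ × E` with the first basis vector, restricted to `E`. -/
def contractFst (E : Type*) [NormedAddCommGroup E] [NormedSpace ℝ E] :
    ((ℝ × E) [⋀^Fin 2]→L[ℝ] ℝ) →L[ℝ] E [⋀^Fin 1]→L[ℝ] ℝ :=
  (ContinuousAlternatingMap.compContinuousLinearMapCLM (ContinuousLinearMap.inr ℝ ℝ E)).comp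
    ((ContinuousLinearMap.apply ℝ ((ℝ × E) [⋀^Fin 1]→L[ℝ] ℝ) ((1, 0) : ℝ × E)).comp
      (ContinuousAlternatingMap.curryLeftLI (𝕜 := ℝ) (E := ℝ × E) (F := ℝ)
        (n := 1)).toContinuousLinearMap)

theorem contractFst_apply (η : (ℝ × E) [⋀^Fin 2]→L[ℝ] ℝ) (v : Fin 1 → E) :
    contractFst E η v = η ![(1, 0), (0, v 0)] := by
  change η (Matrix.vecCons (1, 0) _) = _
  congr 1
  ext i <;> fin_cases i <;> rfl

/-- The homotopy formula on `[0, 1] × E`: the integral over `t` of the contraction of a closed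
2-form with `∂/∂t` is a primitive of the difference of its restrictions to the two ends. -/
theorem extDeriv_intervalIntegral_contractFst {α : ℝ × E → (ℝ × E) [⋀^Fin 2]→L[ℝ] ℝ} {x₀ : E}
    (hα : ∀ t ∈ Icc (0 : ℝ) 1, ContDiffAt ℝ ∞ α (t, x₀))
    (hcl : ∀ t ∈ Icc (0 : ℝ) 1, extDeriv α (t, x₀) = 0) :
    extDeriv (fun x => ∫ t in (0 : ℝ)..1, contractFst E (α (t, x))) x₀ =
      (α (1, x₀)).compContinuousLinearMap (ContinuousLinearMap.inr ℝ ℝ E) -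
        (α (0, x₀)).compContinuousLinearMap (ContinuousLinearMap.inr ℝ ℝ E) := by
  have hf : ∀ t ∈ Icc (0 : ℝ) 1, ContDiffAt ℝ ∞ (fun z => contractFst E (α z)) (t, x₀) :=
    fun t ht => (contractFst E).contDiff.contDiffAt.comp _ (hα t ht)
  have hda : ∀ t ∈ Icc (0 : ℝ) 1, DifferentiableAt ℝ α (t, x₀) := fun t ht =>
    (hα t ht).differentiableAt (by simp)
  ext v
  let Λ : (E →L[ℝ] E [⋀^Fin 1]→L[ℝ] ℝ) →L[ℝ] ℝ :=
    (ContinuousAlternatingMap.apply ℝ E ℝ v).comp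
      (ContinuousAlternatingMap.alternatizeUncurryFinCLM ℝ E ℝ)
  have key : ∀ t ∈ Icc (0 : ℝ) 1,
      Λ ((fderiv ℝ (fun z => contractFst E (α z)) (t, x₀)).comp (ContinuousLinearMap.inr ℝ ℝ E)) =
        fderiv ℝ α (t, x₀) (1, 0) ![(0, v 0), (0, v 1)] := by
    intro t ht
    have h1 : fderiv ℝ (fun z => contractFst E (α z)) (t, x₀) =
        (contractFst E).comp (fderiv ℝ α (t, x₀)) :=
      ((contractFst E).hasFDerivAt.comp _ (hda t ht).hasFDerivAt).fderiv
    -- Closedness evaluated on `(∂/∂t, v 0, v 1)` expresses the `t`-derivative of `α (v 0, v 1)` by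
    -- the two terms that make up the differential of the contraction; the fundamental theorem of
    -- calculus then finishes.
    have h2 := congrArg (fun η => η ![((1 : ℝ), (0 : E)), (0, v 0), (0, v 1)]) (hcl t ht)
    have h3 : Λ ((fderiv ℝ (fun z => contractFst E (α z)) (t, x₀)).comp
        (ContinuousLinearMap.inr ℝ ℝ E)) =
        fderiv ℝ α (t, x₀) (0, v 0) ![(1, 0), (0, v 1)] -
          fderiv ℝ α (t, x₀) (0, v 1) ![(1, 0), (0, v 0)] := by
      rw [h1]
      simp [Λ, ContinuousAlternatingMap.alternatizeUncurryFin_apply, Fin.sum_univ_two,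
        contractFst_apply, Fin.removeNth, sub_eq_add_neg, Fin.succAbove]
    have h4 : fderiv ℝ α (t, x₀) (1, 0) ![(0, v 0), (0, v 1)] -
        fderiv ℝ α (t, x₀) (0, v 0) ![(1, 0), (0, v 1)] +
          fderiv ℝ α (t, x₀) (0, v 1) ![(1, 0), (0, v 0)] = 0 := by
      have e0 : Fin.removeNth 0 ![((1 : ℝ), (0 : E)), (0, v 0), (0, v 1)] =
        ![(0, v 0), (0, v 1)] := by funext i; fin_cases i <;> rfl
      have e1 : Fin.removeNth 1 ![((1 : ℝ), (0 : E)), (0, v 0), (0, v 1)] =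
        ![(1, 0), (0, v 1)] := by funext i; fin_cases i <;> rfl
      have e2 : Fin.removeNth 2 ![((1 : ℝ), (0 : E)), (0, v 0), (0, v 1)] =
        ![(1, 0), (0, v 0)] := by funext i; fin_cases i <;> rfl
      rw [extDeriv, ContinuousAlternatingMap.alternatizeUncurryFin_apply,
        Fin.sum_univ_three, e0, e1, e2] at h2
      simpa [sub_eq_add_neg] using h2
    rw [h3]; linarith
  have hFTC : ∫ t in (0 : ℝ)..1, fderiv ℝ α (t, x₀) (1, 0) ![(0, v 0), (0, v 1)] =
      α (1, x₀) ![(0, v 0), (0, v 1)] - α (0, x₀) ![(0, v 0), (0, v 1)] := by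
    refine intervalIntegral.integral_eq_sub_of_hasDerivAt
      (f := fun t => α (t, x₀) ![(0, v 0), (0, v 1)]) ?_ ?_
    · intro t ht
      rw [uIcc_of_le zero_le_one] at ht
      have h1 : HasDerivAt (fun s : ℝ => (s, x₀)) ((1 : ℝ), (0 : E)) t :=
        (hasDerivAt_id t).prodMk (hasDerivAt_const t x₀)
      have h2 := (hda t ht).hasFDerivAt.comp_hasDerivAt t h1
      exact (ContinuousAlternatingMap.apply ℝ (ℝ × E) ℝ _).hasFDerivAt.comp_hasDerivAt t h2
    · refine intervalIntegrable_slice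
        (f := fun z => fderiv ℝ α z (1, 0) ![(0, v 0), (0, v 1)]) fun t ht => ?_
      have h1 := (((hα t ht).fderiv_right (m := 0) (by simp)).continuousAt).clm_apply
        (continuousAt_const (y := ((1 : ℝ), (0 : E))))
      exact (ContinuousAlternatingMap.apply ℝ (ℝ × E) ℝ
        ![(0, v 0), (0, v 1)]).continuous.continuousAt.comp h1
  have h3 : extDeriv (fun x => ∫ t in (0 : ℝ)..1, contractFst E (α (t, x))) x₀ v =
      Λ (fderiv ℝ (fun x => ∫ t in (0 : ℝ)..1, contractFst E (α (t, x))) x₀) := rfl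
  rw [h3, map_fderiv_intervalIntegral hf Λ]
  rw [intervalIntegral.integral_congr
    (g := fun t => fderiv ℝ α (t, x₀) (1, 0) ![(0, v 0), (0, v 1)])
    (by rw [uIcc_of_le zero_le_one]; exact key), hFTC]
  have h4 : ((ContinuousLinearMap.inr ℝ ℝ E) ∘ v) = ![(0, v 0), (0, v 1)] := by
    funext i; fin_cases i <;> rfl
  simp [ContinuousAlternatingMap.compContinuousLinearMap_apply, h4]

end HomotopyFormula

/-! ### Calculus of forms on manifolds: functoriality, `d ∘ d = 0`, gluing. -/

section FormCalculus

variable {E : Type*} [NormedAddCommGroup E] [NormedSpace ℝ E]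
  {M : Type*} [TopologicalSpace M] [ChartedSpace E M]
  {E' : Type*} [NormedAddCommGroup E'] [NormedSpace ℝ E']
  {M' : Type*} [TopologicalSpace M'] [ChartedSpace E' M']
  {E'' : Type*} [NormedAddCommGroup E''] [NormedSpace ℝ E'']
  {M'' : Type*} [TopologicalSpace M''] [ChartedSpace E'' M'']
  {k : ℕ}

namespace DForm

theorem sub_apply (α β : DForm E M k) (x : M) : (α - β) x = α x - β x := rfl

theorem sum_apply {ι : Type*} (s : Finset ι) (α : ι → DForm E M k) (x : M) :
    (∑ i ∈ s, α i) x = ∑ i ∈ s, α i x :=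
  map_sum (AddMonoidHom.mk' (fun α : DForm E M k => α x) fun _ _ => rfl) α s

omit [NormedSpace ℝ E] in
theorem tendsto_chartAt_symm (x : M) :
    Filter.Tendsto (chartAt E x).symm (𝓝 (chartAt E x x)) (𝓝 x) := by
  have := (chartAt E x).continuousAt_symm (mem_chart_target E x)
  simpa [ContinuousAt] using this

theorem inChart_congr {α β : DForm E M k} {x : M} (h : ∀ᶠ y in 𝓝 x, α y = β y) :
    α.inChart x =ᶠ[𝓝 (chartAt E x x)] β.inChart x := by
  filter_upwards [(tendsto_chartAt_symm x).eventually h] with y hy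
  simp only [inChart, hy]

theorem SmoothAt.congr {α β : DForm E M k} {x : M} (hα : α.SmoothAt x)
    (h : ∀ᶠ y in 𝓝 x, β y = α y) : β.SmoothAt x :=
  ContDiffAt.congr_of_eventuallyEq hα (inChart_congr h)

theorem SmoothAt.neg {α : DForm E M k} {x : M} (hα : α.SmoothAt x) : DForm.SmoothAt (-α) x :=
  ContDiffAt.neg hα

theorem SmoothAt.sub {α β : DForm E M k} {x : M} (hα : α.SmoothAt x) (hβ : β.SmoothAt x) :
    DForm.SmoothAt (α - β) x := ContDiffAt.sub hα hβ

theorem extD_neg_apply (α : DForm E M k) (x : M) : extD (-α) x = -α.extD x := by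
  have h := extD_smul_apply (-1) α x
  rw [neg_one_smul] at h
  exact h.trans (neg_one_smul ℝ (show E [⋀^Fin (k + 1)]→L[ℝ] ℝ from α.extD x))

theorem extD_sub_apply {α β : DForm E M k} {x : M} (hα : α.SmoothAt x) (hβ : β.SmoothAt x) :
    extD (α - β) x = α.extD x - β.extD x := by
  rw [sub_eq_add_neg, extD_add_apply hα hβ.neg, extD_neg_apply, sub_eq_add_neg]

theorem SmoothAt.sum {ι : Type*} {s : Finset ι} {α : ι → DForm E M k} {x : M}
    (h : ∀ i ∈ s, (α i).SmoothAt x) : DForm.SmoothAt (∑ i ∈ s, α i) x := by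
  classical
  induction s using Finset.induction_on with
  | empty => exact .zero x
  | insert a s ha ih =>
    rw [Finset.sum_insert ha]
    exact (h a (by simp)).add (ih fun i hi => h i (by simp [hi]))

theorem extD_sum_apply {ι : Type*} {s : Finset ι} {α : ι → DForm E M k} {x : M}
    (h : ∀ i ∈ s, (α i).SmoothAt x) : extD (∑ i ∈ s, α i) x = ∑ i ∈ s, (α i).extD x := by
  classical
  induction s using Finset.induction_on with
  | empty => simp [extD_zero]; rfl
  | insert a s ha ih =>
    rw [Finset.sum_insert ha, Finset.sum_insert ha, extD_add_apply (h a (by simp))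
      (SmoothAt.sum fun i hi => h i (by simp [hi])), ih fun i hi => h i (by simp [hi])]

/-! ### Forms on a vector space -/

theorem inChart_self (α : DForm E E k) (x : E) : α.inChart x = α := by
  funext y
  have h : mfderiv 𝓘(ℝ, E) 𝓘(ℝ, E) (chartAt E x).symm y = ContinuousLinearMap.id ℝ E := by
    have : ((chartAt E x).symm : E → E) = id := by rw [chartAt_self_eq]; rfl
    rw [this]
    exact mfderiv_id
  simp only [inChart, h]
  ext v
  rfl

theorem smoothAt_self_iff {α : DForm E E k} {x : E} :
    α.SmoothAt x ↔ ContDiffAt ℝ ∞ (fun y => (show E [⋀^Fin k]→L[ℝ] ℝ from α y)) x := by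
  rw [SmoothAt, inChart_self]; rfl

theorem extD_self (α : DForm E E k) (x : E) :
    α.extD x = extDeriv (fun y => (show E [⋀^Fin k]→L[ℝ] ℝ from α y)) x := by
  have h : mfderiv 𝓘(ℝ, E) 𝓘(ℝ, E) (chartAt E x) x = ContinuousLinearMap.id ℝ E := by
    have : (chartAt E x : E → E) = id := by rw [chartAt_self_eq]; rfl
    rw [this]
    exact mfderiv_id
  simp only [extD, h, inChart_self]
  ext v
  rfl

/-! ### Functoriality of the pull-back -/

theorem pullback_congr {f g : M → M'} {x : M} (h : f =ᶠ[𝓝 x] g) (α : DForm E' M' k) :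
    pullback E f α x = pullback E g α x := by
  ext v
  have h1 : (mfderiv 𝓘(ℝ, E) 𝓘(ℝ, E') f x : E →L[ℝ] E') = mfderiv 𝓘(ℝ, E) 𝓘(ℝ, E') g x :=
    h.mfderiv_eq
  have h2 := congr_point α h.eq_of_nhds
  exact congrArg₂ (fun (β : E' [⋀^Fin k]→L[ℝ] ℝ) (T : E →L[ℝ] E') => β fun i => T (v i)) h2 h1

theorem pullback_comp {f : M → M'} {g : M' → M''} {x : M}
    (hg : MDifferentiableAt 𝓘(ℝ, E') 𝓘(ℝ, E'') g (f x))
    (hf : MDifferentiableAt 𝓘(ℝ, E) 𝓘(ℝ, E') f x) (α : DForm E'' M'' k) :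
    pullback E (fun y => g (f y)) α x = pullback E f (pullback E' g α) x := by
  ext v
  have h1 : (mfderiv 𝓘(ℝ, E) 𝓘(ℝ, E'') (fun y => g (f y)) x : E →L[ℝ] E'') =
    (mfderiv 𝓘(ℝ, E') 𝓘(ℝ, E'') g (f x)).comp (mfderiv 𝓘(ℝ, E) 𝓘(ℝ, E') f x) :=
    mfderiv_comp x hg hf
  exact congrArg (fun (T : E →L[ℝ] E'') =>
    (show E'' [⋀^Fin k]→L[ℝ] ℝ from α (g (f x))) fun i => T (v i)) h1

theorem pullback_sub (f : M → M') (α β : DForm E' M' k) :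
    pullback E f (α - β) = pullback E f α - pullback E f β := rfl

theorem pullback_apply_congr {f : M → M'} {α β : DForm E' M' k} {x : M} (h : α (f x) = β (f x)) :
    pullback E f α x = pullback E f β x := by
  simp only [pullback, h]

theorem pullback_id (α : DForm E M k) (x : M) : pullback E (fun y => y) α x = α x := by
  ext v
  have h1 : (mfderiv 𝓘(ℝ, E) 𝓘(ℝ, E) (fun y : M => y) x : E →L[ℝ] E) =
    ContinuousLinearMap.id ℝ E := mfderiv_id
  exact congrArg (fun (T : E →L[ℝ] E) =>
    (show E [⋀^Fin k]→L[ℝ] ℝ from α x) fun i => T (v i)) h1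

theorem pullback_sum {ι : Type*} (s : Finset ι) (f : M → M') (α : ι → DForm E' M' k) :
    pullback E f (∑ i ∈ s, α i) = ∑ i ∈ s, pullback E f (α i) :=
  map_sum (pullbackₗ E f) α s

/-! ### Smoothness of differentials; `d ∘ d = 0` -/

section Manifold

variable [IsManifold 𝓘(ℝ, E) ∞ M] [IsManifold 𝓘(ℝ, E') ∞ M']

theorem contMDiffAt_chartAt_symm {x : M} {y : E} (hy : y ∈ (chartAt E x).target) :
    ContMDiffAt 𝓘(ℝ, E) 𝓘(ℝ, E) ∞ (chartAt E x).symm y :=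
  (contMDiffOn_chart_symm (I := 𝓘(ℝ, E)) (n := ∞) (x := x)).contMDiffAt
    ((chartAt E x).open_target.mem_nhds hy)

/-- `extD` uses a different chart at every point. Naturality under the inverse of the chart at `x`
shows that this single chart computes it at all nearby points, so smoothness of `dα` and `d ∘ d = 0`
reduce to the vector space case. -/
theorem inChart_extD {α : DForm E M k} {x : M} (h : ∀ᶠ y in 𝓝 x, α.SmoothAt y) :
    α.extD.inChart x =ᶠ[𝓝 (chartAt E x x)] extDeriv (α.inChart x) := by
  filter_upwards [(tendsto_chartAt_symm x).eventually h,
    (chartAt E x).open_target.mem_nhds (mem_chart_target E x)] with y hy ht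
  have := extD_pullback (f := (chartAt E x).symm) (x := y) hy (contMDiffAt_chartAt_symm ht)
  rw [extD_self] at this
  exact this.symm

theorem SmoothAt.extD {α : DForm E M k} {x : M} (h : ∀ᶠ y in 𝓝 x, α.SmoothAt y) :
    α.extD.SmoothAt x := by
  refine ContDiffAt.congr_of_eventuallyEq ?_ (inChart_extD h)
  exact (ContinuousAlternatingMap.alternatizeUncurryFinCLM ℝ E ℝ).contDiff.contDiffAt.comp _
    (h.self_of_nhds.fderiv_right (m := ∞) (by simp))

theorem extD_extD {α : DForm E M k} {x : M} (h : ∀ᶠ y in 𝓝 x, α.SmoothAt y) :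
    α.extD.extD x = 0 := by
  have h1 : extDeriv (extDeriv (α.inChart x)) (chartAt E x x) = 0 :=
    extDeriv_extDeriv_apply h.self_of_nhds (by simp; exact WithTop.coe_le_coe.2 le_top)
  rw [DForm.extD, (inChart_extD h).extDeriv_eq, h1]
  rfl

theorem exactForms_le_closedForms : exactForms E M k ≤ closedForms E M (k + 1) := by
  rintro _ ⟨β, hβ, rfl⟩
  exact ⟨fun x => SmoothAt.extD (.of_forall hβ), funext fun x => extD_extD (.of_forall hβ)⟩

end Manifold

/-! ### Multiplication with functions, gluing -/

/-- The product of a function and a form. -/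
def fsmul (f : M → ℝ) (α : DForm E M k) : DForm E M k := fun x => f x • α x

theorem SmoothAt.fsmul [IsManifold 𝓘(ℝ, E) ∞ M] {f : M → ℝ} {α : DForm E M k} {x : M}
    (hf : ContMDiffAt 𝓘(ℝ, E) 𝓘(ℝ, ℝ) ∞ f x) (hα : α.SmoothAt x) : (fsmul f α).SmoothAt x := by
  have h1 : ContDiffAt ℝ ∞ (f ∘ (chartAt E x).symm) (chartAt E x x) := by
    rw [← contMDiffAt_iff_contDiffAt]
    refine ContMDiffAt.comp _ ?_ (contMDiffAt_chartAt_symm (mem_chart_target E x))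
    simpa using hf
  exact h1.smul hα

/-- A finite sum of products `fᵢ αᵢ` is smooth if each `αᵢ` is so on the support of `fᵢ`. -/
theorem smooth_sum_fsmul [IsManifold 𝓘(ℝ, E) ∞ M] {ι : Type*} {s : Finset ι} {f : ι → M → ℝ}
    {α : ι → DForm E M k} (hf : ∀ i ∈ s, ContMDiff 𝓘(ℝ, E) 𝓘(ℝ, ℝ) ∞ (f i))
    (hα : ∀ i ∈ s, ∀ x ∈ tsupport (f i), (α i).SmoothAt x) :
    DForm.Smooth (∑ i ∈ s, DForm.fsmul (f i) (α i)) := by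
  intro x
  refine SmoothAt.sum fun i hi => ?_
  by_cases hx : x ∈ tsupport (f i)
  · exact SmoothAt.fsmul (hf i hi x) (hα i hi x hx)
  · refine (SmoothAt.zero x).congr ?_
    filter_upwards [(isClosed_tsupport (f i)).isOpen_compl.mem_nhds hx] with y hy
    rw [DForm.fsmul, image_eq_zero_of_notMem_tsupport hy, zero_smul]
    rfl

/-- Gluing locally defined smooth forms with values in convex sets. -/
theorem exists_smooth_forall_mem_convex [FiniteDimensional ℝ E] [IsManifold 𝓘(ℝ, E) ∞ M]
    [T2Space M] [CompactSpace M] (Q : ∀ x : M, Set (E [⋀^Fin k]→L[ℝ] ℝ))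
    (hQ : ∀ x, Convex ℝ (Q x))
    (h : ∀ x : M, ∃ α : DForm E M k, ∀ᶠ y in 𝓝 x, α.SmoothAt y ∧
      (show E [⋀^Fin k]→L[ℝ] ℝ from α y) ∈ Q y) :
    ∃ α : DForm E M k, α.Smooth ∧ ∀ x, (show E [⋀^Fin k]→L[ℝ] ℝ from α x) ∈ Q x := by
  choose α hα using h
  choose U hU hUo hxU using fun x => eventually_nhds_iff.1 (hα x)
  obtain ⟨t, ht⟩ := isCompact_univ.elim_finite_subcover U hUo fun x _ =>
    Set.mem_iUnion.2 ⟨x, hxU x⟩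
  obtain ⟨ρ, hρ⟩ := SmoothPartitionOfUnity.exists_isSubordinate 𝓘(ℝ, E) (s := (Set.univ : Set M))
    isClosed_univ (fun i : t => U i) (fun i => hUo i) fun x hx => by
      obtain ⟨i, hi, hxi⟩ := Set.mem_iUnion₂.1 (ht hx)
      exact Set.mem_iUnion.2 ⟨⟨i, hi⟩, hxi⟩
  refine ⟨∑ i : t, DForm.fsmul (ρ i) (α i), smooth_sum_fsmul (fun i _ => (ρ i).contMDiff)
    fun i _ x hx => (hU i x (hρ i hx)).1, fun x => ?_⟩
  rw [sum_apply]
  have h2 : (∑ᶠ i : t, ρ i x • (show E [⋀^Fin k]→L[ℝ] ℝ from α i x)) ∈ Q x :=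
    (hQ x).finsum_mem (fun i => ρ.nonneg i x) (ρ.sum_eq_one (Set.mem_univ x)) fun i hi =>
      (hU i x (hρ i (subset_tsupport _ hi))).2
  rwa [finsum_eq_sum_of_fintype] at h2

/-- Two forms which agree on a set have the same differential at the points at which this set has
unique differentials. -/
theorem extD_eq_of_eqOn {N : Set M} {α β : DForm E M k} {x : M} (hα : α.SmoothAt x)
    (hβ : β.SmoothAt x) (hx : x ∈ N) (hN : UniqueMDiffWithinAt 𝓘(ℝ, E) N x)
    (h : ∀ᶠ y in 𝓝 x, y ∈ N → α y = β y) : α.extD x = β.extD x := by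
  have hN' : UniqueDiffWithinAt ℝ ((chartAt E x).symm ⁻¹' N) (chartAt E x x) := by
    have := hN
    simpa [UniqueMDiffWithinAt, extChartAt, mfld_simps] using this
  have h1 : α.inChart x =ᶠ[𝓝[(chartAt E x).symm ⁻¹' N] (chartAt E x x)] β.inChart x := by
    filter_upwards [self_mem_nhdsWithin, mem_nhdsWithin_of_mem_nhds
      ((tendsto_chartAt_symm x).eventually h)] with y h1 h2
    simp only [inChart, h2 h1]
  have h2 : α.inChart x (chartAt E x x) = β.inChart x (chartAt E x x) :=
    h1.eq_of_nhdsWithin (by simpa using hx)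
  -- The differential involves only first derivatives, which by unique differentiability are
  -- determined by the values on `N`; this includes boundary points.
  have h3 := Filter.EventuallyEq.fderivWithin_eq (𝕜 := ℝ) h1 h2
  rw [hα.differentiableAt.fderivWithin hN', hβ.differentiableAt.fderivWithin hN'] at h3
  simp only [extD, extDeriv, h3]

end DForm

end FormCalculus

/-! ### The homotopy operator on manifolds. -/

section HomotopyOperator

open Set MeasureTheory

variable {E : Type*} [NormedAddCommGroup E] [NormedSpace ℝ E]
  {M : Type*} [TopologicalSpace M] [ChartedSpace E M]
  {E' : Type*} [NormedAddCommGroup E'] [NormedSpace ℝ E']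
  {M' : Type*} [TopologicalSpace M'] [ChartedSpace E' M']

namespace DForm

/-- The integrand of the homotopy operator: the contraction of `τ` with the velocity of the
homotopy `G`, pulled back along `G t`. -/
def homotopyIntegrand (E : Type*) [NormedAddCommGroup E] [NormedSpace ℝ E]
    {M : Type*} [TopologicalSpace M] [ChartedSpace E M]
    (G : ℝ → M → M') (τ : DForm E' M' 2) (x : M) (t : ℝ) : E [⋀^Fin 1]→L[ℝ] ℝ :=
  ((show E' [⋀^Fin 2]→L[ℝ] ℝ from τ (G t x)).curryLeft
    (mfderiv 𝓘(ℝ, ℝ) 𝓘(ℝ, E') (fun s => G s x) t (1 : ℝ))).compContinuousLinearMap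
      (mfderiv 𝓘(ℝ, E) 𝓘(ℝ, E') (G t) x)

/-- The homotopy operator of the homotopy `G`, on 2-forms. -/
def homotopyOp (E : Type*) [NormedAddCommGroup E] [NormedSpace ℝ E]
    {M : Type*} [TopologicalSpace M] [ChartedSpace E M]
    (G : ℝ → M → M') (τ : DForm E' M' 2) : DForm E M 1 :=
  fun x => (∫ t in (0 : ℝ)..1, homotopyIntegrand E G τ x t : E [⋀^Fin 1]→L[ℝ] ℝ)

variable [IsManifold 𝓘(ℝ, E) ∞ M] [IsManifold 𝓘(ℝ, E') ∞ M']

/-- The homotopy `G` read in the chart at `x`. -/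
def homotopyInChart (G : ℝ → M → M') (x : M) : ℝ × E → M' :=
  fun z => G z.1 ((chartAt E x).symm z.2)

omit [IsManifold 𝓘(ℝ, E') ∞ M'] in
theorem contMDiffAt_homotopyInChart {n : WithTop ℕ∞} (hn : n ≤ ∞) {G : ℝ → M → M'}
    {x : M} {t : ℝ} {y : E}
    (hy : y ∈ (chartAt E x).target)
    (hG : ContMDiffAt (𝓘(ℝ, ℝ).prod 𝓘(ℝ, E)) 𝓘(ℝ, E') n (Function.uncurry G)
      (t, (chartAt E x).symm y)) :
    ContMDiffAt 𝓘(ℝ, ℝ × E) 𝓘(ℝ, E') n (homotopyInChart (E := E) G x) (t, y) := by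
  have h1 : ContMDiffAt 𝓘(ℝ, ℝ × E) 𝓘(ℝ, ℝ) n (fun z : ℝ × E => z.1) (t, y) :=
    contDiff_fst.contMDiff.contMDiffAt
  have h2 : ContMDiffAt 𝓘(ℝ, ℝ × E) 𝓘(ℝ, E) n (fun z : ℝ × E => z.2) (t, y) :=
    contDiff_snd.contMDiff.contMDiffAt
  have h3 : ContMDiffAt 𝓘(ℝ, ℝ × E) 𝓘(ℝ, E) n (fun z : ℝ × E => (chartAt E x).symm z.2) (t, y) :=
    ((contMDiffAt_chartAt_symm hy).of_le hn).comp (t, y) h2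
  exact ContMDiffAt.comp (t, y) (g := Function.uncurry G) hG (h1.prodMk h3)

omit [IsManifold 𝓘(ℝ, E') ∞ M'] in
-- By the chain rule, the derivative of the homotopy in the chart sends `∂/∂t` to the velocity and
-- `E` through the spatial derivative. This links the intrinsic integrand to the flat homotopy
-- formula.
theorem contractFst_pullback_homotopyInChart {G : ℝ → M → M'} {x : M} {t : ℝ} {y : E}
    (hy : y ∈ (chartAt E x).target) (τ : DForm E' M' 2)
    (hG : ContMDiffAt (𝓘(ℝ, ℝ).prod 𝓘(ℝ, E)) 𝓘(ℝ, E') 1 (Function.uncurry G)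
      (t, (chartAt E x).symm y)) :
    contractFst E (show (ℝ × E) [⋀^Fin 2]→L[ℝ] ℝ from
        pullback (ℝ × E) (homotopyInChart (E := E) G x) τ (t, y)) =
      (homotopyIntegrand E G τ ((chartAt E x).symm y) t).compContinuousLinearMap
        (mfderiv 𝓘(ℝ, E) 𝓘(ℝ, E) (chartAt E x).symm y) := by
  have hA := (contMDiffAt_homotopyInChart (by simp) hy hG).mdifferentiableAt (by simp)
  have hs : MDifferentiableAt 𝓘(ℝ, E) 𝓘(ℝ, E) (chartAt E x).symm y :=
    (contMDiffAt_chartAt_symm hy).mdifferentiableAt (by simp)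
  have hGt : MDifferentiableAt 𝓘(ℝ, E) 𝓘(ℝ, E') (G t) ((chartAt E x).symm y) :=
    (hG.comp (f := fun z : M => (t, z)) ((chartAt E x).symm y)
      (contMDiffAt_const.prodMk contMDiffAt_id)).mdifferentiableAt (by simp)
  have hl : MDifferentiableAt 𝓘(ℝ, ℝ) 𝓘(ℝ, ℝ × E) (fun s : ℝ => (s, y)) t :=
    (hasFDerivAt_prodMk_left t y).differentiableAt.mdifferentiableAt
  have hr : MDifferentiableAt 𝓘(ℝ, E) 𝓘(ℝ, ℝ × E) (fun w : E => (t, w)) y :=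
    (hasFDerivAt_prodMk_right t y).differentiableAt.mdifferentiableAt
  have h1 : mfderiv 𝓘(ℝ, ℝ) 𝓘(ℝ, E') (fun s => G s ((chartAt E x).symm y)) t =
      (mfderiv 𝓘(ℝ, ℝ × E) 𝓘(ℝ, E') (homotopyInChart (E := E) G x) (t, y)).comp
        (ContinuousLinearMap.inl ℝ ℝ E) := by
    have := mfderiv_comp t hA hl
    rw [mfderiv_eq_fderiv, (hasFDerivAt_prodMk_left t y).fderiv] at this
    exact this
  have h2 : (mfderiv 𝓘(ℝ, E) 𝓘(ℝ, E') (G t) ((chartAt E x).symm y)).comp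
      (mfderiv 𝓘(ℝ, E) 𝓘(ℝ, E) (chartAt E x).symm y) =
      (mfderiv 𝓘(ℝ, ℝ × E) 𝓘(ℝ, E') (homotopyInChart (E := E) G x) (t, y)).comp
        (ContinuousLinearMap.inr ℝ ℝ E) := by
    have := mfderiv_comp y hA hr
    rw [mfderiv_eq_fderiv, (hasFDerivAt_prodMk_right t y).fderiv] at this
    exact (mfderiv_comp y hGt hs).symm.trans this
  ext v
  rw [contractFst_apply]
  have e1 : (mfderiv 𝓘(ℝ, ℝ × E) 𝓘(ℝ, E') (homotopyInChart (E := E) G x) (t, y) (1, 0) : E') =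
      mfderiv 𝓘(ℝ, ℝ) 𝓘(ℝ, E') (fun s => G s ((chartAt E x).symm y)) t (1 : ℝ) :=
    (congrArg (fun T : ℝ →L[ℝ] E' => T 1) h1).symm
  have e2 : (mfderiv 𝓘(ℝ, ℝ × E) 𝓘(ℝ, E') (homotopyInChart (E := E) G x) (t, y) (0, v 0) : E') =
      mfderiv 𝓘(ℝ, E) 𝓘(ℝ, E') (G t) ((chartAt E x).symm y)
        (mfderiv 𝓘(ℝ, E) 𝓘(ℝ, E) (chartAt E x).symm y (v 0)) :=
    (congrArg (fun T : E →L[ℝ] E' => T (v 0)) h2).symm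
  refine congrArg (show E' [⋀^Fin 2]→L[ℝ] ℝ from τ (G t ((chartAt E x).symm y))) ?_
  funext i
  fin_cases i
  · exact e1
  · exact e2

variable [FiniteDimensional ℝ E] [FiniteDimensional ℝ E']

theorem contDiffAt_pullback_homotopyInChart {G : ℝ → M → M'} {x : M} {τ : DForm E' M' 2}
    (hτ : τ.Smooth) (hG : ∀ t ∈ Icc (0 : ℝ) 1,
      ContMDiffAt (𝓘(ℝ, ℝ).prod 𝓘(ℝ, E)) 𝓘(ℝ, E') ∞ (Function.uncurry G) (t, x)) :
    ∀ t ∈ Icc (0 : ℝ) 1, ContDiffAt ℝ ∞ (fun z => (show (ℝ × E) [⋀^Fin 2]→L[ℝ] ℝ from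
        pullback (ℝ × E) (homotopyInChart (E := E) G x) τ z)) (t, chartAt E x x) := fun t ht =>
  smoothAt_self_iff.1 <| (hτ _).pullback <|
    contMDiffAt_homotopyInChart le_rfl (mem_chart_target E x) <| by
      rw [(chartAt E x).left_inv (mem_chart_source E x)]; exact hG t ht

theorem inChart_homotopyOp {G : ℝ → M → M'} {x : M} {τ : DForm E' M' 2}
    (hτ : τ.Smooth) (hG : ∀ t ∈ Icc (0 : ℝ) 1,
      ContMDiffAt (𝓘(ℝ, ℝ).prod 𝓘(ℝ, E)) 𝓘(ℝ, E') ∞ (Function.uncurry G) (t, x)) :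
    (homotopyOp E G τ).inChart x =ᶠ[𝓝 (chartAt E x x)] fun y => ∫ t in (0 : ℝ)..1,
      contractFst E (show (ℝ × E) [⋀^Fin 2]→L[ℝ] ℝ from
        pullback (ℝ × E) (homotopyInChart (E := E) G x) τ (t, y)) := by
  obtain ⟨W, hW, hxW, h⟩ := eventually_forall_Icc_of_contDiffAt 1
    (contDiffAt_pullback_homotopyInChart hτ hG)
  have hG1 : ∀ᶠ z in 𝓝 x, ∀ t ∈ Icc (0 : ℝ) 1,
      ContMDiffAt (𝓘(ℝ, ℝ).prod 𝓘(ℝ, E)) 𝓘(ℝ, E') 1 (Function.uncurry G) (t, z) :=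
    isCompact_Icc.eventually_forall_of_forall_eventually fun t ht =>
      (continuous_swap.tendsto (x, t)).eventually <|
        (contMDiffAt_iff_contMDiffAt_nhds (by simp)).1 ((hG t ht).of_le (by simp))
  filter_upwards [hW.mem_nhds hxW, (tendsto_chartAt_symm x).eventually hG1,
    (chartAt E x).open_target.mem_nhds (mem_chart_target E x)] with y hyW hy ht
  have hd : (chartAt E x).MDifferentiable 𝓘(ℝ, E) 𝓘(ℝ, E) :=
    haveI := IsManifold.of_le (I := 𝓘(ℝ, E)) (M := M) (m := 1) (n := ∞) (by simp)
    mdifferentiable_of_mem_atlas (chart_mem_atlas E x)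
  set L : E →L[ℝ] E := mfderiv 𝓘(ℝ, E) 𝓘(ℝ, E) (chartAt E x).symm y with hL
  set L' : E →L[ℝ] E := mfderiv 𝓘(ℝ, E) 𝓘(ℝ, E) (chartAt E x) ((chartAt E x).symm y) with hL'
  have hLL : L.comp L' = ContinuousLinearMap.id ℝ E := by
    have := hd.symm_comp_deriv ((chartAt E x).map_target ht)
    rw [(chartAt E x).right_inv ht] at this
    exact this
  have hkey : ∀ t ∈ Icc (0 : ℝ) 1, contractFst E (show (ℝ × E) [⋀^Fin 2]→L[ℝ] ℝ from
        pullback (ℝ × E) (homotopyInChart (E := E) G x) τ (t, y)) =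
      (homotopyIntegrand E G τ ((chartAt E x).symm y) t).compContinuousLinearMap L :=
    fun t ht' => contractFst_pullback_homotopyInChart ht τ (hy t ht')
  -- Continuity in `t` is known for the expression in the chart, that is, after pulling back by `L`.
  -- Pulling back by `L'`, with `L ∘ L' = id`, transfers integrability to the intrinsic integrand.
  have hint : IntervalIntegrable (homotopyIntegrand E G τ ((chartAt E x).symm y)) volume 0 1 := by
    have h1 : IntervalIntegrable (fun t => ContinuousAlternatingMap.compContinuousLinearMapCLM L'
        (contractFst E (show (ℝ × E) [⋀^Fin 2]→L[ℝ] ℝ from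
        pullback (ℝ × E) (homotopyInChart (E := E) G x) τ (t, y)))) volume 0 1 :=
      intervalIntegrable_slice (f := fun z => ContinuousAlternatingMap.compContinuousLinearMapCLM L'
        (contractFst E (show (ℝ × E) [⋀^Fin 2]→L[ℝ] ℝ from
        pullback (ℝ × E) (homotopyInChart (E := E) G x) τ z))) fun t ht' =>
        (ContinuousAlternatingMap.compContinuousLinearMapCLM L').continuous.continuousAt.comp
          ((contractFst E).continuous.continuousAt.comp (h t ht' y hyW).continuousAt)
    refine h1.congr fun t ht' => ?_
    rw [uIoc_of_le zero_le_one] at ht'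
    change ContinuousAlternatingMap.compContinuousLinearMapCLM L' (contractFst E _) = _
    rw [hkey t (Ioc_subset_Icc_self ht')]
    ext v
    exact congrArg (homotopyIntegrand E G τ ((chartAt E x).symm y) t)
      (funext fun i => congrArg (fun T : E →L[ℝ] E => T (v i)) hLL)
  rw [intervalIntegral.integral_congr (g := fun t =>
    ContinuousAlternatingMap.compContinuousLinearMapCLM L
      (homotopyIntegrand E G τ ((chartAt E x).symm y) t))
    (by rw [uIcc_of_le zero_le_one]; exact hkey),
    ContinuousLinearMap.intervalIntegral_comp_comm _ hint]
  rfl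

theorem smoothAt_homotopyOp {G : ℝ → M → M'} {x : M} {τ : DForm E' M' 2}
    (hτ : τ.Smooth) (hG : ∀ t ∈ Icc (0 : ℝ) 1,
      ContMDiffAt (𝓘(ℝ, ℝ).prod 𝓘(ℝ, E)) 𝓘(ℝ, E') ∞ (Function.uncurry G) (t, x)) :
    (homotopyOp E G τ).SmoothAt x := by
  refine ContDiffAt.congr_of_eventuallyEq ?_ (inChart_homotopyOp hτ hG)
  exact contDiffAt_intervalIntegral fun t ht => (contractFst E).contDiff.contDiffAt.comp _
    (contDiffAt_pullback_homotopyInChart hτ hG t ht)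

/-- The homotopy formula. -/
theorem extD_homotopyOp {G : ℝ → M → M'} {x : M} {τ : DForm E' M' 2}
    (hτ : τ ∈ closedForms E' M' 2) (hG : ∀ t ∈ Icc (0 : ℝ) 1,
      ContMDiffAt (𝓘(ℝ, ℝ).prod 𝓘(ℝ, E)) 𝓘(ℝ, E') ∞ (Function.uncurry G) (t, x)) :
    (homotopyOp E G τ).extD x = pullback E (G 1) τ x - pullback E (G 0) τ x := by
  have hA : ∀ t ∈ Icc (0 : ℝ) 1, ContMDiffAt 𝓘(ℝ, ℝ × E) 𝓘(ℝ, E') ∞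
      (homotopyInChart (E := E) G x) (t, chartAt E x x) := fun t ht =>
    contMDiffAt_homotopyInChart le_rfl (mem_chart_target E x) <| by
      rw [(chartAt E x).left_inv (mem_chart_source E x)]; exact hG t ht
  have hφ : MDifferentiableAt 𝓘(ℝ, E) 𝓘(ℝ, E) (chartAt E x) x :=
    haveI := IsManifold.of_le (I := 𝓘(ℝ, E)) (M := M) (m := 1) (n := ∞) (by simp)
    mdifferentiableAt_atlas (chart_mem_atlas E x) (mem_chart_source E x)
  have hcl : ∀ t ∈ Icc (0 : ℝ) 1, extDeriv (fun z => (show (ℝ × E) [⋀^Fin 2]→L[ℝ] ℝ from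
        pullback (ℝ × E) (homotopyInChart (E := E) G x) τ z)) (t, chartAt E x x) = 0 := by
    intro t ht
    have := extD_pullback (hτ.1 _) (hA t ht)
    rw [extD_self, hτ.2] at this
    exact this.trans (ContinuousAlternatingMap.ext fun _ => rfl)
  -- Near `x` the map `G t` is the chart followed by the slice at time `t` of the homotopy in the
  -- chart; this identifies the two ends of the flat formula.
  have hend : ∀ t ∈ Icc (0 : ℝ) 1, pullback E (G t) τ x =
      ((show (ℝ × E) [⋀^Fin 2]→L[ℝ] ℝ from pullback (ℝ × E) (homotopyInChart (E := E) G x) τ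
        (t, chartAt E x x)).compContinuousLinearMap
        (ContinuousLinearMap.inr ℝ ℝ E)).compContinuousLinearMap
          (mfderiv 𝓘(ℝ, E) 𝓘(ℝ, E) (chartAt E x) x) := by
    intro t ht
    have h1 : G t =ᶠ[𝓝 x] fun z => homotopyInChart (E := E) G x (t, chartAt E x z) := by
      filter_upwards [(chartAt E x).open_source.mem_nhds (mem_chart_source E x)] with z hz
      simp [homotopyInChart, (chartAt E x).left_inv hz]
    have hr : MDifferentiableAt 𝓘(ℝ, E) 𝓘(ℝ, ℝ × E) (fun w : E => (t, w)) (chartAt E x x) :=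
      (hasFDerivAt_prodMk_right t _).differentiableAt.mdifferentiableAt
    have hAt := (hA t ht).mdifferentiableAt (by simp)
    rw [pullback_congr h1, pullback_comp (f := chartAt E x)
      (g := fun w => homotopyInChart (E := E) G x (t, w)) (hAt.comp _ hr) hφ]
    have h2 : pullback E (fun w : E => homotopyInChart (E := E) G x (t, w)) τ (chartAt E x x) =
      (show (ℝ × E) [⋀^Fin 2]→L[ℝ] ℝ from pullback (ℝ × E) (homotopyInChart (E := E) G x) τ
        (t, chartAt E x x)).compContinuousLinearMap (ContinuousLinearMap.inr ℝ ℝ E) := by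
      rw [pullback_comp (f := fun w : E => (t, w)) (g := homotopyInChart (E := E) G x) hAt hr]
      rw [pullback, mfderiv_eq_fderiv, (hasFDerivAt_prodMk_right t _).fderiv]
      rfl
    ext v
    exact congrArg (fun β : E [⋀^Fin 2]→L[ℝ] ℝ => β fun i =>
      mfderiv 𝓘(ℝ, E) 𝓘(ℝ, E) (chartAt E x) x (v i)) h2
  rw [hend 1 (by simp), hend 0 (by simp), extD, (inChart_homotopyOp hτ.1 hG).extDeriv_eq,
    extDeriv_intervalIntegral_contractFst (contDiffAt_pullback_homotopyInChart hτ.1 hG) hcl]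
  rfl

end DForm

end HomotopyOperator

/-! ### Linear algebra of the rank of alternating 2-forms. -/

section Rank

variable {E : Type*} [NormedAddCommGroup E] [NormedSpace ℝ E]
  {E' : Type*} [NormedAddCommGroup E'] [NormedSpace ℝ E']

/-- The rank of an alternating 2-form on a vector space. -/
def formRank (η : E [⋀^Fin 2]→L[ℝ] ℝ) : ℕ :=
  Module.finrank ℝ (LinearMap.range (η.curryLeft : E →ₗ[ℝ] E [⋀^Fin 1]→L[ℝ] ℝ))

theorem curryLeft_eq_zero_iff (η : E [⋀^Fin 2]→L[ℝ] ℝ) (v : E) :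
    η.curryLeft v = 0 ↔ ∀ w, η ![v, w] = 0 := by
  constructor
  · intro h w
    have := congrArg (fun β : E [⋀^Fin 1]→L[ℝ] ℝ => β ![w]) h
    exact this
  · intro h
    ext w
    have hw : w = ![w 0] := by funext i; fin_cases i; rfl
    rw [hw]
    exact h (w 0)

theorem form_swap (η : E [⋀^Fin 2]→L[ℝ] ℝ) (v w : E) : η ![w, v] = -η ![v, w] := by
  have h := η.toAlternatingMap.map_swap ![v, w] (i := 0) (j := 1) (by simp)
  have h1 : ![v, w] ∘ Equiv.swap (0 : Fin 2) 1 = ![w, v] := by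
    funext i; fin_cases i <;> rfl
  rw [h1] at h
  exact h

theorem form_zero_right (η : E [⋀^Fin 2]→L[ℝ] ℝ) (v : E) : η ![v, 0] = 0 :=
  η.map_coord_zero 1 rfl

variable [FiniteDimensional ℝ E] [FiniteDimensional ℝ E']

theorem formRank_add_finrank_ker (η : E [⋀^Fin 2]→L[ℝ] ℝ) :
    formRank η + Module.finrank ℝ (LinearMap.ker (η.curryLeft : E →ₗ[ℝ] E [⋀^Fin 1]→L[ℝ] ℝ)) =
      Module.finrank ℝ E :=
  LinearMap.finrank_range_add_finrank_ker _

/-- On an odd-dimensional space an alternating 2-form is degenerate. -/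
theorem formRank_lt_of_odd (hE : Odd (Module.finrank ℝ E)) (η : E [⋀^Fin 2]→L[ℝ] ℝ) :
    formRank η < Module.finrank ℝ E := by
  classical
  let b := Module.finBasis ℝ E
  let A : Matrix (Fin (Module.finrank ℝ E)) (Fin (Module.finrank ℝ E)) ℝ :=
    Matrix.of fun i j => η ![b j, b i]
  have hA : A.transpose = -A := by
    ext i j
    exact form_swap η _ _
  -- In odd size skew-symmetry gives `det A = det Aᵀ = det (-A) = -det A`. A kernel vector of `A`
  -- then gives a nonzero vector with vanishing contraction.
  have hdet : A.det = 0 := by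
    have h1 := A.det_transpose
    rw [hA, Matrix.det_neg, Fintype.card_fin, hE.neg_one_pow] at h1
    linarith
  obtain ⟨c, hc, h⟩ := Matrix.exists_mulVec_eq_zero_iff.2 hdet
  have hker : η.curryLeft (∑ j, c j • b j) = 0 := by
    have h2 : ∀ i, η.curryLeft (∑ j, c j • b j) ![b i] = 0 := by
      intro i
      have h3 := congrFun h i
      rw [map_sum, ContinuousAlternatingMap.sum_apply]
      refine Eq.trans ?_ h3
      simp only [Matrix.mulVec, dotProduct]
      refine Finset.sum_congr rfl fun j _ => ?_
      rw [map_smul, mul_comm]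
      rfl
    refine (curryLeft_eq_zero_iff _ _).2 fun w => ?_
    have h4 : (((ContinuousAlternatingMap.apply ℝ E ℝ ![∑ j, c j • b j]).comp
        η.curryLeft : E →L[ℝ] ℝ) : E →ₗ[ℝ] ℝ) = 0 := by
      refine b.ext fun i => ?_
      have h5 : η ![b i, ∑ j, c j • b j] = 0 := by
        rw [form_swap, neg_eq_zero]; exact h2 i
      exact h5
    rw [form_swap, neg_eq_zero]
    exact congrArg (fun T : E →ₗ[ℝ] ℝ => T w) h4
  have hne : ∑ j, c j • b j ≠ 0 := fun h0 => hc (by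
    have := Fintype.linearIndependent_iff.1 b.linearIndependent c h0
    exact funext this)
  have h6 := formRank_add_finrank_ker η
  have h7 : 0 < Module.finrank ℝ
      (LinearMap.ker (η.curryLeft : E →ₗ[ℝ] E [⋀^Fin 1]→L[ℝ] ℝ)) := by
    refine Module.finrank_pos_iff_exists_ne_zero.2 ⟨⟨_, hker⟩, fun h8 => hne ?_⟩
    exact congrArg Subtype.val h8
  omega

/-- The contraction map of the pulled-back form factors as transpose of `L`, contraction of `η`,
`L`; composition cannot raise the rank. -/
theorem formRank_comp_le (η : E' [⋀^Fin 2]→L[ℝ] ℝ) (L : E →L[ℝ] E') :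
    formRank (η.compContinuousLinearMap L) ≤ formRank η := by
  have h : ((η.compContinuousLinearMap L).curryLeft : E →ₗ[ℝ] E [⋀^Fin 1]→L[ℝ] ℝ) =
      ((ContinuousAlternatingMap.compContinuousLinearMapCLM L :
        (E' [⋀^Fin 1]→L[ℝ] ℝ) →L[ℝ] E [⋀^Fin 1]→L[ℝ] ℝ) :
          (E' [⋀^Fin 1]→L[ℝ] ℝ) →ₗ[ℝ] E [⋀^Fin 1]→L[ℝ] ℝ) ∘ₗ ((η.curryLeft : E' →ₗ[ℝ] E' [⋀^Fin 1]→L[ℝ] ℝ) ∘ₗ (L : E →ₗ[ℝ] E')) := by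
    apply LinearMap.ext
    intro v
    exact η.curryLeft_compContinuousLinearMap L v
  rw [formRank, h, LinearMap.range_comp]
  refine (Submodule.finrank_map_le _ _).trans ?_
  exact Submodule.finrank_mono (LinearMap.range_comp_le_range _ _)

/-- The rank is lower semicontinuous. -/
theorem eventually_le_formRank {X : Type*} [TopologicalSpace X] {g : X → E [⋀^Fin 2]→L[ℝ] ℝ}
    {x : X} (hg : ContinuousAt g x) : ∀ᶠ y in 𝓝 x, formRank (g x) ≤ formRank (g y) := by
  have h1 : ContinuousAt (fun y => (g y).curryLeft) x :=
    (ContinuousAlternatingMap.curryLeftLI (𝕜 := ℝ) (E := E) (F := ℝ)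
      (n := 1)).continuous.continuousAt.comp hg
  have h2 := isOpen_setOfPred_nat_le_rank (𝕜 := ℝ) (E := E) (F := E [⋀^Fin 1]→L[ℝ] ℝ) (formRank (g x))
  have h3 : ∀ η : E [⋀^Fin 2]→L[ℝ] ℝ, ((formRank η : ℕ) : Cardinal) =
      (η.curryLeft : E →ₗ[ℝ] E [⋀^Fin 1]→L[ℝ] ℝ).rank := fun η =>
    Module.finrank_eq_rank ℝ _
  have h4 := h1.eventually (h2.mem_nhds (by
    change ((formRank (g x) : ℕ) : Cardinal) ≤ _
    rw [h3]))
  filter_upwards [h4] with y hy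
  have hy' : ((formRank (g x) : ℕ) : Cardinal) ≤ ((formRank (g y) : ℕ) : Cardinal) := by
    rw [h3 (g y)]; exact hy
  exact_mod_cast hy'

/-- The rank of a direct sum of a form of corank at most one and a nondegenerate form. -/
theorem finrank_le_formRank_prod (β : E [⋀^Fin 2]→L[ℝ] ℝ) (σ : E' [⋀^Fin 2]→L[ℝ] ℝ)
    (hβ : Module.finrank ℝ E ≤ formRank β + 1) (hσ : Module.finrank ℝ E' ≤ formRank σ) :
    Module.finrank ℝ (E × E') ≤ formRank
      (σ.compContinuousLinearMap (ContinuousLinearMap.snd ℝ E E') +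
        β.compContinuousLinearMap (ContinuousLinearMap.fst ℝ E E')) + 1 := by
  set η := σ.compContinuousLinearMap (ContinuousLinearMap.snd ℝ E E') +
        β.compContinuousLinearMap (ContinuousLinearMap.fst ℝ E E') with hη
  have hηv : ∀ v w, η ![v, w] = σ ![v.2, w.2] + β ![v.1, w.1] := by
    intro v w
    have e1 : (fun i => (![v, w] i).2) = ![v.2, w.2] := by funext i; fin_cases i <;> rfl
    have e2 : (fun i => (![v, w] i).1) = ![v.1, w.1] := by funext i; fin_cases i <;> rfl
    rw [← e1, ← e2]; rfl
  have h1 := formRank_add_finrank_ker η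
  have h2 := formRank_add_finrank_ker β
  have h3 := formRank_add_finrank_ker σ
  have hinj : ∀ v, σ.curryLeft v = 0 → v = 0 := by
    intro v hv
    have h4 : LinearMap.ker (σ.curryLeft : E' →ₗ[ℝ] E' [⋀^Fin 1]→L[ℝ] ℝ) = ⊥ :=
      Submodule.finrank_eq_zero.1 (by omega)
    have h5 : v ∈ LinearMap.ker (σ.curryLeft : E' →ₗ[ℝ] E' [⋀^Fin 1]→L[ℝ] ℝ) := hv
    rw [h4] at h5
    exact h5
  -- Testing against `(0, w)` and `(w, 0)` separates the summands, so the kernel embeds into the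
  -- kernel of `β`, whose dimension is at most one.
  have hker : ∀ v : E × E', η.curryLeft v = 0 → v.2 = 0 ∧ β.curryLeft v.1 = 0 := by
    intro v hv
    rw [curryLeft_eq_zero_iff] at hv
    refine ⟨hinj _ ((curryLeft_eq_zero_iff _ _).2 fun w => ?_),
      (curryLeft_eq_zero_iff _ _).2 fun w => ?_⟩
    · have := hv (0, w)
      rwa [hηv, form_zero_right, add_zero] at this
    · have := hv (w, 0)
      rwa [hηv, form_zero_right, zero_add] at this
  have h4 : Module.finrank ℝ (LinearMap.ker
      (η.curryLeft : (E × E') →ₗ[ℝ] (E × E') [⋀^Fin 1]→L[ℝ] ℝ)) ≤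
      Module.finrank ℝ (LinearMap.ker (β.curryLeft : E →ₗ[ℝ] E [⋀^Fin 1]→L[ℝ] ℝ)) := by
    let f : LinearMap.ker (η.curryLeft : (E × E') →ₗ[ℝ] (E × E') [⋀^Fin 1]→L[ℝ] ℝ) →ₗ[ℝ]
        LinearMap.ker (β.curryLeft : E →ₗ[ℝ] E [⋀^Fin 1]→L[ℝ] ℝ) :=
      ((LinearMap.fst ℝ E E').domRestrict _).codRestrict _ fun v => (hker v.1 v.2).2
    refine LinearMap.finrank_le_finrank_of_injective (f := f) fun v w h => ?_
    apply Subtype.ext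
    refine Prod.ext (congrArg Subtype.val h) ?_
    rw [(hker v.1 v.2).1, (hker w.1 w.2).1]
  omega

end Rank

/-! ### Ranks of forms on manifolds. -/

section Presymplectic

variable {E : Type*} [NormedAddCommGroup E] [NormedSpace ℝ E]
  {M : Type*} [TopologicalSpace M] [ChartedSpace E M] [IsManifold 𝓘(ℝ, E) ∞ M]

/-- The value at `x` is the pull-back of the chart expression along the derivative of the chart.
Only lower bounds in charts are needed, so this inequality suffices. -/
theorem DForm.rank_le_formRank_inChart [FiniteDimensional ℝ E] (α : DForm E M 2) (x : M) :
    α.rank x ≤ formRank (α.inChart x (chartAt E x x)) := by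
  have hd : (chartAt E x).MDifferentiable 𝓘(ℝ, E) 𝓘(ℝ, E) :=
    haveI := IsManifold.of_le (I := 𝓘(ℝ, E)) (M := M) (m := 1) (n := ∞) (by simp)
    mdifferentiable_of_mem_atlas (chart_mem_atlas E x)
  have h1 := hd.symm_comp_deriv (mem_chart_source E x)
  have h2 : (show E [⋀^Fin 2]→L[ℝ] ℝ from α x) =
      (α.inChart x (chartAt E x x)).compContinuousLinearMap
        (mfderiv 𝓘(ℝ, E) 𝓘(ℝ, E) (chartAt E x) x : E →L[ℝ] E) := by
    ext v
    have h3 := congr_point α ((chartAt E x).left_inv (mem_chart_source E x)).symm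
    refine (congrArg (fun β : E [⋀^Fin 2]→L[ℝ] ℝ => β v) h3).trans ?_
    refine congrArg (show E [⋀^Fin 2]→L[ℝ] ℝ from α ((chartAt E x).symm (chartAt E x x))) ?_
    funext i
    exact (congrArg (fun T : E →L[ℝ] E => T (v i)) h1).symm
  change formRank (show E [⋀^Fin 2]→L[ℝ] ℝ from α x) ≤ _
  rw [h2]
  exact formRank_comp_le _ _

omit [IsManifold 𝓘(ℝ, E) ∞ M] in
theorem IsSymplectic.rank_eq [FiniteDimensional ℝ E] {α : DForm E M 2} (hα : IsSymplectic α)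
    (x : M) : α.rank x = Module.finrank ℝ E :=
  LinearMap.finrank_range_of_inj ((injective_iff_map_eq_zero _).2 (hα.nondegenerate x))

omit [IsManifold 𝓘(ℝ, E) ∞ M] in
theorem IsSymplectic.even_finrank [FiniteDimensional ℝ E] {α : DForm E M 2} (hα : IsSymplectic α)
    (x : M) : Even (Module.finrank ℝ E) := by
  by_contra h
  rw [Nat.not_even_iff_odd] at h
  have h1 := formRank_lt_of_odd h (show E [⋀^Fin 2]→L[ℝ] ℝ from α x)
  have h2 : formRank (show E [⋀^Fin 2]→L[ℝ] ℝ from α x) = _ := hα.rank_eq x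
  omega

end Presymplectic

/-! ### Compactness of the total space and product coordinates on it. -/

section BundleCharts

variable {EB : Type*} [NormedAddCommGroup EB] [NormedSpace ℝ EB]
  {B : Type*} [TopologicalSpace B] [ChartedSpace EB B]
  {EF : Type*} [NormedAddCommGroup EF] [NormedSpace ℝ EF]
  {F : Type*} [TopologicalSpace F] [ChartedSpace EF F]
  {EM : Type*} [NormedAddCommGroup EM] [NormedSpace ℝ EM]
  {M : Type*} [TopologicalSpace M] [ChartedSpace EM M]

namespace SymplecticFibration

variable {p : M → B} {σ₀ : DForm EF F 2} {N₀ : Set F} (P : SymplecticFibration EB EM p σ₀ N₀)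

include P in
-- Each `b` has a compact neighbourhood `K` inside a trivializing set, and `p ⁻¹' K` is the image of
-- the compact set `K × F`. Finitely many such sets cover `M`.
theorem compactSpace [T2Space B] [CompactSpace B] [CompactSpace F] : CompactSpace M := by
  have h : ∀ b : B, ∃ K : Set B, b ∈ interior K ∧ IsCompact (p ⁻¹' K) := by
    intro b
    obtain ⟨e, -, hb⟩ := P.exists_mem b
    obtain ⟨K, hK, hbK, hKe⟩ := exists_compact_subset e.open_baseSet hb
    refine ⟨K, hbK, ?_⟩
    have h1 : p ⁻¹' K = e.toOpenPartialHomeomorph.symm '' (K ×ˢ Set.univ) := by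
      ext x
      constructor
      · intro hx
        have hxe : x ∈ e.source := e.mem_source.2 (hKe hx)
        refine ⟨e x, ⟨?_, trivial⟩, e.toOpenPartialHomeomorph.left_inv hxe⟩
        rw [e.coe_fst hxe]
        exact hx
      · rintro ⟨⟨b', y⟩, ⟨hb', -⟩, rfl⟩
        have : p (e.toOpenPartialHomeomorph.symm (b', y)) = b' :=
          e.proj_symm_apply' (hKe hb')
        rwa [Set.mem_preimage, this]
    rw [h1]
    refine (hK.prod isCompact_univ).image_of_continuousOn
      (e.continuousOn_invFun.mono fun z hz => e.mem_target.2 (hKe hz.1))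
  choose K hK hKc using h
  obtain ⟨t, ht⟩ := isCompact_univ.elim_finite_subcover (fun b => interior (K b))
    (fun _ => isOpen_interior) fun b _ => Set.mem_iUnion.2 ⟨b, hK b⟩
  refine ⟨(t.isCompact_biUnion fun b _ => hKc b).of_isClosed_subset isClosed_univ
    fun x _ => ?_⟩
  obtain ⟨b, hb, hx⟩ := Set.mem_iUnion₂.1 (ht (Set.mem_univ (p x)))
  exact Set.mem_iUnion₂.2 ⟨b, hb, interior_subset (s := K b) hx⟩

/-- The fibre coordinate of a trivialization. -/
def fibreCoord (e : Trivialization F p) (x : M) : F := (e x).2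

theorem contMDiffAt_fibreCoord {e : Trivialization F p} (he : e ∈ P.atlas) {x : M}
    (hx : x ∈ e.source) : ContMDiffAt 𝓘(ℝ, EM) 𝓘(ℝ, EF) ∞ (fibreCoord e) x :=
  ((P.smooth e he).contMDiffAt (e.open_source.mem_nhds hx)).snd

theorem contMDiffAt_symm {e : Trivialization F p} (he : e ∈ P.atlas) {b : B} (hb : b ∈ e.baseSet)
    (y : F) : ContMDiffAt (𝓘(ℝ, EB).prod 𝓘(ℝ, EF)) 𝓘(ℝ, EM) ∞ e.toOpenPartialHomeomorph.symm
      (b, y) :=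
  (P.smooth_symm e he).contMDiffAt (e.open_target.mem_nhds (e.mem_target.2 hb))

omit [ChartedSpace EB B] [ChartedSpace EF F] [ChartedSpace EM M] in
theorem symm_proj_fibreCoord {e : Trivialization F p} {x : M} (hx : x ∈ e.source) :
    e.toOpenPartialHomeomorph.symm (p x, fibreCoord e x) = x := by
  rw [fibreCoord, ← e.coe_fst hx, Prod.mk.eta]
  exact e.toOpenPartialHomeomorph.left_inv hx

theorem proj_fibreIncl {e : Trivialization F p} {b : B} (hb : b ∈ e.baseSet) (y : F) :
    p (fibreIncl e b y) = b := e.proj_symm_apply' hb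

theorem fibreIncl_mem_source {e : Trivialization F p} {b : B} (hb : b ∈ e.baseSet) (y : F) :
    fibreIncl e b y ∈ e.source := e.mem_source.2 (by rwa [proj_fibreIncl hb])

theorem fibreCoord_fibreIncl {e : Trivialization F p} {b : B} (hb : b ∈ e.baseSet) (y : F) :
    fibreCoord e (fibreIncl e b y) = y :=
  congrArg Prod.snd (e.apply_symm_apply' hb)

/-- The map `EB × EF → M` given by a trivialization `e`, the chart of `B` at `p x` and the chart
of `F` at the fibre coordinate of `x`. -/
def bundleParam (EB EF : Type*) [NormedAddCommGroup EB] [NormedSpace ℝ EB]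
    [NormedAddCommGroup EF] [NormedSpace ℝ EF] [ChartedSpace EB B] [ChartedSpace EF F]
    (e : Trivialization F p) (x : M) : EB × EF → M := fun z =>
  e.toOpenPartialHomeomorph.symm ((chartAt EB (p x)).symm z.1,
    (chartAt EF (fibreCoord e x)).symm z.2)

/-- The coordinates inverse to `bundleParam`. -/
def bundleCoord (EB EF : Type*) [NormedAddCommGroup EB] [NormedSpace ℝ EB]
    [NormedAddCommGroup EF] [NormedSpace ℝ EF] [ChartedSpace EB B] [ChartedSpace EF F]
    (e : Trivialization F p) (x : M) : M → EB × EF := fun y =>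
  (chartAt EB (p x) (p y), chartAt EF (fibreCoord e x) (fibreCoord e y))

variable [IsManifold 𝓘(ℝ, EB) ∞ B] [IsManifold 𝓘(ℝ, EF) ∞ F] [IsManifold 𝓘(ℝ, EM) ∞ M]

omit [IsManifold 𝓘(ℝ, EM) ∞ M] in
theorem contMDiffAt_bundleParam {e : Trivialization F p} (he : e ∈ P.atlas) {x : M}
    {z : EB × EF} (h1 : z.1 ∈ (chartAt EB (p x)).target)
    (h2 : (chartAt EB (p x)).symm z.1 ∈ e.baseSet)
    (h3 : z.2 ∈ (chartAt EF (fibreCoord e x)).target) :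
    ContMDiffAt 𝓘(ℝ, EB × EF) 𝓘(ℝ, EM) ∞ (bundleParam EB EF e x) z := by
  have e1 : ContMDiffAt 𝓘(ℝ, EB × EF) 𝓘(ℝ, EB) ∞ (fun z : EB × EF => z.1) z :=
    contDiff_fst.contMDiff.contMDiffAt
  have e2 : ContMDiffAt 𝓘(ℝ, EB × EF) 𝓘(ℝ, EF) ∞ (fun z : EB × EF => z.2) z :=
    contDiff_snd.contMDiff.contMDiffAt
  exact (P.contMDiffAt_symm he h2 _).comp z
    (((DForm.contMDiffAt_chartAt_symm h1).comp z e1).prodMk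
      ((DForm.contMDiffAt_chartAt_symm h3).comp z e2))

omit [IsManifold 𝓘(ℝ, EM) ∞ M] in
theorem contMDiffAt_bundleCoord {e : Trivialization F p} (he : e ∈ P.atlas) {x : M}
    (hx : x ∈ e.source) :
    ContMDiffAt 𝓘(ℝ, EM) 𝓘(ℝ, EB × EF) ∞ (bundleCoord EB EF e x) x := by
  have h1 : ContMDiffAt 𝓘(ℝ, EB) 𝓘(ℝ, EB) ∞ (chartAt EB (p x)) (p x) :=
    contMDiffAt_of_mem_maximalAtlas (IsManifold.chart_mem_maximalAtlas _) (mem_chart_source _ _)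
  have h2 : ContMDiffAt 𝓘(ℝ, EF) 𝓘(ℝ, EF) ∞ (chartAt EF (fibreCoord e x)) (fibreCoord e x) :=
    contMDiffAt_of_mem_maximalAtlas (IsManifold.chart_mem_maximalAtlas _) (mem_chart_source _ _)
  exact (h1.comp x (P.contMDiff_proj x)).prodMk_space (h2.comp x (P.contMDiffAt_fibreCoord he hx))

omit [IsManifold 𝓘(ℝ, EB) ∞ B] [IsManifold 𝓘(ℝ, EF) ∞ F] [IsManifold 𝓘(ℝ, EM) ∞ M] in
theorem bundleParam_bundleCoord (P : SymplecticFibration EB EM p σ₀ N₀)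
    {e : Trivialization F p} (he : e ∈ P.atlas) {x : M}
    (hx : x ∈ e.source) : ∀ᶠ y in 𝓝 x, bundleParam EB EF e x (bundleCoord EB EF e x y) = y := by
  filter_upwards [e.open_source.mem_nhds hx,
    (P.contMDiff_proj.continuous.continuousAt (x := x)).eventually
      ((chartAt EB (p x)).open_source.mem_nhds (mem_chart_source _ _)),
    (P.contMDiffAt_fibreCoord he hx).continuousAt.eventually
      ((chartAt EF (fibreCoord e x)).open_source.mem_nhds (mem_chart_source _ _))] with y h1 h2 h3
  simp only [bundleParam, bundleCoord, (chartAt EB (p x)).left_inv h2,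
    (chartAt EF (fibreCoord e x)).left_inv h3, symm_proj_fibreCoord h1]

omit [IsManifold 𝓘(ℝ, EB) ∞ B] [IsManifold 𝓘(ℝ, EF) ∞ F] [IsManifold 𝓘(ℝ, EM) ∞ M] in
/-- The points of `EB × EF` which are in the domain of `bundleParam`. -/
theorem eventually_mem_bundleParam_domain {e : Trivialization F p} {x : M}
    (hx : x ∈ e.source) : ∀ᶠ z : EB × EF in 𝓝 (bundleCoord EB EF e x x),
      z.1 ∈ (chartAt EB (p x)).target ∧ (chartAt EB (p x)).symm z.1 ∈ e.baseSet ∧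
        z.2 ∈ (chartAt EF (fibreCoord e x)).target := by
  have h1 : Filter.Tendsto Prod.fst (𝓝 (bundleCoord EB EF e x x)) (𝓝 (chartAt EB (p x) (p x))) :=
    continuous_fst.tendsto _
  have h2 : Filter.Tendsto Prod.snd (𝓝 (bundleCoord EB EF e x x))
      (𝓝 (chartAt EF (fibreCoord e x) (fibreCoord e x))) := continuous_snd.tendsto _
  filter_upwards [h1.eventually ((chartAt EB (p x)).open_target.mem_nhds (mem_chart_target _ _)),
    h1.eventually ((DForm.tendsto_chartAt_symm (E := EB) (p x)).eventually
      (e.open_baseSet.mem_nhds (e.mem_source.1 hx))),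
    h2.eventually ((chartAt EF (fibreCoord e x)).open_target.mem_nhds (mem_chart_target _ _))]
    with z h3 h4 h5
  exact ⟨h3, h4, h5⟩

omit [IsManifold 𝓘(ℝ, EM) ∞ M] in
-- The model space `EM` has no a priori relation to `EB × EF`. The bundle coordinates and the
-- parametrization are inverse to each other near the point, so their derivatives are injective in
-- both directions.
theorem finrank_eq (P : SymplecticFibration EB EM p σ₀ N₀) [FiniteDimensional ℝ EB] [FiniteDimensional ℝ EF] [FiniteDimensional ℝ EM]
    (x : M) :
    Module.finrank ℝ EM = Module.finrank ℝ (EB × EF) := by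
  obtain ⟨e, he, hb⟩ := P.exists_mem (p x)
  have hx : x ∈ e.source := e.mem_source.2 hb
  obtain ⟨h1, h2, h3⟩ := (eventually_mem_bundleParam_domain (EB := EB) (EF := EF) hx).self_of_nhds
  have hΨ := (P.contMDiffAt_bundleParam he h1 h2 h3).mdifferentiableAt (by simp)
  have hΘ := (P.contMDiffAt_bundleCoord he hx).mdifferentiableAt (by simp)
  have hpt := (P.bundleParam_bundleCoord he hx).self_of_nhds
  have e1 : bundleParam EB EF e x ∘ bundleCoord EB EF e x =ᶠ[𝓝 x] id :=
    P.bundleParam_bundleCoord he hx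
  have e2 : bundleCoord EB EF e x ∘ bundleParam EB EF e x =ᶠ[𝓝 (bundleCoord EB EF e x x)] id := by
    filter_upwards [eventually_mem_bundleParam_domain (EB := EB) (EF := EF) hx] with z hz
    have h4 : p (bundleParam EB EF e x z) = (chartAt EB (p x)).symm z.1 :=
      proj_fibreIncl hz.2.1 _
    have h5 : fibreCoord e (bundleParam EB EF e x z) = (chartAt EF (fibreCoord e x)).symm z.2 :=
      fibreCoord_fibreIncl hz.2.1 _
    simp only [Function.comp, bundleCoord, h4, h5, (chartAt EB (p x)).right_inv hz.1,
      (chartAt EF (fibreCoord e x)).right_inv hz.2.2, Prod.mk.eta, id]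
  have d1 := mfderiv_comp x hΨ hΘ
  rw [e1.mfderiv_eq, mfderiv_id] at d1
  have d2 := mfderiv_comp (bundleCoord EB EF e x x)
    (g := bundleCoord EB EF e x) (f := bundleParam EB EF e x) (by rw [hpt]; exact hΘ) hΨ
  rw [e2.mfderiv_eq, mfderiv_id] at d2
  have i1 : Function.Injective (mfderiv 𝓘(ℝ, EM) 𝓘(ℝ, EB × EF) (bundleCoord EB EF e x) x :
      EM →L[ℝ] EB × EF) := Function.LeftInverse.injective
    (g := (mfderiv 𝓘(ℝ, EB × EF) 𝓘(ℝ, EM) (bundleParam EB EF e x) (bundleCoord EB EF e x x) :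
      EB × EF →L[ℝ] EM)) fun v => (congrArg (fun T : EM →L[ℝ] EM => T v) d1).symm
  have i2 : Function.Injective (mfderiv 𝓘(ℝ, EB × EF) 𝓘(ℝ, EM) (bundleParam EB EF e x)
      (bundleCoord EB EF e x x) : EB × EF →L[ℝ] EM) := Function.LeftInverse.injective
    (g := (mfderiv 𝓘(ℝ, EM) 𝓘(ℝ, EB × EF) (bundleCoord EB EF e x) (bundleParam EB EF e x
      (bundleCoord EB EF e x x)) : EM →L[ℝ] EB × EF))
    fun v => (congrArg (fun T : EB × EF →L[ℝ] EB × EF => T v) d2).symm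
  exact le_antisymm (LinearMap.finrank_le_finrank_of_injective
      (f := (mfderiv 𝓘(ℝ, EM) 𝓘(ℝ, EB × EF) (bundleCoord EB EF e x) x :
      EM →L[ℝ] EB × EF).toLinearMap) i1)
    (LinearMap.finrank_le_finrank_of_injective (f := (mfderiv 𝓘(ℝ, EB × EF) 𝓘(ℝ, EM)
      (bundleParam EB EF e x) (bundleCoord EB EF e x x) : EB × EF →L[ℝ] EM).toLinearMap) i2)

end SymplecticFibration

end BundleCharts

/-! ### Adding a large multiple of the form on the base. -/

section LargeMultiples

variable {EB : Type*} [NormedAddCommGroup EB] [NormedSpace ℝ EB] [FiniteDimensional ℝ EB]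
  {B : Type*} [TopologicalSpace B] [ChartedSpace EB B] [IsManifold 𝓘(ℝ, EB) ∞ B]
  {EF : Type*} [NormedAddCommGroup EF] [NormedSpace ℝ EF] [FiniteDimensional ℝ EF]
  {F : Type*} [TopologicalSpace F] [ChartedSpace EF F] [IsManifold 𝓘(ℝ, EF) ∞ F]
  {EM : Type*} [NormedAddCommGroup EM] [NormedSpace ℝ EM] [FiniteDimensional ℝ EM]
  {M : Type*} [TopologicalSpace M] [ChartedSpace EM M] [IsManifold 𝓘(ℝ, EM) ∞ M]

/-- The linear map `(v, w) ↦ (s v, w)`. -/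
def scaleFst (EB EF : Type*) [NormedAddCommGroup EB] [NormedSpace ℝ EB]
    [NormedAddCommGroup EF] [NormedSpace ℝ EF] (s : ℝ) : EB × EF →L[ℝ] EB × EF :=
  s • (ContinuousLinearMap.inl ℝ EB EF).comp (ContinuousLinearMap.fst ℝ EB EF) +
    (ContinuousLinearMap.inr ℝ EB EF).comp (ContinuousLinearMap.snd ℝ EB EF)

/-- Pulling back along `scaleFst` multiplies a 2-form from the first factor by `s ^ 2`, cancelling
`(s ^ 2)⁻¹`. Hence the form on the left is a pull-back of the form on the right. -/
theorem formRank_scaleFst_add_le (α : (EB × EF) [⋀^Fin 2]→L[ℝ] ℝ) (θ : EB [⋀^Fin 2]→L[ℝ] ℝ)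
    {s : ℝ} (hs : s ≠ 0) :
    formRank (α.compContinuousLinearMap (scaleFst EB EF s) +
        θ.compContinuousLinearMap (ContinuousLinearMap.fst ℝ EB EF)) ≤
      formRank (α + (s ^ 2)⁻¹ • θ.compContinuousLinearMap (ContinuousLinearMap.fst ℝ EB EF)) := by
  have h6 : (θ.compContinuousLinearMap (ContinuousLinearMap.fst ℝ EB EF)).compContinuousLinearMap
      (scaleFst EB EF s) = s ^ 2 • θ.compContinuousLinearMap (ContinuousLinearMap.fst ℝ EB EF) := by
    ext v
    have h7 : ∀ i, (scaleFst EB EF s (v i)).1 = s • (v i).1 := fun i => by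
      simp [scaleFst]
    have h8 := θ.toMultilinearMap.map_smul_univ (fun _ => s) fun i => (v i).1
    simp only [Finset.prod_const, Finset.card_univ, Fintype.card_fin] at h8
    refine Eq.trans ?_ h8
    exact congrArg θ (funext h7)
  have h9 : (α + (s ^ 2)⁻¹ • θ.compContinuousLinearMap
      (ContinuousLinearMap.fst ℝ EB EF)).compContinuousLinearMap (scaleFst EB EF s) =
      α.compContinuousLinearMap (scaleFst EB EF s) + (s ^ 2)⁻¹ • (θ.compContinuousLinearMap
        (ContinuousLinearMap.fst ℝ EB EF)).compContinuousLinearMap (scaleFst EB EF s) := rfl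
  rw [h6, smul_smul, inv_mul_cancel₀ (pow_ne_zero 2 hs), one_smul] at h9
  rw [← h9]
  exact formRank_comp_le _ _

/-- Lower semicontinuity of the rank of the form obtained from `α` by shrinking the first factor,
when a form `θ` on the first factor is added. -/
theorem eventually_le_formRank_scaleFst_add {α : EB × EF → (EB × EF) [⋀^Fin 2]→L[ℝ] ℝ}
    {θ : EB → EB [⋀^Fin 2]→L[ℝ] ℝ} {z₀ : EB × EF} (hα : DifferentiableAt ℝ α z₀)
    (hθ : ContinuousAt θ z₀.1) : ∀ᶠ z : ℝ × (EB × EF) in 𝓝 (0, z₀),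
      formRank (((α z₀).compContinuousLinearMap
        (ContinuousLinearMap.inr ℝ EB EF)).compContinuousLinearMap
          (ContinuousLinearMap.snd ℝ EB EF) +
        (θ z₀.1).compContinuousLinearMap (ContinuousLinearMap.fst ℝ EB EF)) ≤
      formRank ((α z.2).compContinuousLinearMap (scaleFst EB EF z.1) +
        (θ z.2.1).compContinuousLinearMap (ContinuousLinearMap.fst ℝ EB EF)) := by
  have h1 : DifferentiableAt ℝ (fun z : ℝ × (EB × EF) => α z.2) ((0 : ℝ), z₀) :=
    hα.comp ((0 : ℝ), z₀) differentiableAt_snd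
  have h2 : DifferentiableAt ℝ (fun z : ℝ × (EB × EF) => scaleFst EB EF z.1) ((0 : ℝ), z₀) :=
    (differentiableAt_fst.smul_const _).add_const _
  have h3 : ContinuousAt (fun z : ℝ × (EB × EF) => (θ z.2.1).compContinuousLinearMap
      (ContinuousLinearMap.fst ℝ EB EF)) ((0 : ℝ), z₀) :=
    (ContinuousAlternatingMap.compContinuousLinearMapCLM
      (ContinuousLinearMap.fst ℝ EB EF)).continuous.continuousAt.comp
        (hθ.comp (f := fun z : ℝ × (EB × EF) => z.2.1) (x := ((0 : ℝ), z₀))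
          (continuous_fst.comp continuous_snd).continuousAt)
  have h4 := eventually_le_formRank
    ((h1.continuousAlternatingMapCompContinuousLinearMap h2).continuousAt.add h3)
  -- At `s = 0` scaling becomes the projection to the fibre direction, so mixed and horizontal terms
  -- of `α` disappear.
  have h5 : (α z₀).compContinuousLinearMap (scaleFst EB EF 0) =
      ((α z₀).compContinuousLinearMap
        (ContinuousLinearMap.inr ℝ EB EF)).compContinuousLinearMap
          (ContinuousLinearMap.snd ℝ EB EF) := by
    simp only [scaleFst, zero_smul, zero_add]
    rfl
  rw [← h5]
  exact h4

namespace SymplecticFibration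

variable {p : M → B} {σ₀ : DForm EF F 2} {N₀ : Set F} (P : SymplecticFibration EB EM p σ₀ N₀)

omit [FiniteDimensional ℝ EB] [FiniteDimensional ℝ EF] [FiniteDimensional ℝ EM]
  [IsManifold 𝓘(ℝ, EM) ∞ M] in
include P in
theorem pullback_bundleParam_proj (σB : DForm EB B 2) {e : Trivialization F p} (he : e ∈ P.atlas)
    {x : M} (hx : x ∈ e.source) : ∀ᶠ z : EB × EF in 𝓝 (bundleCoord EB EF e x x),
      (show (EB × EF) [⋀^Fin 2]→L[ℝ] ℝ from
        DForm.pullback (EB × EF) (bundleParam EB EF e x) (DForm.pullback EM p σB) z) =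
      (σB.inChart (p x) z.1).compContinuousLinearMap (ContinuousLinearMap.fst ℝ EB EF) := by
  filter_upwards [(eventually_mem_bundleParam_domain (EB := EB) (EF := EF) hx).eventually_nhds]
    with z hz
  obtain ⟨h1, h2, h3⟩ := hz.self_of_nhds
  have hΨ := (P.contMDiffAt_bundleParam he h1 h2 h3).mdifferentiableAt (by simp)
  have hφ : MDifferentiableAt 𝓘(ℝ, EB) 𝓘(ℝ, EB) (chartAt EB (p x)).symm z.1 :=
    (DForm.contMDiffAt_chartAt_symm h1).mdifferentiableAt (by simp)
  have hfst : MDifferentiableAt 𝓘(ℝ, EB × EF) 𝓘(ℝ, EB) (fun z : EB × EF => z.1) z :=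
    differentiableAt_fst.mdifferentiableAt
  rw [← DForm.pullback_comp ((P.contMDiff_proj _).mdifferentiableAt (by simp)) hΨ]
  have hEq : (fun z => p (bundleParam EB EF e x z)) =ᶠ[𝓝 z]
      fun z : EB × EF => (chartAt EB (p x)).symm z.1 := by
    filter_upwards [hz] with w hw
    exact proj_fibreIncl hw.2.1 _
  rw [DForm.pullback_congr hEq, DForm.pullback_comp (f := fun z : EB × EF => z.1) hφ hfst,
    DForm.pullback, mfderiv_eq_fderiv, fderiv_fst]
  rfl

omit [FiniteDimensional ℝ EB] [FiniteDimensional ℝ EF] [FiniteDimensional ℝ EM]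
  [IsManifold 𝓘(ℝ, EM) ∞ M] in
-- On a vertical slice the parametrization is `fibreIncl` after the inverse chart of `F`, so the
-- hypothesis on the fibres applies.
theorem pullback_bundleParam_comp_inr {τ : DForm EM M 2}
    (hτ : ∀ e ∈ P.atlas, ∀ b ∈ e.baseSet, DForm.pullback EF (fibreIncl e b) τ = σ₀)
    {e : Trivialization F p} (he : e ∈ P.atlas) {x : M} (hx : x ∈ e.source) :
    (show (EB × EF) [⋀^Fin 2]→L[ℝ] ℝ from DForm.pullback (EB × EF) (bundleParam EB EF e x) τ
      (bundleCoord EB EF e x x)).compContinuousLinearMap (ContinuousLinearMap.inr ℝ EB EF) =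
      σ₀.inChart (fibreCoord e x) (chartAt EF (fibreCoord e x) (fibreCoord e x)) := by
  obtain ⟨h1, h2, h3⟩ := (eventually_mem_bundleParam_domain (EB := EB) (EF := EF) hx).self_of_nhds
  have hΨ := (P.contMDiffAt_bundleParam he h1 h2 h3).mdifferentiableAt (by simp)
  set c := chartAt EB (p x) (p x)
  set w := chartAt EF (fibreCoord e x) (fibreCoord e x)
  have hr : MDifferentiableAt 𝓘(ℝ, EF) 𝓘(ℝ, EB × EF) (fun w : EF => (c, w)) w :=
    (hasFDerivAt_prodMk_right c w).differentiableAt.mdifferentiableAt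
  have hψ : MDifferentiableAt 𝓘(ℝ, EF) 𝓘(ℝ, EF) (chartAt EF (fibreCoord e x)).symm w :=
    (DForm.contMDiffAt_chartAt_symm h3).mdifferentiableAt (by simp)
  have e1 : DForm.pullback EF (fun w : EF => bundleParam EB EF e x (c, w)) τ w =
      DForm.pullback EF (fun w : EF => (c, w))
        (DForm.pullback (EB × EF) (bundleParam EB EF e x) τ) w :=
    DForm.pullback_comp (f := fun w : EF => (c, w)) hΨ hr τ
  have e2 : DForm.pullback EF (fun w : EF => bundleParam EB EF e x (c, w)) τ w =
      DForm.pullback EF (chartAt EF (fibreCoord e x)).symm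
        (DForm.pullback EF (fibreIncl e ((chartAt EB (p x)).symm c)) τ) w :=
    DForm.pullback_comp (f := (chartAt EF (fibreCoord e x)).symm)
      ((P.contMDiff_fibreIncl he h2 _).mdifferentiableAt (by simp)) hψ τ
  have h2' : (chartAt EB (p x)).symm c ∈ e.baseSet := h2
  rw [hτ e he _ h2'] at e2
  have e3 := e1.symm.trans e2
  rw [DForm.pullback, mfderiv_eq_fderiv, (hasFDerivAt_prodMk_right c w).fderiv] at e3
  exact e3

/-- The first coordinate of `z` is the scale `s`, with `K = s⁻²`. The estimate holds on a
neighbourhood of `(0, x)` in `ℝ × M`, the form in which compactness of `M` produces a single `s`. -/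
theorem eventually_finrank_le_formRank (hσ₀ : IsSymplectic σ₀) {σB : DForm EB B 2}
    (hσB : IsPresymplectic σB) {τ : DForm EM M 2} (hτs : τ.Smooth)
    (hτ : ∀ e ∈ P.atlas, ∀ b ∈ e.baseSet, DForm.pullback EF (fibreIncl e b) τ = σ₀) (x : M) :
    ∀ᶠ z : ℝ × M in 𝓝 (0, x), z.1 ≠ 0 → Module.finrank ℝ EM ≤
      DForm.rank (τ + (z.1 ^ 2)⁻¹ • DForm.pullback EM p σB) z.2 + 1 := by
  obtain ⟨e, he, hb⟩ := P.exists_mem (p x)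
  have hx : x ∈ e.source := e.mem_source.2 hb
  obtain ⟨h1, h2, h3⟩ := (eventually_mem_bundleParam_domain (EB := EB) (EF := EF) hx).self_of_nhds
  have hΨ := P.contMDiffAt_bundleParam he h1 h2 h3
  set z₀ := bundleCoord EB EF e x x with hz₀
  let α : EB × EF → (EB × EF) [⋀^Fin 2]→L[ℝ] ℝ :=
    fun z => DForm.pullback (EB × EF) (bundleParam EB EF e x) τ z
  have hαd : DifferentiableAt ℝ α z₀ :=
    (DForm.smoothAt_self_iff.1 ((hτs _).pullback hΨ)).differentiableAt (by simp)
  have hθ : ContinuousAt (σB.inChart (p x)) z₀.1 := (hσB.closed.1 (p x)).continuousAt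
  have hA := eventually_le_formRank_scaleFst_add hαd hθ
  -- The limit at `s = 0` is the direct sum of the nondegenerate fibre form and the corank-one base
  -- form.
  have hA0 : Module.finrank ℝ (EB × EF) ≤ formRank (((α z₀).compContinuousLinearMap
        (ContinuousLinearMap.inr ℝ EB EF)).compContinuousLinearMap
          (ContinuousLinearMap.snd ℝ EB EF) +
        (σB.inChart (p x) z₀.1).compContinuousLinearMap (ContinuousLinearMap.fst ℝ EB EF)) + 1 := by
    refine finrank_le_formRank_prod _ _ ?_ ?_
    · obtain ⟨n, hn, hr⟩ := hσB.maximal_rank (p x)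
      have h5 : σB.rank (p x) ≤ formRank (σB.inChart (p x) z₀.1) :=
        σB.rank_le_formRank_inChart (p x)
      have h6 : Module.finrank ℝ EB = 2 * n + 1 := hn
      omega
    · have h4 : (α z₀).compContinuousLinearMap (ContinuousLinearMap.inr ℝ EB EF) = _ :=
        P.pullback_bundleParam_comp_inr hτ he hx
      rw [h4, ← hσ₀.rank_eq (fibreCoord e x)]
      exact σ₀.rank_le_formRank_inChart _
  have hc2 : ContinuousAt (fun z : ℝ × M => bundleCoord EB EF e x z.2) (0, x) :=
    (P.contMDiffAt_bundleCoord he hx).continuousAt.comp (f := Prod.snd) (x := ((0 : ℝ), x))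
      continuousAt_snd
  have hc1 : ContinuousAt (fun z : ℝ × M => (z.1, bundleCoord EB EF e x z.2)) (0, x) :=
    continuousAt_fst.prodMk hc2
  filter_upwards [hc1.eventually hA,
    hc2.eventually (P.pullback_bundleParam_proj σB he hx),
    (continuous_snd.tendsto ((0 : ℝ), x)).eventually (P.bundleParam_bundleCoord he hx)]
    with z hz1 hz2 hz3 hs
  have h4 := formRank_scaleFst_add_le (α (bundleCoord EB EF e x z.2))
    (σB.inChart (p x) (bundleCoord EB EF e x z.2).1) hs
  have h5 : formRank (α (bundleCoord EB EF e x z.2) + (z.1 ^ 2)⁻¹ •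
      (σB.inChart (p x) (bundleCoord EB EF e x z.2).1).compContinuousLinearMap
        (ContinuousLinearMap.fst ℝ EB EF)) ≤
      DForm.rank (τ + (z.1 ^ 2)⁻¹ • DForm.pullback EM p σB) z.2 := by
    rw [← hz2]
    have h6 := formRank_comp_le (E := EB × EF) (E' := EM) (show EM [⋀^Fin 2]→L[ℝ] ℝ from
      (τ + (z.1 ^ 2)⁻¹ • DForm.pullback EM p σB : DForm EM M 2)
        (bundleParam EB EF e x (bundleCoord EB EF e x z.2)))
      (mfderiv 𝓘(ℝ, EB × EF) 𝓘(ℝ, EM) (bundleParam EB EF e x) (bundleCoord EB EF e x z.2) :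
        EB × EF →L[ℝ] EM)
    refine LE.le.trans ?_ (h6.trans ?_)
    · exact le_rfl
    · rw [hz3]
      exact le_rfl
  rw [P.finrank_eq x]
  omega

/-- If a closed form is symplectic on the fibres, its sum with a large multiple of the pull-back
of a presymplectic form of the base is presymplectic. -/
theorem exists_isPresymplectic_add [CompactSpace M] (hσ₀ : IsSymplectic σ₀) {σB : DForm EB B 2}
    (hσB : IsPresymplectic σB) {τ : DForm EM M 2} (hτc : τ ∈ closedForms EM M 2)
    (hτ : ∀ e ∈ P.atlas, ∀ b ∈ e.baseSet, DForm.pullback EF (fibreIncl e b) τ = σ₀) :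
    ∃ K : ℝ, 0 < K ∧ IsPresymplectic (τ + K • DForm.pullback EM p σB) := by
  -- By compactness one neighbourhood of `0` serves all points; any positive `s` in it gives the
  -- constant `K = (s ^ 2)⁻¹`.
  have h1 : ∀ᶠ s : ℝ in 𝓝 0, ∀ x ∈ (Set.univ : Set M), s ≠ 0 → Module.finrank ℝ EM ≤
      DForm.rank (τ + (s ^ 2)⁻¹ • DForm.pullback EM p σB) x + 1 :=
    isCompact_univ.eventually_forall_of_forall_eventually fun x _ =>
      P.eventually_finrank_le_formRank hσ₀ hσB hτc.1 hτ x
  obtain ⟨s, hs, hs0⟩ := ((h1.filter_mono nhdsWithin_le_nhds).and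
    (self_mem_nhdsWithin (s := Set.Ioi (0 : ℝ)))).exists
  have hs0 : 0 < s := hs0
  refine ⟨(s ^ 2)⁻¹, by positivity, add_mem hτc (Submodule.smul_mem _ _
    (pullback_mem_closedForms P.contMDiff_proj hσB.closed)), fun x => ?_⟩
  have h2 := hs x trivial hs0.ne'
  obtain ⟨e, -, hb⟩ := P.exists_mem (p x)
  obtain ⟨n, hn, -⟩ := hσB.maximal_rank (p x)
  obtain ⟨m, hm⟩ := hσ₀.even_finrank (fibreCoord e x)
  have h3 : Module.finrank ℝ EM = 2 * (n + m) + 1 := by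
    have h4 : Module.finrank ℝ EB = 2 * n + 1 := hn
    rw [P.finrank_eq x, Module.finrank_prod]
    omega
  -- The scaling argument bounds the corank by one from above; odd dimension bounds it by one from
  -- below.
  have h4 := formRank_lt_of_odd (E := EM) ⟨_, h3⟩ (show EM [⋀^Fin 2]→L[ℝ] ℝ from
    (τ + (s ^ 2)⁻¹ • DForm.pullback EM p σB : DForm EM M 2) x)
  have h5 : DForm.rank (τ + (s ^ 2)⁻¹ • DForm.pullback EM p σB) x < Module.finrank ℝ EM := h4
  exact ⟨n + m, h3, by omega⟩

end SymplecticFibration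

end LargeMultiples

/-! ### Pull-backs along maps that agree on a set. -/

section UniqueDerivatives

variable {E : Type*} [NormedAddCommGroup E] [NormedSpace ℝ E]
  {M : Type*} [TopologicalSpace M] [ChartedSpace E M]
  {E' : Type*} [NormedAddCommGroup E'] [NormedSpace ℝ E']
  {M' : Type*} [TopologicalSpace M'] [ChartedSpace E' M'] {k : ℕ}

/-- Maps which agree on a set pull back forms in the same way at the points at which this set has
unique differentials. -/
theorem DForm.pullback_eq_of_eqOn {f g : M → M'} {N : Set M} {x : M}
    (hf : MDifferentiableAt 𝓘(ℝ, E) 𝓘(ℝ, E') f x) (hg : MDifferentiableAt 𝓘(ℝ, E) 𝓘(ℝ, E') g x)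
    (hx : x ∈ N) (hN : UniqueMDiffWithinAt 𝓘(ℝ, E) N x)
    (h : ∀ᶠ y in 𝓝 x, y ∈ N → f y = g y) (α : DForm E' M' k) :
    DForm.pullback E f α x = DForm.pullback E g α x := by
  have h1 : f =ᶠ[𝓝[N] x] g := by
    filter_upwards [self_mem_nhdsWithin, mem_nhdsWithin_of_mem_nhds h] with y h1 h2
    exact h2 h1
  have h2 : f x = g x := h.self_of_nhds hx
  have h3 : (mfderiv 𝓘(ℝ, E) 𝓘(ℝ, E') f x : E →L[ℝ] E') = mfderiv 𝓘(ℝ, E) 𝓘(ℝ, E') g x :=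
    (mfderivWithin_eq_mfderiv hN hf).symm.trans
      ((h1.mfderivWithin_eq h2).trans (mfderivWithin_eq_mfderiv hN hg))
  ext v
  exact congrArg₂ (fun (β : E' [⋀^Fin k]→L[ℝ] ℝ) (T : E →L[ℝ] E') => β fun i => T (v i))
    (DForm.congr_point α h2) h3

end UniqueDerivatives

/-! ### Fibrewise primitives and contraction of the bundle to one fibre. -/

section LocalPrimitives

variable {EB : Type*} [NormedAddCommGroup EB] [NormedSpace ℝ EB]
  {B : Type*} [TopologicalSpace B] [ChartedSpace EB B]
  {EF : Type*} [NormedAddCommGroup EF] [NormedSpace ℝ EF]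
  {F : Type*} [TopologicalSpace F] [ChartedSpace EF F]
  {EM : Type*} [NormedAddCommGroup EM] [NormedSpace ℝ EM]
  {M : Type*} [TopologicalSpace M] [ChartedSpace EM M]

namespace SymplecticFibration

variable {p : M → B} {σ₀ : DForm EF F 2} {N₀ : Set F} (P : SymplecticFibration EB EM p σ₀ N₀)

theorem isClosed_N (hN₀ : IsClosed N₀) : IsClosed P.N := by
  rw [← isOpen_compl_iff, isOpen_iff_mem_nhds]
  intro x hx
  obtain ⟨e, he, hb⟩ := P.exists_mem (p x)
  have hxe : x ∈ e.source := e.mem_source.2 hb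
  have h1 : fibreCoord e x ∈ N₀ᶜ := fun h => hx ((P.mem_N_iff he hxe).2 h)
  filter_upwards [e.open_source.mem_nhds hxe,
    (P.contMDiffAt_fibreCoord he hxe).continuousAt.eventually
      (hN₀.isOpen_compl.mem_nhds h1)] with y hy1 hy2 hyN
  exact hy2 ((P.mem_N_iff he hy1).1 hyN)

theorem fibreIncl_mem_N {e : Trivialization F p} (he : e ∈ P.atlas) {b : B} (hb : b ∈ e.baseSet)
    {y : F} (hy : y ∈ N₀) : fibreIncl e b y ∈ P.N :=
  (P.mem_N_iff he (fibreIncl_mem_source hb y)).2 (by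
    change fibreCoord e (fibreIncl e b y) ∈ N₀
    rwa [fibreCoord_fibreIncl hb])

theorem pullback_fibreIncl_fibreCoord {k : ℕ} {e : Trivialization F p} (he : e ∈ P.atlas) {b : B}
    (hb : b ∈ e.baseSet) (α : DForm EF F k) :
    DForm.pullback EF (fibreIncl e b) (DForm.pullback EM (fibreCoord e) α) = α := by
  funext y
  rw [← DForm.pullback_comp ((P.contMDiffAt_fibreCoord he
      (fibreIncl_mem_source hb y)).mdifferentiableAt (by simp))
    ((P.contMDiff_fibreIncl he hb y).mdifferentiableAt (by simp)),
    DForm.pullback_congr (g := fun y => y) (.of_forall fun y => fibreCoord_fibreIncl hb y),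
    DForm.pullback_id]

/-- Read in another trivialization, the fibre inclusion is a transition map, which preserves `σ₀`.
-/
theorem pullback_fibreIncl_fibreCoord_symplectic {e e' : Trivialization F p} (he : e ∈ P.atlas)
    (he' : e' ∈ P.atlas) {b : B} (hb : b ∈ e.baseSet) (hb' : b ∈ e'.baseSet) :
    DForm.pullback EF (fibreIncl e b) (DForm.pullback EM (fibreCoord e') σ₀) = σ₀ := by
  obtain ⟨g, hg, h⟩ := P.transition e he e' he' b ⟨hb, hb'⟩
  funext y
  have hs : fibreIncl e b y ∈ e'.source := e'.mem_source.2 (by rwa [proj_fibreIncl hb])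
  rw [← DForm.pullback_comp ((P.contMDiffAt_fibreCoord he' hs).mdifferentiableAt (by simp))
    ((P.contMDiff_fibreIncl he hb y).mdifferentiableAt (by simp)),
    DForm.pullback_congr (f := fun y => fibreCoord e' (fibreIncl e b y)) (g := g)
      (.of_forall fun y => congrArg Prod.snd (h y)), hg.1]

/-- Fibre coordinates agree on `N`, and unique differentiability of `N` makes their full derivatives
agree there. Thus prescribed values on `N` do not depend on the trivialization. -/
theorem pullback_fibreCoord_eq [IsManifold 𝓘(ℝ, EF) ∞ F] (hN₀ : IsCodimZeroSubmanifold EF N₀)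
    {k : ℕ} {e e' : Trivialization F p} (he : e ∈ P.atlas) (he' : e' ∈ P.atlas) {x : M}
    (hx : x ∈ e.source) (hx' : x ∈ e'.source) (hN : x ∈ P.N) (α : DForm EF F k) :
    DForm.pullback EM (fibreCoord e) α x = DForm.pullback EM (fibreCoord e') α x := by
  refine DForm.pullback_eq_of_eqOn ((P.contMDiffAt_fibreCoord he hx).mdifferentiableAt (by simp))
    ((P.contMDiffAt_fibreCoord he' hx').mdifferentiableAt (by simp)) hN
    (P.uniqueMDiffWithinAt_N hN₀ hN) ?_ α
  filter_upwards [e.open_source.mem_nhds hx, e'.open_source.mem_nhds hx'] with y h1 h2 hy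
  exact (P.toFibre_eq he h1 hy).symm.trans (P.toFibre_eq he' h2 hy)

/-- `θ` agrees on `N₀` with a primitive on `F` of the difference of `σ₀` and the restriction of `τ`
to the fibre over `b`. -/
def HasFibrePrimitive (σ₀ : DForm EF F 2) (N₀ : Set F) (τ : DForm EM M 2) (e : Trivialization F p)
    (b : B) (θ : DForm EF F 1) : Prop :=
  ∃ ν : DForm EF F 1, ν.Smooth ∧ ν.extD = DForm.pullback EF (fibreIncl e b) τ - σ₀ ∧
    ∀ y ∈ N₀, ν y = θ y

variable [IsManifold 𝓘(ℝ, EF) ∞ F]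

/-- The transition map `g` preserves `σ₀`, so `g^*ν` is a primitive for the other trivialization. It
fixes `N₀` pointwise, so its derivative on `N₀` is the identity, even at the boundary, and `g^*ν =
ν` there. -/
theorem hasFibrePrimitive_transition [FiniteDimensional ℝ EF] (hN₀ : IsCodimZeroSubmanifold EF N₀)
    {τ : DForm EM M 2} {e e' : Trivialization F p} (he : e ∈ P.atlas) (he' : e' ∈ P.atlas)
    {b : B} (hb : b ∈ e.baseSet) (hb' : b ∈ e'.baseSet) {θ : DForm EF F 1}
    (h : HasFibrePrimitive σ₀ N₀ τ e b θ) : HasFibrePrimitive σ₀ N₀ τ e' b θ := by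
  obtain ⟨ν, hν, hd, hνθ⟩ := h
  obtain ⟨g, hg, hgt⟩ := P.transition e' he' e he b ⟨hb', hb⟩
  have hinc : ∀ y, fibreIncl e' b y = fibreIncl e b (g y) := fun y => by
    have h1 : fibreIncl e' b y ∈ e.source := e.mem_source.2 (by rwa [proj_fibreIncl hb'])
    have h2 : e.toOpenPartialHomeomorph.symm (e (fibreIncl e' b y)) = fibreIncl e' b y :=
      e.toOpenPartialHomeomorph.left_inv h1
    rw [← h2]
    exact congrArg e.toOpenPartialHomeomorph.symm (hgt y)
  have hgs : ContMDiff 𝓘(ℝ, EF) 𝓘(ℝ, EF) ∞ g := g.contMDiff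
  refine ⟨DForm.pullback EF g ν, fun y => (hν _).pullback (hgs y), ?_, fun y hy => ?_⟩
  · funext y
    rw [DForm.extD_pullback (hν _) (hgs y), hd, DForm.pullback_sub, hg.1, DForm.sub_apply,
      DForm.sub_apply, ← DForm.pullback_comp (f := g)
      ((P.contMDiff_fibreIncl he hb _).mdifferentiableAt (by simp))
      ((hgs y).mdifferentiableAt (by simp)),
      DForm.pullback_congr (f := fibreIncl e' b) (.of_forall hinc)]
  · rw [DForm.pullback_eq_of_eqOn (g := fun y => y) ((hgs y).mdifferentiableAt (by simp))
      mdifferentiableAt_id hy (hN₀.uniqueMDiffWithinAt hy) (.of_forall hg.2), DForm.pullback_id,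
      hνθ y hy]

variable [IsManifold 𝓘(ℝ, EB) ∞ B]

omit [IsManifold 𝓘(ℝ, EF) ∞ F] in
/-- Over a small neighbourhood `U` of `b₀`, the bundle can be contracted to the fibre over `b₀`,
with constant fibre coordinate. -/
theorem exists_contraction {e : Trivialization F p} (he : e ∈ P.atlas) {b₀ : B}
    (hb₀ : b₀ ∈ e.baseSet) : ∃ U : Set B, IsOpen U ∧ b₀ ∈ U ∧ U ⊆ e.baseSet ∧ ∃ G : ℝ → M → M,
      (∀ x, p x ∈ U → ∀ t ∈ Set.Icc (0 : ℝ) 1,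
        ContMDiffAt (𝓘(ℝ, ℝ).prod 𝓘(ℝ, EM)) 𝓘(ℝ, EM) ∞ (Function.uncurry G) (t, x)) ∧
      (∀ x, p x ∈ U → ∀ t ∈ Set.Icc (0 : ℝ) 1, ∀ᶠ s in 𝓝 t,
        G s x ∈ e.source ∧ fibreCoord e (G s x) = fibreCoord e x) ∧
      (∀ x, p x ∈ U → G 1 x = x) ∧ ∀ x, G 0 x = fibreIncl e b₀ (fibreCoord e x) := by
  set φ := chartAt EB b₀ with hφ
  set c := φ b₀ with hc
  have hV : φ.target ∩ φ.symm ⁻¹' e.baseSet ∈ 𝓝 c :=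
    Filter.inter_mem (φ.open_target.mem_nhds (mem_chart_target EB b₀))
      ((DForm.tendsto_chartAt_symm b₀).eventually (e.open_baseSet.mem_nhds hb₀))
  obtain ⟨r, hr, hball⟩ := Metric.mem_nhds_iff.1 hV
  -- The straight segment from the centre `c` to `φ (p x)`; it remains in a ball on which both the
  -- chart inverse and `e` are available.
  set a : ℝ → M → EB := fun t x => c + t • (φ (p x) - c) with ha
  have hmem : ∀ x, φ (p x) ∈ Metric.ball c r → ∀ t ∈ Set.Icc (0 : ℝ) 1,
      a t x ∈ Metric.ball c r := by
    intro x hx t ht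
    exact (convex_ball c r).add_smul_sub_mem (Metric.mem_ball_self hr) hx ht
  refine ⟨φ.source ∩ φ ⁻¹' Metric.ball c r, φ.isOpen_inter_preimage Metric.isOpen_ball,
    ⟨mem_chart_source EB b₀, Metric.mem_ball_self hr⟩, ?_,
    fun t x => e.toOpenPartialHomeomorph.symm (φ.symm (a t x), fibreCoord e x), ?_, ?_, ?_, ?_⟩
  · intro b hb
    have := (hball hb.2).2
    rwa [Set.mem_preimage, φ.left_inv hb.1] at this
  · intro x hx t ht
    have h1 := hball (hmem x hx.2 t ht)
    have hxe : x ∈ e.source := by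
      have := (hball hx.2).2
      rw [Set.mem_preimage, φ.left_inv hx.1] at this
      exact e.mem_source.2 this
    have s1 : ContMDiffAt (𝓘(ℝ, ℝ).prod 𝓘(ℝ, EM)) 𝓘(ℝ, EB) ∞
        (fun z : ℝ × M => φ (p z.2)) (t, x) :=
      (contMDiffAt_of_mem_maximalAtlas (IsManifold.chart_mem_maximalAtlas b₀) hx.1).comp (t, x)
        ((P.contMDiff_proj x).comp (t, x) contMDiffAt_snd)
    have s2 : ContMDiffAt (𝓘(ℝ, ℝ).prod 𝓘(ℝ, EM)) 𝓘(ℝ, EB) ∞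
        (fun z : ℝ × M => a z.1 z.2) (t, x) :=
      contMDiffAt_const.add (contMDiffAt_fst.smul (s1.sub contMDiffAt_const))
    have s3 : ContMDiffAt (𝓘(ℝ, ℝ).prod 𝓘(ℝ, EM)) 𝓘(ℝ, EB) ∞
        (fun z : ℝ × M => φ.symm (a z.1 z.2)) (t, x) :=
      (DForm.contMDiffAt_chartAt_symm h1.1).comp (t, x) s2
    have s4 : ContMDiffAt (𝓘(ℝ, ℝ).prod 𝓘(ℝ, EM)) 𝓘(ℝ, EF) ∞
        (fun z : ℝ × M => fibreCoord e z.2) (t, x) :=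
      ContMDiffAt.comp (t, x) (g := fibreCoord e) (f := Prod.snd)
        (P.contMDiffAt_fibreCoord he hxe) contMDiffAt_snd
    exact (P.contMDiffAt_symm he h1.2 _).comp (t, x) (s3.prodMk s4)
  · intro x hx t ht
    -- The segment extends to all real `s` and remains in the open ball near `t`, so velocities at
    -- the end points `0` and `1` are genuine two-sided derivatives.
    have hcont : Continuous fun s => a s x := by
      simp only [ha]; fun_prop
    filter_upwards [hcont.continuousAt.eventually (Metric.isOpen_ball.mem_nhds (hmem x hx.2 t ht))]
      with s hs
    exact ⟨fibreIncl_mem_source (hball hs).2 _, fibreCoord_fibreIncl (hball hs).2 _⟩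
  · intro x hx
    have hxe : x ∈ e.source := by
      have := (hball hx.2).2
      rw [Set.mem_preimage, φ.left_inv hx.1] at this
      exact e.mem_source.2 this
    have h1 : a 1 x = φ (p x) := by simp [ha]
    simp only [h1, φ.left_inv hx.1]
    exact symm_proj_fibreCoord hxe
  · intro x
    have h1 : a 0 x = c := by simp [ha]
    simp only [h1, hc, φ.left_inv (mem_chart_source EB b₀)]
    rfl

variable [IsManifold 𝓘(ℝ, EM) ∞ M]

/-- A closed form equal to `ω_N` on `N` differs from the one induced by its restriction to one
fibre by the differential of a 1-form which vanishes on `N`, locally over the base. -/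
theorem exists_primitive_sub_retract [FiniteDimensional ℝ EM]
    (hN₀ : IsCodimZeroSubmanifold EF N₀)
    {τ : DForm EM M 2} (hτ : τ ∈ closedForms EM M 2) (hτN : ∀ x ∈ P.N, τ x = P.formN x)
    {e : Trivialization F p} (he : e ∈ P.atlas) {b₀ : B} (hb₀ : b₀ ∈ e.baseSet) :
    ∃ U : Set B, IsOpen U ∧ b₀ ∈ U ∧ U ⊆ e.baseSet ∧ ∃ γ : DForm EM M 1, ∀ x, p x ∈ U →
      γ.SmoothAt x ∧ γ.extD x = τ x - DForm.pullback EM (fibreCoord e)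
        (DForm.pullback EF (fibreIncl e b₀) τ) x ∧ (x ∈ P.N → γ x = 0) := by
  obtain ⟨U, hUo, hbU, hUe, G, hG, hGe, hG1, hG0⟩ := P.exists_contraction he hb₀
  refine ⟨U, hUo, hbU, hUe, DForm.homotopyOp EM G τ, fun x hx =>
    ⟨DForm.smoothAt_homotopyOp hτ.1 (hG x hx), ?_, fun hxN => ?_⟩⟩
  · have hxe : x ∈ e.source := e.mem_source.2 (hUe hx)
    have h1 : G 1 =ᶠ[𝓝 x] fun y => y :=
      (P.contMDiff_proj.continuous.continuousAt.eventually (hUo.mem_nhds hx)).mono hG1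
    rw [DForm.extD_homotopyOp hτ (hG x hx), DForm.pullback_congr h1, DForm.pullback_id,
      DForm.pullback_congr (.of_forall hG0), DForm.pullback_comp
      ((P.contMDiff_fibreIncl he hb₀ _).mdifferentiableAt (by simp))
      ((P.contMDiffAt_fibreCoord he hxe).mdifferentiableAt (by simp))]
  · have hxe : x ∈ e.source := e.mem_source.2 (hUe hx)
    -- The homotopy preserves `N`, where `τ = q^*σ₀`. Since `q` is constant along it, the derivative
    -- of `q` annihilates the velocity, and so the contraction of `τ` with the velocity vanishes.
    have key : ∀ t ∈ Set.Icc (0 : ℝ) 1, DForm.homotopyIntegrand EM G τ x t = 0 := by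
      intro t ht
      obtain ⟨hs, hq⟩ := (hGe x hx t ht).self_of_nhds
      have hGN : G t x ∈ P.N := by
        refine (P.mem_N_iff he hs).2 ?_
        change fibreCoord e (G t x) ∈ N₀
        rw [hq]
        exact (P.mem_N_iff he hxe).1 hxN
      have hτG := (hτN _ hGN).trans (P.formN_eq_pullback hN₀ he hs hGN)
      have hGt : MDifferentiableAt 𝓘(ℝ, ℝ) 𝓘(ℝ, EM) (fun s => G s x) t :=
        ((hG x hx t ht).comp (f := fun s : ℝ => (s, x)) t
          (contMDiffAt_id.prodMk contMDiffAt_const)).mdifferentiableAt (by simp)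
      have hd := mfderiv_comp t ((P.contMDiffAt_fibreCoord he hs).mdifferentiableAt (by simp)) hGt
      have hconst : fibreCoord e ∘ (fun s => G s x) =ᶠ[𝓝 t] fun _ => fibreCoord e x :=
        (hGe x hx t ht).mono fun s hs => hs.2
      rw [hconst.mfderiv_eq, mfderiv_const] at hd
      have h0 : (mfderiv 𝓘(ℝ, EM) 𝓘(ℝ, EF) (fibreCoord e) (G t x)
          (mfderiv 𝓘(ℝ, ℝ) 𝓘(ℝ, EM) (fun s => G s x) t (1 : ℝ)) : EF) = 0 :=
        (congrArg (fun T : ℝ →L[ℝ] EF => T 1) hd).symm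
      have h1 : (show EM [⋀^Fin 2]→L[ℝ] ℝ from τ (G t x)).curryLeft
          (mfderiv 𝓘(ℝ, ℝ) 𝓘(ℝ, EM) (fun s => G s x) t (1 : ℝ)) = 0 := by
        refine (curryLeft_eq_zero_iff _ _).2 fun w => ?_
        rw [hτG]
        refine (show EF [⋀^Fin 2]→L[ℝ] ℝ from σ₀ (fibreCoord e (G t x))).map_coord_zero 0 ?_
        exact h0
      rw [DForm.homotopyIntegrand, h1]
      ext v
      rfl
    have h2 : (∫ t in (0 : ℝ)..1, DForm.homotopyIntegrand EM G τ x t) = 0 := by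
      rw [intervalIntegral.integral_congr (g := fun _ => 0) (by
        rw [Set.uIcc_of_le zero_le_one]; exact key), intervalIntegral.integral_zero]
    exact h2

end SymplecticFibration

end LocalPrimitives

/-! ### Thurston's construction relative to `N`. -/

section FibrewiseSymplectic

variable {EB : Type*} [NormedAddCommGroup EB] [NormedSpace ℝ EB]
  {B : Type*} [TopologicalSpace B] [ChartedSpace EB B] [IsManifold 𝓘(ℝ, EB) ∞ B]
  {EF : Type*} [NormedAddCommGroup EF] [NormedSpace ℝ EF] [FiniteDimensional ℝ EF]
  {F : Type*} [TopologicalSpace F] [ChartedSpace EF F] [IsManifold 𝓘(ℝ, EF) ∞ F]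
  {EM : Type*} [NormedAddCommGroup EM] [NormedSpace ℝ EM] [FiniteDimensional ℝ EM]
  {M : Type*} [TopologicalSpace M] [ChartedSpace EM M] [IsManifold 𝓘(ℝ, EM) ∞ M]

namespace SymplecticFibration

variable {p : M → B} {σ₀ : DForm EF F 2} {N₀ : Set F} (P : SymplecticFibration EB EM p σ₀ N₀)

/-- Whether `θ` agrees on `N₀` with a fibrewise primitive is locally constant along the base, and
fibrewise primitives extend over neighbourhoods in the base. -/
theorem exists_extension_fibrePrimitive
    (hN₀ : IsCodimZeroSubmanifold EF N₀)
    {τ : DForm EM M 2} (hτ : τ ∈ closedForms EM M 2) (hτN : ∀ x ∈ P.N, τ x = P.formN x)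
    {e : Trivialization F p} (he : e ∈ P.atlas) {b₀ : B} (hb₀ : b₀ ∈ e.baseSet) :
    ∃ U : Set B, IsOpen U ∧ b₀ ∈ U ∧ U ⊆ e.baseSet ∧
      (∀ b ∈ U, ∀ θ, HasFibrePrimitive σ₀ N₀ τ e b θ ↔ HasFibrePrimitive σ₀ N₀ τ e b₀ θ) ∧
      ∀ θ, HasFibrePrimitive σ₀ N₀ τ e b₀ θ → ∃ γ : DForm EM M 1, ∀ x, p x ∈ U →
        γ.SmoothAt x ∧ γ.extD x = τ x - DForm.pullback EM (fibreCoord e) σ₀ x ∧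
          (x ∈ P.N → γ x = DForm.pullback EM (fibreCoord e) θ x) := by
  obtain ⟨U, hUo, hbU, hUe, γ, hγ⟩ := P.exists_primitive_sub_retract hN₀ hτ hτN he hb₀
  have hext : ∀ θ, HasFibrePrimitive σ₀ N₀ τ e b₀ θ → ∃ γ : DForm EM M 1, ∀ x, p x ∈ U →
        γ.SmoothAt x ∧ γ.extD x = τ x - DForm.pullback EM (fibreCoord e) σ₀ x ∧
          (x ∈ P.N → γ x = DForm.pullback EM (fibreCoord e) θ x) := by
    rintro θ ⟨ν, hν, hdν, hνθ⟩
    -- `γ` accounts for `τ - q^*(ι_{b₀}^*τ)` and `q^*ν` for `q^*(ι_{b₀}^*τ - σ₀)`. As `γ` vanishes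
    -- on `N`, the values there come from `ν`, hence from `θ`.
    refine ⟨γ + DForm.pullback EM (fibreCoord e) ν, fun x hx => ?_⟩
    have hxe : x ∈ e.source := e.mem_source.2 (hUe hx)
    obtain ⟨h1, h2, h3⟩ := hγ x hx
    have hq := P.contMDiffAt_fibreCoord he hxe
    refine ⟨h1.add ((hν _).pullback hq), ?_, fun hxN => ?_⟩
    · rw [DForm.extD_add_apply h1 ((hν _).pullback hq), h2, DForm.extD_pullback (hν _) hq, hdν,
        DForm.pullback_sub, DForm.sub_apply]
      abel
    · rw [DForm.add_apply, h3 hxN, zero_add]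
      exact DForm.pullback_apply_congr (hνθ _ ((P.mem_N_iff he hxe).1 hxN))
  refine ⟨U, hUo, hbU, hUe, fun b hb θ => ⟨?_, fun h => ?_⟩, hext⟩
  · rintro ⟨ν, hν, hdν, hνθ⟩
    have hι := P.contMDiff_fibreIncl he (hUe hb)
    have hpU : ∀ y, p (fibreIncl e b y) ∈ U := fun y => by rwa [proj_fibreIncl (hUe hb)]
    have hs : ∀ y, (DForm.pullback EF (fibreIncl e b) γ).SmoothAt y := fun y =>
      (hγ _ (hpU y)).1.pullback (hι y)
    -- The differential of `ι_b^*γ` is `ι_b^*τ - ι_{b₀}^*τ`, so subtracting it moves the primitive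
    -- from `b` to `b₀` with unchanged values on `N₀`.
    refine ⟨ν - DForm.pullback EF (fibreIncl e b) γ, fun y => (hν y).sub (hs y), ?_,
      fun y hy => ?_⟩
    · funext y
      have h1 : DForm.pullback EF (fibreIncl e b) γ.extD y = DForm.pullback EF (fibreIncl e b)
          (τ - DForm.pullback EM (fibreCoord e) (DForm.pullback EF (fibreIncl e b₀) τ)) y :=
        DForm.pullback_apply_congr (hγ _ (hpU y)).2.1
      rw [DForm.extD_sub_apply (hν y) (hs y), DForm.extD_pullback (hγ _ (hpU y)).1 (hι y), h1, hdν,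
        DForm.pullback_sub, P.pullback_fibreIncl_fibreCoord he (hUe hb)]
      simp only [DForm.sub_apply]
      abel
    · have h1 : DForm.pullback EF (fibreIncl e b) γ y =
          DForm.pullback EF (fibreIncl e b) (0 : DForm EM M 1) y :=
        DForm.pullback_apply_congr
          ((hγ _ (hpU y)).2.2 (P.fibreIncl_mem_N he (hUe hb) hy))
      have h2 : DForm.pullback EF (fibreIncl e b) (0 : DForm EM M 1) y = 0 :=
        ContinuousAlternatingMap.ext fun _ => rfl
      rw [DForm.sub_apply, h1, h2, sub_zero, hνθ y hy]
  · obtain ⟨γ', hγ'⟩ := hext θ h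
    have hι := P.contMDiff_fibreIncl he (hUe hb)
    have hpU : ∀ y, p (fibreIncl e b y) ∈ U := fun y => by rwa [proj_fibreIncl (hUe hb)]
    refine ⟨DForm.pullback EF (fibreIncl e b) γ', fun y => (hγ' _ (hpU y)).1.pullback (hι y), ?_,
      fun y hy => ?_⟩
    · funext y
      have h1 : DForm.pullback EF (fibreIncl e b) γ'.extD y = DForm.pullback EF (fibreIncl e b)
          (τ - DForm.pullback EM (fibreCoord e) σ₀) y :=
        DForm.pullback_apply_congr (hγ' _ (hpU y)).2.1
      rw [DForm.extD_pullback (hγ' _ (hpU y)).1 (hι y), h1, DForm.pullback_sub,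
        P.pullback_fibreIncl_fibreCoord he (hUe hb)]
    · have h1 : DForm.pullback EF (fibreIncl e b) γ' y = DForm.pullback EF (fibreIncl e b)
          (DForm.pullback EM (fibreCoord e) θ) y :=
        DForm.pullback_apply_congr
          ((hγ' _ (hpU y)).2.2 (P.fibreIncl_mem_N he (hUe hb) hy))
      rw [h1, P.pullback_fibreIncl_fibreCoord he (hUe hb)]

/-- The 1-forms which agree on `N₀` with a primitive over the fibre at `b`. -/
def fibrePrimitives (τ : DForm EM M 2) (b : B) : Set (DForm EF F 1) :=
  {θ | HasFibrePrimitive σ₀ N₀ τ (P.trivAt b) b θ}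

/-- Locally over the base there are primitives of the difference of `τ` and the fibre form whose
values on `N` are independent of the choices. -/
theorem exists_local_primitives (hN₀ : IsCodimZeroSubmanifold EF N₀)
    {τ : DForm EM M 2} (hτ : τ ∈ closedForms EM M 2) (hτN : ∀ x ∈ P.N, τ x = P.formN x)
    (hτe : ∀ b, (P.fibrePrimitives τ b).Nonempty) :
    ∃ θ : B → DForm EF F 1, ∀ b₀ : B, ∃ U : Set B, IsOpen U ∧ b₀ ∈ U ∧ ∃ e ∈ P.atlas,
      U ⊆ e.baseSet ∧ ∃ γ : DForm EM M 1, ∀ x, p x ∈ U →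
        γ.SmoothAt x ∧ γ.extD x = τ x - DForm.pullback EM (fibreCoord e) σ₀ x ∧
          (x ∈ P.N → γ x = DForm.pullback EM (fibreCoord e) (θ (p x)) x) := by
  classical
  -- The choice is made on sets of forms, not on points of `B`: where the set of admissible boundary
  -- values is locally constant, so is the chosen one. The value `0` for the empty set is never
  -- used.
  let c : Set (DForm EF F 1) → DForm EF F 1 := fun S => if h : S.Nonempty then h.some else 0
  have hc : ∀ b, c (P.fibrePrimitives τ b) ∈ P.fibrePrimitives τ b := fun b => by
    simp only [c, dif_pos (hτe b)]; exact (hτe b).some_mem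
  refine ⟨fun b => c (P.fibrePrimitives τ b), fun b₀ => ?_⟩
  have he := P.trivAt_mem b₀
  obtain ⟨U, hUo, hbU, hUe, hiff, hext⟩ := P.exists_extension_fibrePrimitive hN₀ hτ hτN he
    (P.mem_baseSet_trivAt b₀)
  obtain ⟨γ, hγ⟩ := hext _ (hc b₀)
  have hconst : ∀ b ∈ U, P.fibrePrimitives τ b = P.fibrePrimitives τ b₀ := fun b hb => by
    ext θ
    refine Iff.trans ?_ (hiff b hb θ)
    exact ⟨P.hasFibrePrimitive_transition hN₀ (P.trivAt_mem b) he (P.mem_baseSet_trivAt b) (hUe hb),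
      P.hasFibrePrimitive_transition hN₀ he (P.trivAt_mem b) (hUe hb) (P.mem_baseSet_trivAt b)⟩
  refine ⟨U, hUo, hbU, _, he, hUe, γ, fun x hx => ⟨(hγ x hx).1, (hγ x hx).2.1, fun hxN => ?_⟩⟩
  simp only [hconst _ hx]
  exact (hγ x hx).2.2 hxN

/-- Thurston's construction relative to `N`: a closed form which is equal to `ω_N` on `N` and
whose restrictions to the fibres are cohomologous to the symplectic forms can be made symplectic
on the fibres without changing its class and its values on `N`. -/
theorem exists_sub_extD_fibrewise [FiniteDimensional ℝ EB] [T2Space B] [CompactSpace B]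
    (hN₀ : IsCodimZeroSubmanifold EF N₀)
    {τ : DForm EM M 2} (hτ : τ ∈ closedForms EM M 2) (hτN : ∀ x ∈ P.N, τ x = P.formN x)
    (hτe : ∀ b, (P.fibrePrimitives τ b).Nonempty) :
    ∃ γ : DForm EM M 1, γ.Smooth ∧ (∀ x ∈ P.N, γ.extD x = 0) ∧
      ∀ e ∈ P.atlas, ∀ b ∈ e.baseSet, DForm.pullback EF (fibreIncl e b) (τ - γ.extD) = σ₀ := by
  obtain ⟨θ, hθ⟩ := P.exists_local_primitives hN₀ hτ hτN hτe
  choose U hUo hbU e he hUe γ hγ using hθ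
  obtain ⟨t, ht⟩ := isCompact_univ.elim_finite_subcover U hUo fun b _ =>
    Set.mem_iUnion.2 ⟨b, hbU b⟩
  obtain ⟨ρ, hρ⟩ := SmoothPartitionOfUnity.exists_isSubordinate 𝓘(ℝ, EB) (s := (Set.univ : Set B))
    isClosed_univ (fun i : t => U i) (fun i => hUo i) fun b hb => by
      obtain ⟨i, hi, hbi⟩ := Set.mem_iUnion₂.1 (ht hb)
      exact Set.mem_iUnion.2 ⟨⟨i, hi⟩, hbi⟩
  have hρU : ∀ (i : t) (b : B), ρ i b ≠ 0 → b ∈ U i := fun i b h => hρ i (subset_tsupport _ h)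
  have hρsum : ∀ b, ∑ i : t, ρ i b = 1 := fun b => by
    rw [← finsum_eq_sum_of_fintype]; exact ρ.sum_eq_one (Set.mem_univ b)
  let Γ : DForm EM M 1 := ∑ i : t, DForm.fsmul (fun x => ρ i (p x)) (γ i)
  have hΓa : ∀ x, Γ x = ∑ i : t, ρ i (p x) • γ i x := fun x => DForm.sum_apply _ _ x
  have hΓ : Γ.Smooth := by
    refine DForm.smooth_sum_fsmul (fun i _ => (ρ i).contMDiff.comp P.contMDiff_proj)
      fun i _ x hx => (hγ i x (hρ i ?_)).1
    exact tsupport_comp_subset_preimage (ρ i) P.contMDiff_proj.continuous hx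
  refine ⟨Γ, hΓ, fun x hx => ?_, fun e' he' b hb => ?_⟩
  -- Near `x` all `γ i` that contribute agree on `N` with `γ (p x)`, and the weights sum to one, so
  -- `Γ = γ (p x)` on `N`. Therefore `dΓ = τ - q^*σ₀ = 0` on `N`, without computing the terms with
  -- `dρ_i`.
  · have h1 : Γ.extD x = (γ (p x)).extD x := by
      refine DForm.extD_eq_of_eqOn (hΓ x) (hγ (p x) x (hbU _)).1 hx
        (P.uniqueMDiffWithinAt_N hN₀ hx) ?_
      filter_upwards [P.contMDiff_proj.continuous.continuousAt.eventually
        ((hUo (p x)).mem_nhds (hbU (p x)))] with y hy hyN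
      have h2 : ∀ i : t, ρ i (p y) • γ i y = ρ i (p y) • γ (p x) y := by
        intro i
        by_cases h0 : ρ i (p y) = 0
        · rw [h0]
          exact (zero_smul ℝ (show EM [⋀^Fin 1]→L[ℝ] ℝ from γ i y)).trans
            (zero_smul ℝ (show EM [⋀^Fin 1]→L[ℝ] ℝ from γ (p x) y)).symm
        · have hyi := hρU i _ h0
          rw [(hγ i y hyi).2.2 hyN, (hγ (p x) y hy).2.2 hyN,
            P.pullback_fibreCoord_eq hN₀ (he i) (he (p x))
              ((e i).mem_source.2 (hUe i hyi)) ((e (p x)).mem_source.2 (hUe _ hy)) hyN]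
      rw [hΓa]
      simp only [h2]
      have h3 : ∑ i : t, ρ i (p y) • (show EM [⋀^Fin 1]→L[ℝ] ℝ from γ (p x) y) =
          (show EM [⋀^Fin 1]→L[ℝ] ℝ from γ (p x) y) := by
        rw [← Finset.sum_smul, hρsum, one_smul]
      exact h3
    have hxe : x ∈ (e (p x)).source := (e (p x)).mem_source.2 (hUe _ (hbU _))
    rw [h1, (hγ (p x) x (hbU _)).2.1, hτN x hx, P.formN_eq_pullback hN₀ (he _) hxe hx]
    exact sub_self (G := EM [⋀^Fin 2]→L[ℝ] ℝ) _
  · have hι := P.contMDiff_fibreIncl he' hb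
    -- On the fibre over `b` each `ρ i ∘ p` is the constant `ρ i b`, so restriction to the fibre
    -- produces no derivatives of `ρ`.
    have hpull : DForm.pullback EF (fibreIncl e' b) Γ =
        ∑ i : t, ρ i b • DForm.pullback EF (fibreIncl e' b) (γ i) := by
      rw [DForm.pullback_sum]
      refine Finset.sum_congr rfl fun i _ => funext fun y => ?_
      have h1 : p (fibreIncl e' b y) = b := proj_fibreIncl hb y
      ext v
      change ρ i (p (fibreIncl e' b y)) * _ = ρ i b * _
      rw [h1]
      rfl
    have hsm : ∀ i : t, ∀ y, DForm.SmoothAt (ρ i b • DForm.pullback EF (fibreIncl e' b) (γ i)) y := by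
      intro i y
      -- Away from `U i` nothing is known about `γ i`; only its product with the weight `0` occurs
      -- there.
      by_cases h0 : ρ i b = 0
      · rw [h0, zero_smul]
        exact .zero y
      · exact ((hγ i _ (by rw [proj_fibreIncl hb]; exact hρU i b h0)).1.pullback (hι y)).smul _
    funext y
    have h1 : DForm.pullback EF (fibreIncl e' b) Γ.extD y = ∑ i : t, ρ i b •
        (DForm.pullback EF (fibreIncl e' b) τ - σ₀) y := by
      rw [← DForm.extD_pullback (hΓ _) (hι y), hpull, DForm.extD_sum_apply fun i _ => hsm i y]
      refine Finset.sum_congr rfl fun i _ => ?_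
      rw [DForm.extD_smul_apply]
      by_cases h0 : ρ i b = 0
      · rw [h0]
        exact (zero_smul ℝ (_ : EF [⋀^Fin 2]→L[ℝ] ℝ)).trans
          (zero_smul ℝ (_ : EF [⋀^Fin 2]→L[ℝ] ℝ)).symm
      · have hbi := hρU i b h0
        have hpy : p (fibreIncl e' b y) ∈ U i := by rwa [proj_fibreIncl hb]
        have h2 : DForm.pullback EF (fibreIncl e' b) (γ i).extD y = DForm.pullback EF
            (fibreIncl e' b) (τ - DForm.pullback EM (fibreCoord (e i)) σ₀) y :=
          DForm.pullback_apply_congr (hγ i _ hpy).2.1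
        rw [DForm.extD_pullback (hγ i _ hpy).1 (hι y), h2, DForm.pullback_sub,
          P.pullback_fibreIncl_fibreCoord_symplectic he' (he i) hb (hUe i hbi)]
    have h3 : ∑ i : t, ρ i b • (show EF [⋀^Fin 2]→L[ℝ] ℝ from
        (DForm.pullback EF (fibreIncl e' b) τ - σ₀) y) =
          (DForm.pullback EF (fibreIncl e' b) τ - σ₀) y := by
      rw [← Finset.sum_smul, hρsum, one_smul]
    rw [DForm.pullback_sub, DForm.sub_apply, h1.trans h3, DForm.sub_apply]
    exact sub_sub_cancel (G := EF [⋀^Fin 2]→L[ℝ] ℝ) _ _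

omit [IsManifold 𝓘(ℝ, EB) ∞ B] [FiniteDimensional ℝ EF] in
/-- A closed form whose restriction to `N` is cohomologous to `ω_N` can be made equal to `ω_N`
on `N`. -/
theorem exists_sub_extD_eq_formN [T2Space F] [T2Space M] [CompactSpace M] (hN₀c : IsCompact N₀)
    (hN₀ : IsCodimZeroSubmanifold EF N₀) {τ : DForm EM M 2}
    (hτ : τ - P.formN ∈ exactFormsOn EM P.N 1) :
    ∃ β : DForm EM M 1, β.Smooth ∧ ∀ x ∈ P.N, (τ - β.extD) x = P.formN x := by
  obtain ⟨β, hβ⟩ := hτ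
  have hNc : IsClosed P.N := P.isClosed_N hN₀c.isClosed
  -- The convex constraint is the single value `β y` on `N` and empty off `N`; closedness of `N`
  -- lets the zero form serve as the local solution elsewhere.
  obtain ⟨β', hβ's, hβ'⟩ := DForm.exists_smooth_forall_mem_convex (E := EM) (M := M) (k := 1)
    (fun y => {η | y ∈ P.N → η = (show EM [⋀^Fin 1]→L[ℝ] ℝ from β y)}) (fun y => by
      by_cases hy : y ∈ P.N
      · simp only [hy, true_imp_iff]
        exact convex_singleton _
      · simp only [hy, false_imp_iff, Set.ofPred_true]
        exact convex_univ) fun x => by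
      by_cases hx : x ∈ P.N
      · obtain ⟨β', h⟩ := hβ x hx
        exact ⟨β', h.mono fun y hy => ⟨hy.1, fun hyN => (hy.2 hyN).1⟩⟩
      · refine ⟨0, ?_⟩
        filter_upwards [hNc.isOpen_compl.mem_nhds hx] with y hy
        exact ⟨.zero y, fun hyN => absurd hyN hy⟩
  refine ⟨β', hβ's, fun x hx => ?_⟩
  obtain ⟨β'', h⟩ := hβ x hx
  -- The global form and the local extension agree only on `N`, which determines the differential
  -- there.
  have h1 : β'.extD x = β''.extD x := by
    refine DForm.extD_eq_of_eqOn (hβ's x) h.self_of_nhds.1 hx (P.uniqueMDiffWithinAt_N hN₀ hx) ?_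
    filter_upwards [h] with y hy hyN
    exact (hβ' y hyN).trans (hy.2 hyN).1.symm
  rw [DForm.sub_apply, h1, (h.self_of_nhds.2 hx).2, DForm.sub_apply]
  exact sub_sub_cancel (G := EM [⋀^Fin 2]→L[ℝ] ℝ) _ _

end SymplecticFibration

end FibrewiseSymplectic

end

theorem mainTheorem8
    {EB : Type*} [NormedAddCommGroup EB] [NormedSpace ℝ EB] [FiniteDimensional ℝ EB]
    {B : Type*} [TopologicalSpace B] [ChartedSpace EB B] [IsManifold 𝓘(ℝ, EB) ∞ B]
    [T2Space B] [CompactSpace B]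
    {EF : Type*} [NormedAddCommGroup EF] [NormedSpace ℝ EF] [FiniteDimensional ℝ EF]
    {F : Type*} [TopologicalSpace F] [ChartedSpace EF F] [IsManifold 𝓘(ℝ, EF) ∞ F]
    [T2Space F] [CompactSpace F]
    {EM : Type*} [NormedAddCommGroup EM] [NormedSpace ℝ EM] [FiniteDimensional ℝ EM]
    {M : Type*} [TopologicalSpace M] [ChartedSpace EM M] [IsManifold 𝓘(ℝ, EM) ∞ M]
    [T2Space M]
    (σ₀ : DForm EF F 2) (hσ₀ : IsSymplectic σ₀)
    (N₀ : Set F) (hN₀c : IsCompact N₀) (hN₀ : IsCodimZeroSubmanifold EF N₀)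
    (p : M → B) (P : SymplecticFibration EB EM p σ₀ N₀)
    (σB : DForm EB B 2) (hσB : IsPresymplectic σB)
    (u : H2 EM M)
    (hu_fibre : ∀ e, ∀ he : e ∈ P.atlas, ∀ b, ∀ hb : b ∈ e.baseSet,
      H2.pullback (SymplecticFibration.fibreIncl e b) (P.contMDiff_fibreIncl he hb) u =
        H2.mk σ₀ hσ₀.closed)
    (hu_N : H2.restrict P.N u = H2On.mk P.formN (P.formN_mem hσ₀ hN₀)) :
    ∃ K : ℝ, 0 < K ∧ ∃ τ : DForm EM M 2, ∃ hτ : IsPresymplectic τ,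
      H2.mk τ hτ.closed = u + K • H2.pullback p P.contMDiff_proj (H2.mk σB hσB.closed) ∧
      ∀ x ∈ P.N, τ x = P.formN x + K • DForm.pullback EM p σB x := by
  have hcM : CompactSpace M := P.compactSpace
  obtain ⟨⟨τ₀, hτ₀⟩, rfl⟩ := Submodule.Quotient.mk_surjective _ u
  have h1 : τ₀ - P.formN ∈ exactFormsOn EM P.N 1 :=
    (Submodule.Quotient.eq ((exactFormsOn EM P.N 1).comap (closedFormsOn EM P.N 2).subtype)).1 hu_N
  obtain ⟨β, hβ, hβN⟩ := P.exists_sub_extD_eq_formN hN₀c hN₀ h1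
  have hβc : β.extD ∈ closedForms EM M 2 := DForm.exactForms_le_closedForms ⟨β, hβ, rfl⟩
  have hτ₁ : τ₀ - β.extD ∈ closedForms EM M 2 := sub_mem hτ₀ hβc
  have hprim : ∀ b, (P.fibrePrimitives (τ₀ - β.extD) b).Nonempty := fun b => by
    have hι := P.contMDiff_fibreIncl (P.trivAt_mem b) (P.mem_baseSet_trivAt b)
    obtain ⟨ν, hν, hdν⟩ : DForm.pullback EF (SymplecticFibration.fibreIncl (P.trivAt b) b) τ₀ - σ₀ ∈
        exactForms EF F 1 :=
      (Submodule.Quotient.eq ((exactForms EF F 1).comap (closedForms EF F 2).subtype)).1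
        (hu_fibre _ (P.trivAt_mem b) b (P.mem_baseSet_trivAt b))
    have hs : ∀ y, (DForm.pullback EF (SymplecticFibration.fibreIncl (P.trivAt b) b) β).SmoothAt y :=
      fun y => (hβ _).pullback (hι y)
    -- Subtracting the restriction of `β` accounts for the correction `dβ`. The boundary value is
    -- left as `_`: the primitive serves as its own.
    refine ⟨ν - DForm.pullback EF (SymplecticFibration.fibreIncl (P.trivAt b) b) β, _,
      fun y => (hν y).sub (hs y), funext fun y => ?_, fun y _ => rfl⟩
    rw [DForm.extD_sub_apply (hν y) (hs y), hdν, DForm.extD_pullback (hβ _) (hι y),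
      DForm.pullback_sub]
    simp only [DForm.sub_apply]
    abel
  obtain ⟨γ, hγ, hγN, hfib⟩ := P.exists_sub_extD_fibrewise hN₀ hτ₁ hβN hprim
  have hγc : γ.extD ∈ closedForms EM M 2 := DForm.exactForms_le_closedForms ⟨γ, hγ, rfl⟩
  obtain ⟨K, hK, hpre⟩ := P.exists_isPresymplectic_add hσ₀ hσB (sub_mem hτ₁ hγc) hfib
  refine ⟨K, hK, _, hpre, (Submodule.Quotient.eq _).2 ?_, fun x hx => ?_⟩
  · change τ₀ - β.extD - γ.extD + K • DForm.pullback EM p σB -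
      (τ₀ + K • DForm.pullback EM p σB) ∈ exactForms EM M 1
    -- Both corrections are exact, and the term with `K` cancels.
    have h2 : τ₀ - β.extD - γ.extD + K • DForm.pullback EM p σB -
      (τ₀ + K • DForm.pullback EM p σB) = -(β.extD + γ.extD) := by abel
    rw [h2]
    exact neg_mem (add_mem ⟨β, hβ, rfl⟩ ⟨γ, hγ, rfl⟩)
  · rw [DForm.add_apply, DForm.sub_apply, hγN x hx, hβN x hx]
    exact congrArg (fun η : EM [⋀^Fin 2]→L[ℝ] ℝ => η +
      (show EM [⋀^Fin 2]→L[ℝ] ℝ from K • DForm.pullback EM p σB x))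
      (sub_zero (G := EM [⋀^Fin 2]→L[ℝ] ℝ) _)
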